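/- **Setting.** Let $H,d\ge 1$ be integers. Consider a finite-horizon MDP with finite state space $\mathcal S=\mathcal S_1\cup\dots\cup\mathcal S_{H+1}$ (disjoint stages, $\mathcal S_1=\{s_1\}$, $\mathcal S_{H+1}=\{s_\top\}$), finite nonempty action set $\mathcal A$, transitions from $\mathcal S_h$ to $\mathcal S_{h+1}$ ($h\in[H]$), and random rewards with values in $[0,1]$ (zero at $s_\top$), independent of the next state given the current state and action. Policies are memoryless and may be randomized; $v^\pi,q^\pi$ are the expected total rewards under $\pi$ from a state, resp. a state-action pair; $q^\star=\sup_\pi q^\pi$, $v^\star(s)=\max_a q^\star(s,a)$. Let $\phi:\mathcal S\times\mathcal A\to\mathbb R^d$ with $\|\phi\|_2\le L_1$, and assume: 1. ($(\eta,L_2)$-approximate linear $q^\pi$-realizability) for every policy $\pi$ and $h\in[H+1]$ there is $\theta\in\mathbb R^d$, $\|\theta\|_2\le L_2$, with $|q^\pi(s,a)-\langle\phi(s,a),\theta\rangle|\le\eta$ for all $(s,a)\in\mathcal S_h\times\mathcal A$; 2. (trajectory data) the data are $n$ independent full-length trajectories $(s^j_h,a^j_h,r^j_h)_{h\in[H+1]}$,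 $j\in[n]$, of one unknown policy $\pi^0$ started in $s_1$; 3. (concentrability) $\mathbb P_\pi(S_h=s,A_h=a)\le C_{\rm conc}\,\mathbb P_{\pi^0}(S_h=s,A_h=a)$ for every policy $\pi$, $h\in[H]$, $(s,a)\in\mathcal S_h\times\mathcal A$ (trajectories started in $s_1$), where $C_{\rm conc}\ge1$. Let $\varepsilon\in(0,H]$, $\delta\in(0,1)$, $L_1,L_2>0$. **Learner.** Put $\alpha=\varepsilon/(12(H+1))$, $d_0=\lceil 4d\log\log d+16\rceil$ (and $d_0=16$ for $d=1$), $\tilde L_2=L_2(8H^2d_0/\alpha+1)$, $\sqrt\lambda=H^{3/2}d/\tilde L_2$, $\phi^j_h=\phi(s^j_h,a^j_h)$, $X_h=\lambda I+\sum_j\phi^j_h(\phi^j_h)^\top$, $\|x\|_X=\sqrt{x^\top Xx}$, $\bar q_\theta(s,a)=\max\{0,\min\{H,\langle\phi(s,a),\theta\rangle\}\}$ and $\bar v_\theta(s)=\max_a\bar q_\theta(s,a)$. A guess is $G=(\vartheta^i_h)_{2\le h\le H,\,i\in[d_0]}$ with $\|\vartheta^i_h\|_2\le L_2$. For $s\in\mathcal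 S_h$, $2\le h\le H$, let $\mathrm{range}^G(s)=\max_{i,a,a'}\langle\phi(s,a)-\phi(s,a'),\vartheta^i_h\rangle$ and $\omega_G(s)=\min\{1,\max\{0,\,2-\sqrt{2d}\,\mathrm{range}^G(s)/\alpha\}\}$; let $\omega_G=0$ on $\mathcal S_1\cup\mathcal S_{H+1}$. For $h\in[H]$ and $\theta_{h+1},\dots,\theta_{H+1}\in\mathbb R^d$ let $$\hat\theta_h(G,\theta_{h+1:H+1})=X_h^{-1}\sum_{j}\phi^j_h\sum_{t=h+1}^{H+1}(1-\omega_G(s^j_t))\prod_{u=h+1}^{t-1}\omega_G(s^j_u)\Big[\sum_{u=h}^{t-1}r^j_u+\bar v_{\theta_t}(s^j_t)\Big].$$ Let $\Theta_{G,H+1}=\{0\}$ and, for $h=H,\dots,1$, let $\Theta_{G,h}$ be the set of all $\theta$ with $\|\theta\|_2\le\tilde L_2$ and $\|\theta-\hat\theta_h(G,\theta_{h+1:H+1})\|_{X_h}\le\beta$ for some $\theta_{h+1:H+1}\in\Theta_{G,h+1}\times\dots\times\Theta_{G,H+1}$. The optimization problem is to maximize $\bar v_{\theta_1}(s_1)$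 over all guesses $G$ and $\theta_{1:H+1}\in\Theta_{G,1}\times\dots\times\Theta_{G,H+1}$ such that $$\frac1n\sum_{j}\Big(\sup_{\theta\in\Theta_{G,h}}\bar q_\theta(s^j_h,a^j_h)-\inf_{\theta\in\Theta_{G,h}}\bar q_\theta(s^j_h,a^j_h)\Big)\le\bar\varepsilon\qquad\text{for all }h\in[H].$$ Given a solution $(G',\theta'_{1:H+1})$, the output $\pi'$ is a deterministic policy which in every $s\in\mathcal S_h$ takes an action that maximizes $\bar q_{\theta'_h}(s,\cdot)$ (ties broken arbitrarily). **Theorem.** Let $\ell=1+\log(1+\tfrac1\varepsilon)+\log\tfrac1\delta+\log H+\log d+\log C_{\rm conc}+\log(1+L_1)+\log(1+L_2)$. There are universal constants $c_\beta,c_\varepsilon,c_n>0$ and $k_\beta,k_\varepsilon,k_n\in\mathbb N$ such that for all $c_n'\in\mathbb R$, $k_n'\in\mathbb N$ there are $c_\eta>0$, $k_\eta\in\mathbb N$ with the following property. Suppose that all the above assumptions hold, that $$c_n\ell^{k_n}\,\frac{C_{\rm conc}^4H^7d^4}{\varepsilon^2}\le n\le c_n'\ell^{k_n'}\,\frac{C_{\rm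 conc}^4H^7d^4}{\varepsilon^2},\qquad 0\le\eta\le\frac{1}{c_\eta\ell^{k_\eta}}\cdot\frac{\varepsilon^2}{C_{\rm conc}^2H^5d^2},$$ and that the learner uses $\beta=c_\beta(\ell+\log n)^{k_\beta}H^{3/2}d$ and $\bar\varepsilon=c_\varepsilon(\ell+\log n)^{k_\varepsilon}C_{\rm conc}H^{5/2}d^2/\sqrt n$. Then, with probability at least $1-\delta$, the optimization problem is feasible, and for each of its solutions, and more generally for each feasible point whose objective value is within $\varepsilon/12$ of the supremum, every output policy $\pi'$ satisfies $$v^\star(s_1)-v^{\pi'}(s_1)\le\varepsilon .$$ None of the constants depends on the MDP, in particular on the sizes of $\mathcal S$ and $\mathcal A$. -/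

import Mathlib

open MeasureTheory
open scoped ENNReal

noncomputable section

namespace OfflineRL

/-- Vectors of `ℝ^d` with the Euclidean norm. -/
abbrev Vec (d : ℕ) : Type := EuclideanSpace ℝ (Fin d)

/-- Memoryless (possibly randomized) policies. -/
abbrev Policy (S A : Type*) : Type _ := S → PMF A

/-- `k + 1` consecutive steps of an episode, each of them a state, an action and a reward. -/
abbrev Traj (S A : Type*) (k : ℕ) : Type _ := Fin (k + 1) → (S × A) × ℝ

/-- A finite-horizon MDP whose states are organized in the stages `1, …, H + 1`, with a single
initial state and a single terminal state. The value of `trans` at the terminal state is never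
used. -/
structure MDP (S A : Type*) (H : ℕ) where
  stage : S → ℕ
  start : S
  term : S
  one_le_stage : ∀ s, 1 ≤ stage s
  stage_le : ∀ s, stage s ≤ H + 1
  stage_eq_one : ∀ s, stage s = 1 ↔ s = start
  stage_eq_last : ∀ s, stage s = H + 1 ↔ s = term
  trans : S → A → PMF S
  stage_trans : ∀ s a s', stage s ≤ H → s' ∈ (trans s a).support → stage s' = stage s + 1
  reward : S → A → Measure ℝ
  reward_prob : ∀ s a, IsProbabilityMeasure (reward s a)
  reward_mem : ∀ s a, ∀ᵐ r ∂(reward s a), r ∈ Set.Icc (0 : ℝ) 1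
  reward_term : ∀ a, reward term a = Measure.dirac 0

section Environment

variable {S A : Type*} [Fintype S] [Fintype A] [MeasurableSpace S] [MeasurableSpace A] {H : ℕ}

/-- Probability of the state-action sequence `z`, when the first pair has law `ν` and the policy
`π` is followed afterwards. -/
def pathProb (M : MDP S A H) (π : Policy S A) (ν : PMF (S × A)) {k : ℕ}
    (z : Fin (k + 1) → S × A) : ℝ≥0∞ :=
  ν (z 0) * ∏ i : Fin k,
    (M.trans (z i.castSucc).1 (z i.castSucc).2 (z i.succ).1 * π (z i.succ).1 (z i.succ).2)

/-- Law of the trajectory of `k + 1` steps whose first state-action pair has law `ν` and that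
follows `π` afterwards. Given the states and actions, the rewards are independent. -/
def trajLaw (M : MDP S A H) (π : Policy S A) (ν : PMF (S × A)) (k : ℕ) :
    Measure (Traj S A k) :=
  ∑ z : Fin (k + 1) → S × A, pathProb M π ν z •
    (Measure.pi fun i => M.reward (z i).1 (z i).2).map (fun r i => (z i, r i))

/-- Law of `(s, A)` with `A ∼ π(s)`. -/
def firstPair (π : Policy S A) (s : S) : PMF (S × A) := (π s).map fun a => (s, a)

/-- Law of the full-length trajectory (stages `1, …, H + 1`) of `π` from the initial state.
Step `i` (counted from zero) belongs to stage `i + 1`. -/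
def startLaw (M : MDP S A H) (π : Policy S A) : Measure (Traj S A H) :=
  trajLaw M π (firstPair π M.start) H

/-- `v^π(s)`: expected sum of the rewards of the stages `stage s, …, H` under `π` from `s`. -/
def vPi (M : MDP S A H) (π : Policy S A) (s : S) : ℝ :=
  ∫ T, ∑ i : Fin (H + 1 - M.stage s), (T i.castSucc).2
    ∂(trajLaw M π (firstPair π s) (H + 1 - M.stage s))

/-- `q^π(s, a)`: the same, when the first action is `a`. -/
def qPi (M : MDP S A H) (π : Policy S A) (s : S) (a : A) : ℝ :=
  ∫ T, ∑ i : Fin (H + 1 - M.stage s), (T i.castSucc).2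
    ∂(trajLaw M π (PMF.pure (s, a)) (H + 1 - M.stage s))

/-- `q^⋆(s, a)`. -/
def qStar (M : MDP S A H) (s : S) (a : A) : ℝ := ⨆ π : Policy S A, qPi M π s a

/-- `v^⋆(s)`. -/
def vStar (M : MDP S A H) (s : S) : ℝ := ⨆ a : A, qStar M s a

/-- The MDP with feature map `φ` is `(η, L₂)`-approximately linearly `q^π`-realizable. -/
def ApproxRealizable (M : MDP S A H) {d : ℕ} (φ : S → A → Vec d) (η L₂ : ℝ) : Prop :=
  ∀ π : Policy S A, ∀ h : ℕ, 1 ≤ h → h ≤ H + 1 →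
    ∃ θ : Vec d, ‖θ‖ ≤ L₂ ∧
      ∀ s a, M.stage s = h → |qPi M π s a - inner ℝ (φ s a) θ| ≤ η

/-- Law of the state-action pair of each of the stages `1, …, H` (`t : Fin H` is stage `t + 1`)
when `π` is run from the initial state. -/
def occupancy (M : MDP S A H) (π : Policy S A) (t : Fin H) (z : S × A) : ℝ≥0∞ :=
  startLaw M π {T | (T t.castSucc).1 = z}

/-- Admissible sequences of state-action distributions. -/
def Admissible (M : MDP S A H) (ν : Fin H → S × A → ℝ≥0∞) : Prop :=
  ∃ π : Policy S A, ∀ t z, ν t z = occupancy M π t z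

/-- Concentrability of the policy `π₀` with coefficient `C`. -/
def Concentrable (M : MDP S A H) (π₀ : Policy S A) (C : ℝ) : Prop :=
  ∀ ν : Fin H → S × A → ℝ≥0∞, Admissible M ν →
    ∀ t z, ν t z ≤ ENNReal.ofReal C * occupancy M π₀ t z

/-- Law of `n` independent full-length trajectories of `π₀` from the initial state. -/
def dataLaw (M : MDP S A H) (π₀ : Policy S A) (n : ℕ) : Measure (Fin n → Traj S A H) :=
  Measure.pi fun _ => startLaw M π₀

end Environment

/-- The problem parameters, all of them known to the learner. -/
structure Params where
  H : ℕ
  d : ℕ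
  ε : ℝ
  δ : ℝ
  C : ℝ
  L₁ : ℝ
  L₂ : ℝ

namespace Params

variable (p : Params)

/-- The standing conditions on the problem parameters. -/
def Valid : Prop :=
  1 ≤ p.H ∧ 1 ≤ p.d ∧ 0 < p.ε ∧ p.ε ≤ p.H ∧ 0 < p.δ ∧ p.δ < 1 ∧ 1 ≤ p.C ∧ 0 < p.L₁ ∧ 0 < p.L₂

/-- Sum of the logarithms of the problem parameters; at least `1` for valid parameters.
Polylogarithmic factors are the expressions `c * p.logs ^ k`. -/
def logs : ℝ :=
  1 + Real.log (1 + 1 / p.ε) + Real.log (1 / p.δ) + Real.log p.H + Real.log p.d + Real.log p.C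
    + Real.log (1 + p.L₁) + Real.log (1 + p.L₂)

/-- `C⁴ H⁷ d⁴ / ε²`. -/
def sampleRate : ℝ := p.C ^ 4 * (p.H : ℝ) ^ 7 * (p.d : ℝ) ^ 4 / p.ε ^ 2

/-- `ε² / (C² H⁵ d²)`. -/
def misspecRate : ℝ := p.ε ^ 2 / (p.C ^ 2 * (p.H : ℝ) ^ 5 * (p.d : ℝ) ^ 2)

/-- The skipping threshold `α`. -/
def alpha : ℝ := p.ε / (12 * ((p.H : ℝ) + 1))

/-- `d₀ = ⌈4 d log log d + 16⌉`, which is `16` for `d = 1` (as `Real.log 0 = 0`). -/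
def d₀ : ℕ := ⌈4 * (p.d : ℝ) * Real.log (Real.log p.d) + 16⌉₊

/-- The radius `L̃₂` of the parameter balls of the learner. -/
def L₂' : ℝ := p.L₂ * (8 * (p.H : ℝ) ^ 2 * p.d₀ / p.alpha + 1)

/-- The regularization `λ`. -/
def lam : ℝ := ((p.H : ℝ) ^ (3 / 2 : ℝ) * p.d / p.L₂') ^ 2

/-- `β = Õ(H^{3/2} d)` with polylogarithmic factor `c (logs + log n) ^ k`. -/
def beta (c : ℝ) (k n : ℕ) : ℝ :=
  c * (p.logs + Real.log n) ^ k * ((p.H : ℝ) ^ (3 / 2 : ℝ) * p.d)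

/-- `ε̄ = Õ(C H^{5/2} d² / √n)` with polylogarithmic factor `c (logs + log n) ^ k`. -/
def epsBar (c : ℝ) (k n : ℕ) : ℝ :=
  c * (p.logs + Real.log n) ^ k *
    (p.C * (p.H : ℝ) ^ (5 / 2 : ℝ) * (p.d : ℝ) ^ 2 / Real.sqrt n)

end Params

/-- Clipping to `[0, H]`. -/
def clip (H : ℕ) (x : ℝ) : ℝ := max 0 (min (H : ℝ) x)

/-- The weighted norm `‖x‖_X = √(xᵀ X x)`. -/
def wnorm {d : ℕ} (X : Matrix (Fin d) (Fin d) ℝ) (x : Vec d) : ℝ :=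
  Real.sqrt (x.ofLp ⬝ᵥ X.mulVec x.ofLp)

/-! The learner. It uses the stages of the states, the features and the data, but neither the
transition law nor the reward law nor the data collection policy. Families indexed by stages are
functions of `h : ℕ`, and only their values at the stages named in the text matter. A guess is
`G : ℕ → Fin d₀ → ℝ^d`, used at the stages `2, …, H`. -/

section Learner

variable {S A : Type*} (p : Params) (stage : S → ℕ) (φ : S → A → Vec p.d)

/-- `q̄_θ(s, a)`. -/
def qBar (θ : Vec p.d) (s : S) (a : A) : ℝ := clip p.H (inner ℝ (φ s a) θ)

/-- `v̄_θ(s)`. -/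
def vBar (θ : Vec p.d) (s : S) : ℝ := clip p.H (⨆ a : A, inner ℝ (φ s a) θ)

/-- `range^G(s)`. -/
def rangeG (G : ℕ → Fin p.d₀ → Vec p.d) (s : S) : ℝ :=
  ⨆ x : Fin p.d₀ × A × A, inner ℝ (φ s x.2.1 - φ s x.2.2) (G (stage s) x.1)

open Classical in
/-- The skipping probability `ω_G(s)`. -/
def omega (G : ℕ → Fin p.d₀ → Vec p.d) (s : S) : ℝ :=
  if stage s = 1 ∨ stage s = p.H + 1 then 0
  else if rangeG p stage φ G s ≤ p.alpha / Real.sqrt (2 * p.d) then 1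
  else if rangeG p stage φ G s ≤ 2 * p.alpha / Real.sqrt (2 * p.d) then
    2 - Real.sqrt (2 * p.d) * rangeG p stage φ G s / p.alpha
  else 0

/-- The step of a full-length trajectory that belongs to stage `h ∈ {1, …, H + 1}`. -/
def stepAt {H : ℕ} (T : Traj S A H) (h : ℕ) : (S × A) × ℝ :=
  T ⟨min (h - 1) H, Nat.lt_succ_of_le (Nat.min_le_right _ _)⟩

/-- `F_{G, T, h}(τ = t) = (1 - ω_G(s_t)) ∏_{u = h}^{t - 1} ω_G(s_u)`. -/
def stopProb (G : ℕ → Fin p.d₀ → Vec p.d) (T : Traj S A p.H) (h t : ℕ) : ℝ :=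
  (1 - omega p stage φ G (stepAt T t).1.1) *
    ∏ u ∈ Finset.Ico h t, omega p stage φ G (stepAt T u).1.1

/-- The least-squares target
`E_{τ ∼ F_{G, T, h + 1}} [r_h + ⋯ + r_{τ - 1} + v̄_{θ_{h + 1 : H + 1}}(s_τ)]`. -/
def target (G : ℕ → Fin p.d₀ → Vec p.d) (T : Traj S A p.H) (h : ℕ) (θ : ℕ → Vec p.d) : ℝ :=
  ∑ t ∈ Finset.Icc (h + 1) (p.H + 1), stopProb p stage φ G T (h + 1) t *
    (∑ u ∈ Finset.Ico h t, (stepAt T u).2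
      + vBar p φ (θ (stage (stepAt T t).1.1)) (stepAt T t).1.1)

variable {n : ℕ} (D : Fin n → Traj S A p.H)

/-- `φ_h^j`. -/
def feat (j : Fin n) (h : ℕ) : Vec p.d := φ (stepAt (D j) h).1.1 (stepAt (D j) h).1.2

/-- `X_h = λ I + ∑_j φ_h^j (φ_h^j)ᵀ`. -/
def gram (h : ℕ) : Matrix (Fin p.d) (Fin p.d) ℝ :=
  p.lam • (1 : Matrix (Fin p.d) (Fin p.d) ℝ)
    + ∑ j, Matrix.vecMulVec (feat p φ D j h).ofLp (feat p φ D j h).ofLp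

/-- The least-squares predictor of stage `h` based on `θ_{h + 1 : H + 1}`. -/
def lsEstimate (G : ℕ → Fin p.d₀ → Vec p.d) (h : ℕ) (θ : ℕ → Vec p.d) : Vec p.d :=
  WithLp.toLp 2 ((gram p φ D h)⁻¹.mulVec
    (∑ j, target p stage φ G (D j) h θ • feat p φ D j h).ofLp)

/-- The confidence set `Θ_{G, h}`: the parameters of norm at most `L̃₂` whose distance to some
least-squares predictor based on a sequence in `Θ_{G, h + 1} × ⋯ × Θ_{G, H + 1}` is at most `β`
in the norm of `X_h`; and `Θ_{G, H + 1} = {0}`. -/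
def Theta (β : ℝ) (G : ℕ → Fin p.d₀ → Vec p.d) (h : ℕ) : Set (Vec p.d) :=
  if h ≤ p.H then
    {x | ‖x‖ ≤ p.L₂' ∧ ∃ θ : ℕ → Vec p.d,
      (∀ u, h < u → u ≤ p.H + 1 → θ u ∈ Theta β G u) ∧
      wnorm (gram p φ D h) (x - lsEstimate p stage φ D G h θ) ≤ β}
  else {0}
termination_by p.H + 1 - h

/-- The constraints of the optimization problem for the guess `G` and the parameters `θ`. -/
def Feasible (β εbar : ℝ) (G : ℕ → Fin p.d₀ → Vec p.d) (θ : ℕ → Vec p.d) : Prop :=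
  (∀ h, 2 ≤ h → h ≤ p.H → ∀ i, ‖G h i‖ ≤ p.L₂) ∧
  (∀ h, 1 ≤ h → h ≤ p.H + 1 → θ h ∈ Theta p stage φ D β G h) ∧
  ∀ h, 1 ≤ h → h ≤ p.H →
    (1 / (n : ℝ)) * ∑ j : Fin n,
      ((⨆ x : Theta p stage φ D β G h,
          qBar p φ x.1 (stepAt (D j) h).1.1 (stepAt (D j) h).1.2)
        - ⨅ x : Theta p stage φ D β G h,
          qBar p φ x.1 (stepAt (D j) h).1.1 (stepAt (D j) h).1.2) ≤ εbar

/-- `(G, θ)` is a solution of the optimization problem up to `κ`: it is feasible, and no feasible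
point has an objective value that is larger by more than `κ`. For `κ = 0` this is an exact
solution. -/
def IsSolution (s₁ : S) (β εbar κ : ℝ) (G : ℕ → Fin p.d₀ → Vec p.d) (θ : ℕ → Vec p.d) : Prop :=
  Feasible p stage φ D β εbar G θ ∧
  ∀ G' θ', Feasible p stage φ D β εbar G' θ' → vBar p φ (θ' 1) s₁ ≤ vBar p φ (θ 1) s₁ + κ

/-- `π` is the deterministic policy that is greedy with respect to `q̄_{θ_{1 : H + 1}}`, for some
way of breaking ties. -/
def IsGreedy (θ : ℕ → Vec p.d) (π : Policy S A) : Prop :=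
  ∃ g : S → A, (∀ s a, qBar p φ (θ (stage s)) s a ≤ qBar p φ (θ (stage s)) s (g s)) ∧
    π = fun s => PMF.pure (g s)

end Learner

end OfflineRL

end

/-! A guess $G$ defines policies that skip: in a state $s$, with probability $\omega_G(s)$ the data
policy $\pi^0$ acts, and otherwise a best action is taken. Since the data are full trajectories of
$\pi^0$, the return up to the first state that is not skipped is observed, and its conditional mean
is a backward recursion (`integral_stopReturn`).

Skipping makes the regression problem linear. Realizability says nothing about the backup of an
arbitrary clipped function. But let $f$ be a function of the states of one stage that is dominated
by the gap between two action values of some policy. Mixing the two actions in proportion to $f$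
turns the propagation of $f$ along $\pi^0$ into a difference of two action-value functions, which is
approximately linear (`exists_difference`). If $G$ consists of parameters that realize policies,
every state that is not skipped with certainty has such a gap, and so the means of all targets are
approximately linear (`targetMean_linear`). If $G$ is moreover a near-optimal design among the
realizing parameters (`exists_design`), a small range means small gaps for every policy, and
skipping loses at most $3\alpha$ per stage (`vStar_le_of_design`).

Two facts about the confidence sets carry the argument. For every guess, good or bad, they contain
parameters of the policy $\sigma$ that is greedy outside the skipped part, because the targets built
from these parameters have means close to $q^\sigma$ (`exists_realizing_mem_Theta`). For the good
guess they are narrow: widths obey a recursion driven by elliptical bonuses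
(`abs_qBar_sub_le_widthBound`); along $\pi^0$ it is controlled by concentrability
(`widthBound_occE_le`), and the bonuses average to order $\sqrt{d/n}$ (`empE_bonus_le`). Hence the
good guess is feasible.

At any feasible point the constraint makes $\bar q_{\theta'}$ close to the action values of some
true policy $\sigma'$, on average along every policy. So the greedy policy is nearly as good as
$\sigma'$ (`performance_difference`), and the objective hardly overestimates $v^{\sigma'}(s_1)$.
Near-optimality of the objective compares it with the good guess, hence with $v^\star$
(`vStar_sub_vPi_le`).

All statistical statements come from a Chernoff bound at each point of a grid of parameters and a
Lipschitz estimate between grid points (`uniform_chernoff`). The number of parameters is polynomial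
in $H$ and $d$ and does not involve the sizes of the state and action sets. -/

noncomputable section

set_option linter.unusedSectionVars false

namespace OfflineRL

/-! ### Regularized Gram matrices, leverages and approximate optimal designs. -/

section LinearAlgebra

open Matrix

variable {ι : Type*} {d : ℕ}

/-- Regularized Gram matrix of a finite family of vectors. -/
def regGram (μ : ℝ) (x : ι → Fin d → ℝ) (s : Finset ι) : Matrix (Fin d) (Fin d) ℝ :=
  μ • (1 : Matrix (Fin d) (Fin d) ℝ) + ∑ j ∈ s, vecMulVec (x j) (x j)

theorem inner_eq_dot (x y : Vec d) : inner ℝ x y = x.ofLp ⬝ᵥ y.ofLp := by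
  rw [EuclideanSpace.inner_eq_star_dotProduct, dotProduct_comm]
  simp

theorem regGram_mulVec (μ : ℝ) (x : ι → Fin d → ℝ) (s : Finset ι) (w : Fin d → ℝ) :
    regGram μ x s *ᵥ w = μ • w + ∑ j ∈ s, (x j ⬝ᵥ w) • x j := by
  simp only [regGram, add_mulVec, smul_mulVec, one_mulVec, Matrix.sum_mulVec, vecMulVec_mulVec, op_smul_eq_smul]

theorem dot_regGram (μ : ℝ) (x : ι → Fin d → ℝ) (s : Finset ι) (v w : Fin d → ℝ) :
    v ⬝ᵥ regGram μ x s *ᵥ w = μ * (v ⬝ᵥ w) + ∑ j ∈ s, (x j ⬝ᵥ v) * (x j ⬝ᵥ w) := by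
  rw [regGram_mulVec, dotProduct_add, dotProduct_smul, dotProduct_sum]
  congr 1
  refine Finset.sum_congr rfl fun j _ => ?_
  rw [dotProduct_smul, dotProduct_comm v, smul_eq_mul, mul_comm]

theorem regGram_posDef {μ : ℝ} (hμ : 0 < μ) (x : ι → Fin d → ℝ) (s : Finset ι) :
    (regGram μ x s).PosDef := by
  refine Matrix.PosDef.of_dotProduct_mulVec_pos ?_ ?_
  · rw [Matrix.IsHermitian]
    simp only [regGram, conjTranspose_add, conjTranspose_smul, conjTranspose_one,
      conjTranspose_sum, conjTranspose_vecMulVec, star_trivial]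
  · intro v hv
    rw [star_trivial, dot_regGram]
    have h1 : 0 < v ⬝ᵥ v := by
      have := dotProduct_star_self_pos_iff.2 hv
      simpa using this
    have h2 : 0 ≤ ∑ j ∈ s, (x j ⬝ᵥ v) * (x j ⬝ᵥ v) :=
      Finset.sum_nonneg fun j _ => mul_self_nonneg _
    positivity

theorem regGram_det_pos {μ : ℝ} (hμ : 0 < μ) (x : ι → Fin d → ℝ) (s : Finset ι) :
    0 < (regGram μ x s).det := (regGram_posDef hμ x s).det_pos

theorem regGram_mulVec_inv {μ : ℝ} (hμ : 0 < μ) (x : ι → Fin d → ℝ) (s : Finset ι)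
    (v : Fin d → ℝ) : regGram μ x s *ᵥ ((regGram μ x s)⁻¹ *ᵥ v) = v := by
  rw [mulVec_mulVec, mul_nonsing_inv _ (regGram_det_pos hμ x s).ne'.isUnit, one_mulVec]

theorem regGram_self_nonneg {μ : ℝ} (hμ : 0 < μ) (x : ι → Fin d → ℝ) (s : Finset ι)
    (v : Fin d → ℝ) : 0 ≤ v ⬝ᵥ regGram μ x s *ᵥ v := by
  rw [dot_regGram]
  have h1 : 0 ≤ v ⬝ᵥ v := by simpa using dotProduct_star_self_nonneg v
  have h2 : 0 ≤ ∑ j ∈ s, (x j ⬝ᵥ v) * (x j ⬝ᵥ v) :=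
    Finset.sum_nonneg fun j _ => mul_self_nonneg _
  positivity

theorem regGram_inv_nonneg {μ : ℝ} (hμ : 0 < μ) (x : ι → Fin d → ℝ) (s : Finset ι)
    (v : Fin d → ℝ) : 0 ≤ v ⬝ᵥ (regGram μ x s)⁻¹ *ᵥ v := by
  simpa using (regGram_posDef hμ x s).inv.posSemidef.dotProduct_mulVec_nonneg v

theorem regGram_cauchy {μ : ℝ} (hμ : 0 < μ) (x : ι → Fin d → ℝ) (s : Finset ι)
    (v w : Fin d → ℝ) :
    (v ⬝ᵥ regGram μ x s *ᵥ w) ^ 2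
      ≤ (v ⬝ᵥ regGram μ x s *ᵥ v) * (w ⬝ᵥ regGram μ x s *ᵥ w) := by
  set X := regGram μ x s
  have hsymm : w ⬝ᵥ X *ᵥ v = v ⬝ᵥ X *ᵥ w := by
    simp only [X, dot_regGram, dotProduct_comm w v, mul_comm]
  have key : ∀ t : ℝ, 0 ≤ (w ⬝ᵥ X *ᵥ w) * (t * t) + (2 * (v ⬝ᵥ X *ᵥ w)) * t + v ⬝ᵥ X *ᵥ v := by
    intro t
    have h := regGram_self_nonneg hμ x s (v + t • w)
    have e : (v + t • w) ⬝ᵥ X *ᵥ (v + t • w)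
        = (w ⬝ᵥ X *ᵥ w) * (t * t) + (2 * (v ⬝ᵥ X *ᵥ w)) * t + v ⬝ᵥ X *ᵥ v := by
      simp only [mulVec_add, mulVec_smul, add_dotProduct, dotProduct_add, smul_dotProduct,
        dotProduct_smul, hsymm, smul_eq_mul]
      ring
    rw [← e]; exact h
  have h := discrim_le_zero key
  rw [discrim] at h
  nlinarith

/-- Cauchy–Schwarz for the inner product of the Gram matrix $X$, applied to $e$ and $X^{-1}v$. -/
theorem dot_sq_le {μ : ℝ} (hμ : 0 < μ) (x : ι → Fin d → ℝ) (s : Finset ι)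
    (v e : Fin d → ℝ) :
    (v ⬝ᵥ e) ^ 2 ≤ (v ⬝ᵥ (regGram μ x s)⁻¹ *ᵥ v) * (e ⬝ᵥ regGram μ x s *ᵥ e) := by
  have h := regGram_cauchy hμ x s e ((regGram μ x s)⁻¹ *ᵥ v)
  rw [regGram_mulVec_inv hμ] at h
  rw [dotProduct_comm v e, mul_comm, dotProduct_comm v]
  exact h

/-- The sum is the trace of $X^{-1}(X-\mu I)$, which is $d-\mu\,\mathrm{tr}\,X^{-1}$. -/
theorem sum_leverage_le {μ : ℝ} (hμ : 0 < μ) (x : ι → Fin d → ℝ) (s : Finset ι) :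
    ∑ j ∈ s, x j ⬝ᵥ (regGram μ x s)⁻¹ *ᵥ x j ≤ d := by
  set X := regGram μ x s with hX
  have h1 : ∑ j ∈ s, x j ⬝ᵥ X⁻¹ *ᵥ x j = (X⁻¹ * (X - μ • 1)).trace := by
    have e : X - μ • (1 : Matrix (Fin d) (Fin d) ℝ) = ∑ j ∈ s, vecMulVec (x j) (x j) := by
      simp [hX, regGram]
    rw [e, Matrix.mul_sum, trace_sum]
    refine Finset.sum_congr rfl fun j _ => ?_
    rw [mul_vecMulVec, trace_vecMulVec, dotProduct_comm]
  have h2 : 0 ≤ X⁻¹.trace := (regGram_posDef hμ x s).inv.posSemidef.trace_nonneg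
  rw [h1, Matrix.mul_sub, nonsing_inv_mul _ (regGram_det_pos hμ x s).ne'.isUnit]
  rw [Matrix.mul_smul, Matrix.mul_one, trace_sub, trace_one, trace_smul, Fintype.card_fin,
    smul_eq_mul]
  nlinarith

theorem det_add_vecMulVec {X : Matrix (Fin d) (Fin d) ℝ} (hX : IsUnit X.det) (v : Fin d → ℝ) :
    (X + vecMulVec v v).det = X.det * (1 + v ⬝ᵥ X⁻¹ *ᵥ v) := by
  have h := det_add_replicateCol_mul_replicateRow (ι := Unit) hX v v
  rw [← vecMulVec_eq] at h
  rw [h]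
  congr 1
  simp [Matrix.det_unique, Matrix.mul_apply, dotProduct, mulVec, Finset.sum_mul, Finset.mul_sum]
  rw [Finset.sum_comm]
  simp only [mul_assoc]

theorem regGram_erase [DecidableEq ι] {μ : ℝ} (x : ι → Fin d → ℝ) {s : Finset ι} {i : ι} (hi : i ∈ s) :
    regGram μ x s = regGram μ x (s.erase i) + vecMulVec (x i) (x i) := by
  rw [regGram, regGram, ← Finset.sum_erase_add s _ hi, add_assoc]

/-- A family of size at least `2 d` that maximizes the determinant of its regularized Gram
matrix is a `2`-approximate optimal design. -/
theorem design_of_isMax [Fintype ι] [DecidableEq ι] {μ : ℝ} (hμ : 0 < μ) (x : ι → Fin d → ℝ)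
    (θ : Fin d → ℝ) (hcard : 2 * d ≤ Fintype.card ι) (hd : 1 ≤ d)
    (hmax : ∀ i, (regGram μ (Function.update x i θ) Finset.univ).det
      ≤ (regGram μ x Finset.univ).det) (y : Fin d → ℝ) :
    (y ⬝ᵥ θ) ^ 2 ≤ (2 * d / Fintype.card ι) * (μ * (y ⬝ᵥ y) + ∑ i, (y ⬝ᵥ x i) ^ 2) := by
  set V := regGram μ x Finset.univ with hV
  set l := θ ⬝ᵥ V⁻¹ *ᵥ θ with hl
  have hl0 : 0 ≤ l := regGram_inv_nonneg hμ x _ θ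
  -- Let $U$ be the Gram matrix without $x_i$ and $a$ the leverage of $x_i$ with respect to $U$. By
  -- the determinant lemma, maximality says that the leverage of $\theta$ with respect to $U$ is at
  -- most $a$; since $U\preceq V$, also $l\le a$. The leverage of $x_i$ with respect to $V$ is
  -- $a/(1+a)$, which increases with $a$.
  have hlev : ∀ i, l / (1 + l) ≤ x i ⬝ᵥ V⁻¹ *ᵥ x i := by
    intro i
    set U := regGram μ x (Finset.univ.erase i) with hU
    have hUd : 0 < U.det := regGram_det_pos hμ _ _
    have hVU : V = U + vecMulVec (x i) (x i) := regGram_erase x (Finset.mem_univ i)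
    have hupd : regGram μ (Function.update x i θ) Finset.univ = U + vecMulVec θ θ := by
      rw [regGram_erase _ (Finset.mem_univ i)]
      simp only [Function.update_self]
      congr 1
      simp only [hU, regGram]
      congr 1
      refine Finset.sum_congr rfl fun j hj => ?_
      rw [Function.update_of_ne (Finset.ne_of_mem_erase hj)]
    have h1 := hmax i
    rw [hupd, hVU, det_add_vecMulVec hUd.ne'.isUnit, det_add_vecMulVec hUd.ne'.isUnit] at h1
    have h2 : θ ⬝ᵥ U⁻¹ *ᵥ θ ≤ x i ⬝ᵥ U⁻¹ *ᵥ x i := by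
      have := le_of_mul_le_mul_left h1 hUd
      linarith
    set a := x i ⬝ᵥ U⁻¹ *ᵥ x i with ha
    have h3 : l ≤ θ ⬝ᵥ U⁻¹ *ᵥ θ := by
      set z := V⁻¹ *ᵥ θ with hz
      have hzl : z ⬝ᵥ V *ᵥ z = l := by
        rw [hz, regGram_mulVec_inv hμ, dotProduct_comm]
      have hzU : z ⬝ᵥ U *ᵥ z ≤ l := by
        rw [← hzl, hVU, add_mulVec, dotProduct_add, vecMulVec_mulVec]
        have : 0 ≤ z ⬝ᵥ MulOpposite.op (x i ⬝ᵥ z) • x i := by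
          rw [dotProduct_smul, dotProduct_comm z]
          simpa using mul_self_nonneg (x i ⬝ᵥ z)
        linarith
      have hu0 : 0 ≤ θ ⬝ᵥ U⁻¹ *ᵥ θ := regGram_inv_nonneg hμ x _ θ
      have h4 := dot_sq_le hμ x (Finset.univ.erase i) θ z
      rw [← hU, ← hl] at h4
      rcases hl0.eq_or_lt with h0 | h0
      · rw [← h0]; exact hu0
      · have h5 : l * l ≤ (θ ⬝ᵥ U⁻¹ *ᵥ θ) * l := by nlinarith
        exact le_of_mul_le_mul_right h5 h0
    set z := V⁻¹ *ᵥ x i with hz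
    set li := x i ⬝ᵥ z with hli
    have hUz : U *ᵥ z = (1 - li) • x i := by
      have h6 : V *ᵥ z = x i := regGram_mulVec_inv hμ x _ (x i)
      rw [hVU, add_mulVec, vecMulVec_mulVec, op_smul_eq_smul] at h6
      have h7 : U *ᵥ z = x i - li • x i := by
        rw [eq_sub_iff_add_eq]; exact h6
      rw [h7, sub_smul, one_smul]
    have hzz : z = (1 - li) • U⁻¹ *ᵥ x i := by
      rw [← mulVec_smul, ← hUz, mulVec_mulVec, nonsing_inv_mul _ hUd.ne'.isUnit, one_mulVec]
    have hali : li = (1 - li) * a := by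
      conv_lhs => rw [hli, hzz, dotProduct_smul, smul_eq_mul]
    have hal : l ≤ a := h3.trans h2
    rw [div_le_iff₀ (by linarith)]
    have h8 : li * (1 + a) = a := by linear_combination hali
    have h9 : 0 < 1 + a := by linarith
    have h10 : li = a / (1 + a) := by field_simp; linarith
    rw [h10, div_mul_eq_mul_div, le_div_iff₀ h9]
    nlinarith
  have hsum := sum_leverage_le hμ x Finset.univ
  have h11 : (Fintype.card ι : ℝ) * (l / (1 + l)) ≤ d := by
    refine le_trans ?_ hsum
    have := Finset.sum_le_sum (s := Finset.univ) fun i _ => hlev i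
    simpa using this
  have hk : (2 * d : ℝ) ≤ Fintype.card ι := by exact_mod_cast hcard
  have hd' : (1 : ℝ) ≤ d := by exact_mod_cast hd
  -- From $k\,l\le d(1+l)$, where $k\ge 2d$ gives $k-d\ge k/2$.
  have hlk : l ≤ 2 * d / Fintype.card ι := by
    rw [le_div_iff₀ (by linarith)]
    rw [← mul_div_assoc, div_le_iff₀ (by linarith)] at h11
    nlinarith
  have h12 := dot_sq_le hμ x Finset.univ θ y
  rw [← hV, ← hl, dot_regGram, dotProduct_comm θ y] at h12
  refine h12.trans (mul_le_mul hlk (le_of_eq ?_) ?_ (by positivity))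
  · congr 1
    refine Finset.sum_congr rfl fun i _ => ?_
    rw [dotProduct_comm, sq]
  · have := regGram_self_nonneg hμ x Finset.univ y
    rwa [dot_regGram] at this

/-- Every bounded set of vectors contains `k ≥ 2 d` vectors such that the inner product with each
vector of the set is, up to a small error, at most `√(2 d)` times the largest inner product with
one of these. -/
theorem exists_design {d k : ℕ} (hd : 1 ≤ d) (hk : 2 * d ≤ k) {K : Set (Vec d)}
    (hne : K.Nonempty) (hb : Bornology.IsBounded K) {τ : ℝ} (hτ : 0 < τ) :
    ∃ ϑ : Fin k → Vec d, (∀ i, ϑ i ∈ K) ∧ ∀ θ ∈ K, ∀ y : Vec d, ∀ m : ℝ,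
      (∀ i, |inner ℝ y (ϑ i)| ≤ m) → |inner ℝ y θ| ≤ Real.sqrt (2 * d) * m + τ * ‖y‖ := by
  have hd' : (1 : ℝ) ≤ d := by exact_mod_cast hd
  have hk0 : 0 < k := by omega
  have hkk : (0 : ℝ) < k := by exact_mod_cast hk0
  set c := Real.sqrt (2 * d) with hc
  have hc0 : 0 < c := Real.sqrt_pos.2 (by linarith)
  -- Half of the error $\tau\|y\|$ pays for the regularization; the other half pays for moving the
  -- maximizer from the closure of $K$ into $K$.
  set μ : ℝ := (τ / 2) ^ 2 with hμdef
  have hμ : 0 < μ := by positivity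
  -- $K$ need not be closed, so the determinant is maximized over its closure and the maximizer is
  -- then approximated by points of $K$.
  have hcomp : IsCompact (Set.univ.pi fun _ : Fin k => closure K) :=
    isCompact_univ_pi fun _ => hb.isCompact_closure
  have hne' : (Set.univ.pi fun _ : Fin k => closure K).Nonempty := by
    obtain ⟨x, hx⟩ := hne
    exact ⟨fun _ => x, fun _ _ => subset_closure hx⟩
  have hcont : Continuous fun x : Fin k → Vec d =>
      (regGram μ (fun j => (x j).ofLp) Finset.univ).det := by
    refine Continuous.matrix_det ?_
    unfold regGram
    refine continuous_const.add (continuous_finsetSum _ fun j _ => ?_)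
    have : Continuous fun x : Fin k → Vec d => (x j).ofLp := by fun_prop
    exact this.matrix_vecMulVec this
  obtain ⟨x, hxK, hxmax⟩ := hcomp.exists_isMaxOn hne' hcont.continuousOn
  have happ : ∀ i, ∃ z ∈ K, ‖x i - z‖ < τ / 2 / c := by
    intro i
    have := Metric.mem_closure_iff.1 (hxK i (Set.mem_univ i)) (τ / 2 / c) (by positivity)
    simpa [dist_eq_norm] using this
  choose ϑ hϑK hϑ using happ
  refine ⟨ϑ, hϑK, fun θ hθ y m hm => ?_⟩
  have hmax : ∀ i, (regGram μ (Function.update (fun j => (x j).ofLp) i θ.ofLp) Finset.univ).det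
      ≤ (regGram μ (fun j => (x j).ofLp) Finset.univ).det := by
    intro i
    have h1 : Function.update x i θ ∈ Set.univ.pi fun _ : Fin k => closure K := by
      intro j _
      by_cases hj : j = i
      · subst hj; simpa using subset_closure hθ
      · simpa [Function.update_of_ne hj] using hxK j (Set.mem_univ j)
    have h2 := hxmax h1
    simp only [Set.mem_ofPred_eq] at h2
    have e : Function.update (fun j => (x j).ofLp) i θ.ofLp
        = fun j => (Function.update x i θ j).ofLp := by
      funext j
      by_cases hj : j = i
      · subst hj; simp
      · simp [Function.update_of_ne hj]
    rw [e]; exact h2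
  have h3 := design_of_isMax hμ (fun j => (x j).ofLp) θ.ofLp (by simpa using hk) hd hmax y.ofLp
  simp only [← inner_eq_dot, Fintype.card_fin, real_inner_self_eq_norm_sq] at h3
  have h4 : ∀ i, |inner ℝ y (x i)| ≤ m + τ / 2 / c * ‖y‖ := by
    intro i
    have e : inner ℝ y (x i) = inner ℝ y (ϑ i) + inner ℝ y (x i - ϑ i) := by
      rw [← inner_add_right]; congr 1; abel
    rw [e]
    refine (abs_add_le _ _).trans (add_le_add (hm i) ?_)
    refine (abs_real_inner_le_norm _ _).trans ?_
    rw [mul_comm]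
    exact mul_le_mul_of_nonneg_right (hϑ i).le (norm_nonneg _)
  have hm0 : 0 ≤ m := (abs_nonneg _).trans (hm ⟨0, hk0⟩)
  set m' := m + τ / 2 / c * ‖y‖ with hm'
  have hm'0 : 0 ≤ m' := by positivity
  have h5 : ∑ i, (inner ℝ y (x i)) ^ 2 ≤ k * m' ^ 2 := by
    have : ∀ i ∈ Finset.univ, (inner ℝ y (x i)) ^ 2 ≤ m' ^ 2 := fun i _ => by
      rw [← sq_abs]; exact pow_le_pow_left₀ (abs_nonneg _) (h4 i) 2
    simpa using Finset.sum_le_sum this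
  have hkd : (2 * d : ℝ) ≤ k := by exact_mod_cast hk
  have h6 : (inner ℝ y θ) ^ 2 ≤ (c * m' + τ / 2 * ‖y‖) ^ 2 := by
    calc (inner ℝ y θ) ^ 2 ≤ 2 * d / k * (μ * ‖y‖ ^ 2 + ∑ i, (inner ℝ y (x i)) ^ 2) := h3
      _ ≤ 2 * d / k * (μ * ‖y‖ ^ 2 + k * m' ^ 2) := by gcongr
      _ = 2 * d / k * (μ * ‖y‖ ^ 2) + 2 * d * m' ^ 2 := by field_simp
      _ ≤ 1 * (μ * ‖y‖ ^ 2) + 2 * d * m' ^ 2 := by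
          gcongr
          rw [div_le_one hkk]; exact hkd
      _ = (τ / 2 * ‖y‖) ^ 2 + (c * m') ^ 2 := by
          rw [mul_pow c, hc, Real.sq_sqrt (by linarith), hμdef]; ring
      _ ≤ _ := by nlinarith [mul_nonneg (mul_nonneg hc0.le hm'0) (by positivity : 0 ≤ τ / 2 * ‖y‖)]
  have h7 := abs_le_of_sq_le_sq h6 (by positivity)
  refine h7.trans (le_of_eq ?_)
  rw [hm']; field_simp; ring

end LinearAlgebra

/-! ### Regularized least squares with approximately linear means. -/

section LeastSquares

open Matrix

variable {d n : ℕ}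

theorem wnorm_regGram_sq {μ : ℝ} (hμ : 0 < μ) (x : Fin n → Vec d) (e : Vec d) :
    wnorm (regGram μ (fun j => (x j).ofLp) Finset.univ) e ^ 2
      = μ * ‖e‖ ^ 2 + ∑ j, (inner ℝ (x j) e) ^ 2 := by
  rw [wnorm, Real.sq_sqrt (regGram_self_nonneg hμ _ _ _), dot_regGram, ← inner_eq_dot,
    real_inner_self_eq_norm_sq]
  simp only [← inner_eq_dot, sq]

theorem abs_inner_le_wnorm {μ : ℝ} (hμ : 0 < μ) (x : Fin n → Vec d) (v e : Vec d) :
    |inner ℝ v e| ≤ Real.sqrt (v.ofLp ⬝ᵥ (regGram μ (fun j => (x j).ofLp) Finset.univ)⁻¹ *ᵥ v.ofLp)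
      * wnorm (regGram μ (fun j => (x j).ofLp) Finset.univ) e := by
  rw [wnorm, ← Real.sqrt_mul (regGram_inv_nonneg hμ _ _ _), inner_eq_dot]
  exact Real.abs_le_sqrt (dot_sq_le hμ _ _ _ _)

theorem wnorm_add_le {μ : ℝ} (hμ : 0 < μ) (x : Fin n → Vec d) (e f : Vec d) :
    wnorm (regGram μ (fun j => (x j).ofLp) Finset.univ) (e + f)
      ≤ wnorm (regGram μ (fun j => (x j).ofLp) Finset.univ) e
        + wnorm (regGram μ (fun j => (x j).ofLp) Finset.univ) f := by
  set X := regGram μ (fun j => (x j).ofLp) Finset.univ with hX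
  have he := Real.sq_sqrt (regGram_self_nonneg hμ (fun j => (x j).ofLp) Finset.univ e.ofLp)
  have hf := Real.sq_sqrt (regGram_self_nonneg hμ (fun j => (x j).ofLp) Finset.univ f.ofLp)
  rw [← hX] at he hf
  have hc : e.ofLp ⬝ᵥ X *ᵥ f.ofLp ≤ wnorm X e * wnorm X f := by
    refine le_trans (le_abs_self _) (abs_le_of_sq_le_sq ?_ (by unfold wnorm; positivity))
    rw [mul_pow]
    unfold wnorm
    rw [he, hf]
    exact regGram_cauchy hμ _ _ _ _
  have hsymm : f.ofLp ⬝ᵥ X *ᵥ e.ofLp = e.ofLp ⬝ᵥ X *ᵥ f.ofLp := by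
    simp only [hX, dot_regGram, dotProduct_comm f.ofLp e.ofLp, mul_comm]
  rw [wnorm]
  refine Real.sqrt_le_iff.2 ⟨by unfold wnorm; positivity, ?_⟩
  rw [add_sq]
  have e1 : (e + f).ofLp ⬝ᵥ X *ᵥ (e + f).ofLp = e.ofLp ⬝ᵥ X *ᵥ e.ofLp
      + 2 * (e.ofLp ⬝ᵥ X *ᵥ f.ofLp) + f.ofLp ⬝ᵥ X *ᵥ f.ofLp := by
    simp only [WithLp.ofLp_add, mulVec_add, add_dotProduct, dotProduct_add, hsymm]
    ring
  rw [e1]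
  have he' : wnorm X e ^ 2 = e.ofLp ⬝ᵥ X *ᵥ e.ofLp := he
  have hf' : wnorm X f ^ 2 = f.ofLp ⬝ᵥ X *ᵥ f.ofLp := hf
  rw [he', hf']
  linarith

/-- Error of regularized least squares: `m` are approximately linear means, and the noise `y - m`
satisfies a self-normalized bound. -/
theorem least_squares_error {μ η L₁ Ξ B R L : ℝ} (hμ : 0 < μ) (hη : 0 ≤ η) (hB : 0 < B)
    (hL₁ : 0 ≤ L₁) (hΞ : 0 ≤ Ξ) (hL : 0 ≤ L)
    (x : Fin n → Vec d) (y m : Fin n → ℝ) (θ : Vec d) (hx : ∀ j, ‖x j‖ ≤ L₁)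
    (hm : ∀ j, |m j - inner ℝ (x j) θ| ≤ η) (hy : ∀ j, |y j - m j| ≤ Ξ)
    (hR : (‖θ‖ + n * L₁ * (η + Ξ) / μ) / B ^ 2 ≤ R)
    (hnoise : ∀ v : Vec d, (∀ i, |v i| ≤ R) →
      ∑ j, (inner ℝ (x j) v * (y j - m j) - B ^ 2 * (inner ℝ (x j) v) ^ 2 / 2) ≤ L) :
    wnorm (regGram μ (fun j => (x j).ofLp) Finset.univ)
      (θ - WithLp.toLp 2 ((regGram μ (fun j => (x j).ofLp) Finset.univ)⁻¹ *ᵥ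
        (∑ j, y j • x j).ofLp))
      ≤ 2 * (Real.sqrt μ * ‖θ‖ + η * Real.sqrt n) + Real.sqrt (2 * L) * B := by
  set X := regGram μ (fun j => (x j).ofLp) Finset.univ with hX
  set θh : Vec d := WithLp.toLp 2 (X⁻¹ *ᵥ (∑ j, y j • x j).ofLp) with hθh
  set e := θ - θh with he
  set W := wnorm X e with hW
  have hW0 : 0 ≤ W := Real.sqrt_nonneg _
  have hW2 : W ^ 2 = μ * ‖e‖ ^ 2 + ∑ j, (inner ℝ (x j) e) ^ 2 := wnorm_regGram_sq hμ x e
  -- As $X\hat\theta=\sum_j y_jx_j$, the squared norm of the error splits into a regularization, a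
  -- misspecification and a noise term.
  have key : W ^ 2 = μ * inner ℝ e θ
      + ∑ j, inner ℝ (x j) e * (inner ℝ (x j) θ - m j)
      - ∑ j, inner ℝ (x j) e * (y j - m j) := by
    have h1 : W ^ 2 = e.ofLp ⬝ᵥ X *ᵥ e.ofLp :=
      Real.sq_sqrt (regGram_self_nonneg hμ _ _ _)
    have h2 : X *ᵥ e.ofLp = X *ᵥ θ.ofLp - (∑ j, y j • x j).ofLp := by
      rw [he, WithLp.ofLp_sub, mulVec_sub, hθh]
      congr 1
      exact regGram_mulVec_inv hμ _ _ _
    have h3 : e.ofLp ⬝ᵥ (∑ j, y j • x j).ofLp = ∑ j, inner ℝ (x j) e * y j := by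
      rw [← inner_eq_dot, inner_sum]
      refine Finset.sum_congr rfl fun j _ => ?_
      rw [inner_smul_right, real_inner_comm, mul_comm]
    rw [h1, h2, dotProduct_sub, h3, hX, dot_regGram, ← inner_eq_dot]
    simp only [← inner_eq_dot, mul_sub, Finset.sum_sub_distrib]
    ring
  have hlam : μ * inner ℝ e θ ≤ Real.sqrt μ * ‖θ‖ * W := by
    have h1 : Real.sqrt μ * ‖e‖ ≤ W := by
      refine abs_le_of_sq_le_sq' ?_ hW0 |>.2
      rw [mul_pow, Real.sq_sqrt hμ.le, hW2]
      have : 0 ≤ ∑ j, (inner ℝ (x j) e) ^ 2 := Finset.sum_nonneg fun j _ => sq_nonneg _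
      linarith
    calc μ * inner ℝ e θ ≤ μ * (‖e‖ * ‖θ‖) := by
          gcongr; exact real_inner_le_norm e θ
      _ = Real.sqrt μ * ‖θ‖ * (Real.sqrt μ * ‖e‖) := by
          nth_rewrite 1 [← Real.mul_self_sqrt hμ.le]; ring
      _ ≤ _ := by gcongr
  have hsq : Real.sqrt (∑ j, (inner ℝ (x j) e) ^ 2) ≤ W := by
    rw [Real.sqrt_le_left hW0, hW2]
    have : 0 ≤ μ * ‖e‖ ^ 2 := by positivity
    linarith
  have hbias : ∑ j, inner ℝ (x j) e * (inner ℝ (x j) θ - m j) ≤ η * Real.sqrt n * W := by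
    have h1 := Finset.sum_mul_sq_le_sq_mul_sq Finset.univ (fun j => inner ℝ (x j) e)
      (fun j => inner ℝ (x j) θ - m j)
    have h2 : ∑ j, (inner ℝ (x j) θ - m j) ^ 2 ≤ η ^ 2 * n := by
      have : ∀ j ∈ Finset.univ, (inner ℝ (x j) θ - m j) ^ 2 ≤ η ^ 2 := fun j _ => by
        rw [← sq_abs, abs_sub_comm]; exact pow_le_pow_left₀ (abs_nonneg _) (hm j) 2
      have := Finset.sum_le_sum this
      simpa [mul_comm] using this
    refine le_trans (le_abs_self _) (abs_le_of_sq_le_sq ?_ (by positivity))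
    rw [mul_pow, mul_pow, Real.sq_sqrt (Nat.cast_nonneg _), mul_comm (η ^ 2 * _)]
    refine h1.trans (mul_le_mul ?_ h2 (Finset.sum_nonneg fun j _ => sq_nonneg _) (sq_nonneg _))
    rw [hW2]
    have : 0 ≤ μ * ‖e‖ ^ 2 := by positivity
    linarith
  -- A crude a priori bound, needed only to see that the data-dependent direction used for the noise
  -- lies in the box of radius $R$.
  have hnorm : ‖e‖ ≤ ‖θ‖ + n * L₁ * (η + Ξ) / μ := by
    have h1 : μ * ‖e‖ ^ 2 ≤ ‖e‖ * (μ * ‖θ‖ + n * L₁ * (η + Ξ)) := by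
      have h2 : ∑ j, inner ℝ (x j) e * (inner ℝ (x j) θ - m j)
          - ∑ j, inner ℝ (x j) e * (y j - m j) ≤ ‖e‖ * (n * L₁ * (η + Ξ)) := by
        rw [← Finset.sum_sub_distrib]
        have h3 : ∀ j ∈ Finset.univ, inner ℝ (x j) e * (inner ℝ (x j) θ - m j)
            - inner ℝ (x j) e * (y j - m j) ≤ L₁ * ‖e‖ * (η + Ξ) := by
          intro j _
          rw [← mul_sub]
          refine (le_abs_self _).trans ?_
          rw [abs_mul]
          refine mul_le_mul ?_ ?_ (abs_nonneg _) (by positivity)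
          · exact (abs_real_inner_le_norm _ _).trans
              (mul_le_mul_of_nonneg_right (hx j) (norm_nonneg _))
          · refine (abs_sub _ _).trans (add_le_add ?_ (hy j))
            rw [abs_sub_comm]; exact hm j
        refine (Finset.sum_le_sum h3).trans (le_of_eq ?_)
        simp only [Finset.sum_const, Finset.card_univ, Fintype.card_fin, nsmul_eq_mul]
        ring
      have h4 : inner ℝ e θ ≤ ‖e‖ * ‖θ‖ := real_inner_le_norm e θ
      have h5 : 0 ≤ ∑ j, (inner ℝ (x j) e) ^ 2 := Finset.sum_nonneg fun j _ => sq_nonneg _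
      have h6 : μ * inner ℝ e θ ≤ μ * (‖e‖ * ‖θ‖) := by gcongr
      nlinarith
    rcases (norm_nonneg e).eq_or_lt with h0 | h0
    · rw [← h0]; positivity
    · have h2 : ‖e‖ * μ ≤ μ * ‖θ‖ + n * L₁ * (η + Ξ) := by
        refine le_of_mul_le_mul_left ?_ h0
        linarith
      rw [← sub_le_iff_le_add', le_div_iff₀ hμ]
      linarith
  -- The noise bound in the direction $-e/B^2$. Its quadratic term costs only $W^2/2$, which is
  -- absorbed by the left-hand side at the end.
  have hno : -∑ j, inner ℝ (x j) e * (y j - m j) ≤ L * B ^ 2 + W ^ 2 / 2 := by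
    have h1 := hnoise (-(1 / B ^ 2) • e) (fun i => by
      have : |e i| ≤ ‖e‖ := by
        have := PiLp.norm_apply_le e i
        simpa using this
      rw [PiLp.smul_apply, smul_eq_mul, abs_mul, abs_neg, abs_of_pos (by positivity : 0 < 1 / B ^ 2)]
      refine le_trans ?_ hR
      rw [one_div, inv_mul_eq_div]
      gcongr
      exact this.trans hnorm)
    simp only [inner_smul_right] at h1
    have e1 : ∑ j, (-(1 / B ^ 2) * inner ℝ (x j) e * (y j - m j)
        - B ^ 2 * (-(1 / B ^ 2) * inner ℝ (x j) e) ^ 2 / 2)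
        = -(1 / B ^ 2) * ∑ j, inner ℝ (x j) e * (y j - m j)
          - (1 / B ^ 2) * (∑ j, (inner ℝ (x j) e) ^ 2) / 2 := by
      rw [Finset.sum_sub_distrib, Finset.mul_sum, Finset.mul_sum, Finset.sum_div]
      congr 1
      · exact Finset.sum_congr rfl fun j _ => by ring
      · refine Finset.sum_congr rfl fun j _ => ?_
        field_simp
    rw [e1] at h1
    have h2 : ∑ j, (inner ℝ (x j) e) ^ 2 ≤ W ^ 2 := by
      rw [hW2]
      have : 0 ≤ μ * ‖e‖ ^ 2 := by positivity
      linarith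
    have hB2 : 0 < B ^ 2 := by positivity
    have h3 : (-∑ j, inner ℝ (x j) e * (y j - m j)) - (∑ j, (inner ℝ (x j) e) ^ 2) / 2
        ≤ L * B ^ 2 := by
      have := mul_le_mul_of_nonneg_right h1 hB2.le
      refine le_trans (le_of_eq ?_) this
      field_simp
    linarith
  set a := Real.sqrt μ * ‖θ‖ + η * Real.sqrt n with ha
  have ha0 : 0 ≤ a := by positivity
  set b := Real.sqrt (2 * L) * B with hb
  have hb0 : 0 ≤ b := by positivity
  have hb2 : b ^ 2 = 2 * L * B ^ 2 := by rw [hb, mul_pow, Real.sq_sqrt (by positivity)]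
  have hfin : W ^ 2 ≤ 2 * a * W + b ^ 2 := by
    rw [hb2, ha]; nlinarith
  by_contra hcon
  push Not at hcon
  nlinarith [mul_nonneg ha0 hb0]

end LeastSquares

/-! ### Exponential moments and uniform Chernoff bounds for independent trajectories. -/

section Concentration

theorem exists_grid {ι : Type*} [Fintype ι] [DecidableEq ι] {R ρ : ℝ} (hρ : 0 < ρ)
    {m : ℕ} (hm : 2 * R / ρ + 1 ≤ m) :
    ∃ N : Finset (ι → ℝ), N.card ≤ m ^ Fintype.card ι ∧
      ∀ w : ι → ℝ, (∀ i, |w i| ≤ R) → ∃ w' ∈ N, ∀ i, |w i - w' i| ≤ ρ := by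
  refine ⟨Finset.univ.image fun (k : ι → Fin m) i => -R + (k i : ℕ) * ρ,
    Finset.card_image_le.trans (by simp), fun w hw => ?_⟩
  have h0 : ∀ i, 0 ≤ (w i + R) / ρ := fun i => by
    have := (abs_le.1 (hw i)).1
    exact div_nonneg (by linarith) hρ.le
  have hlt : ∀ i, ⌊(w i + R) / ρ⌋₊ < m := by
    intro i
    have h1 : (w i + R) / ρ ≤ 2 * R / ρ := by
      gcongr
      linarith [(abs_le.1 (hw i)).2]
    have h2 := Nat.floor_le (h0 i)
    have h3 : (⌊(w i + R) / ρ⌋₊ : ℝ) < m := by linarith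
    exact_mod_cast h3
  refine ⟨_, Finset.mem_image_of_mem _ (Finset.mem_univ fun i => ⟨⌊(w i + R) / ρ⌋₊, hlt i⟩),
    fun i => ?_⟩
  have h2 := Nat.floor_le (h0 i)
  have h3 := Nat.lt_floor_add_one ((w i + R) / ρ)
  rw [le_div_iff₀ hρ] at h2
  rw [div_lt_iff₀ hρ] at h3
  simp only
  rw [abs_le]
  constructor <;> linarith

variable {Ω : Type*} [MeasurableSpace Ω] (μ : Measure Ω) [IsProbabilityMeasure μ]

/-- Markov's inequality for $\exp\sum_j F(D_j)$, whose expectation factorizes by independence. -/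
theorem pi_chernoff {n : ℕ} {F : Ω → ℝ} (hF : Measurable F)
    (hexp : ∫⁻ x, ENNReal.ofReal (Real.exp (F x)) ∂μ ≤ 1) (t : ℝ) :
    Measure.pi (fun _ : Fin n => μ) {D | t ≤ ∑ j, F (D j)} ≤ ENNReal.ofReal (Real.exp (-t)) := by
  have hm : Measurable fun D : Fin n → Ω =>
      ∏ j ∈ Finset.univ, ENNReal.ofReal (Real.exp (F (D j))) :=
    Finset.measurable_prod _ fun j _ =>
      (Real.measurable_exp.comp (hF.comp (measurable_pi_apply j))).ennreal_ofReal
  have hprod : ∫⁻ D, ∏ j ∈ Finset.univ, ENNReal.ofReal (Real.exp (F (D j)))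
      ∂(Measure.pi fun _ : Fin n => μ) ≤ 1 := by
    have hg : Measurable fun x => ENNReal.ofReal (Real.exp (F x)) :=
      (Real.measurable_exp.comp hF).ennreal_ofReal
    have hind := ProbabilityTheory.iIndepFun_pi (μ := fun _ : Fin n => μ)
      (X := fun _ x => ENNReal.ofReal (Real.exp (F x))) (fun _ => hg.aemeasurable)
    rw [ProbabilityTheory.lintegral_prod_eq_prod_lintegral_of_indepFun Finset.univ _ hind
      (fun j => hg.comp (measurable_pi_apply j))]
    refine Finset.prod_le_one' fun j _ => ?_
    have := (measurePreserving_eval (fun _ : Fin n => μ) j).lintegral_comp hg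
    simp only [Function.eval] at this
    rw [this]; exact hexp
  have hmk := mul_meas_ge_le_lintegral hm (μ := Measure.pi fun _ : Fin n => μ)
    (ENNReal.ofReal (Real.exp t))
  have hset : {D : Fin n → Ω | t ≤ ∑ j, F (D j)}
      = {D | ENNReal.ofReal (Real.exp t) ≤
          ∏ j ∈ Finset.univ, ENNReal.ofReal (Real.exp (F (D j)))} := by
    ext D
    simp only [Set.mem_ofPred_eq]
    rw [← ENNReal.ofReal_prod_of_nonneg (fun j _ => (Real.exp_pos _).le), ← Real.exp_sum,
      ENNReal.ofReal_le_ofReal_iff (Real.exp_pos _).le, Real.exp_le_exp]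
  rw [hset]
  have hpos : ENNReal.ofReal (Real.exp t) ≠ 0 := by simp [Real.exp_pos]
  rw [Real.exp_neg, ENNReal.ofReal_inv_of_pos (Real.exp_pos t), ENNReal.le_inv_iff_mul_le, mul_comm]
  exact hmk.trans hprod

/-- Uniform Chernoff bound over a box of parameters. -/
theorem uniform_chernoff {ι : Type*} [Fintype ι] [DecidableEq ι] {n : ℕ}
    {F : (ι → ℝ) → Ω → ℝ} (hF : ∀ w, Measurable (F w))
    (hexp : ∀ w, ∫⁻ x, ENNReal.ofReal (Real.exp (F w x)) ∂μ ≤ 1) {good : Ω → Prop}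
    {R ρ ζ δ L : ℝ} (hR : 0 ≤ R) (hρ : 0 < ρ) (hδ : 0 < δ) {m : ℕ} (hm : 2 * R / ρ + 1 ≤ m)
    (hlip : ∀ w w' : ι → ℝ, (∀ i, |w i| ≤ R) → (∀ i, |w i - w' i| ≤ ρ) →
      ∀ x, good x → F w x ≤ F w' x + ζ)
    (hL : Fintype.card ι * Real.log m + Real.log (1 / δ) + n * ζ ≤ L) :
    Measure.pi (fun _ : Fin n => μ)
      {D | (∀ j, good (D j)) ∧ ∃ w : ι → ℝ, (∀ i, |w i| ≤ R) ∧ L < ∑ j, F w (D j)}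
      ≤ ENNReal.ofReal δ := by
  obtain ⟨N, hN, hcov⟩ := exists_grid (ι := ι) hρ hm
  have hm0 : (0 : ℝ) < m := by
    have : 0 ≤ 2 * R / ρ := by positivity
    linarith
  -- At a grid point the threshold is $t$; the slack $n\zeta$ in $L$ pays for replacing a parameter
  -- by a nearby grid point in each of the $n$ samples.
  set t := Fintype.card ι * Real.log m + Real.log (1 / δ) with ht
  have hsub : {D : Fin n → Ω | (∀ j, good (D j)) ∧
      ∃ w : ι → ℝ, (∀ i, |w i| ≤ R) ∧ L < ∑ j, F w (D j)}
      ⊆ ⋃ w ∈ N, {D | t ≤ ∑ j, F w (D j)} := by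
    rintro D ⟨hg, w, hw, hlt⟩
    obtain ⟨w', hw', hclose⟩ := hcov w hw
    simp only [Set.mem_iUnion]
    refine ⟨w', hw', ?_⟩
    have h1 : ∑ j, F w (D j) ≤ ∑ j, (F w' (D j) + ζ) :=
      Finset.sum_le_sum fun j _ => hlip w w' hw hclose _ (hg j)
    rw [Finset.sum_add_distrib] at h1
    simp only [Finset.sum_const, Finset.card_univ, Fintype.card_fin, nsmul_eq_mul] at h1
    simp only [Set.mem_ofPred_eq]
    linarith
  refine (measure_mono hsub).trans ((measure_biUnion_finset_le N _).trans ?_)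
  calc ∑ w ∈ N, Measure.pi (fun _ : Fin n => μ) {D | t ≤ ∑ j, F w (D j)}
      ≤ ∑ w ∈ N, ENNReal.ofReal (Real.exp (-t)) :=
        Finset.sum_le_sum fun w _ => pi_chernoff μ (hF w) (hexp w) t
    _ = N.card * ENNReal.ofReal (Real.exp (-t)) := by simp
    _ ≤ ENNReal.ofReal δ := by
      rw [← ENNReal.ofReal_natCast, ← ENNReal.ofReal_mul (Nat.cast_nonneg _)]
      refine ENNReal.ofReal_le_ofReal ?_
      have h2 : Real.exp (-t) = δ / m ^ Fintype.card ι := by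
        rw [ht, one_div, Real.log_inv, neg_add, neg_neg, Real.exp_add, Real.exp_log hδ,
          Real.exp_neg, mul_comm (_ : ℝ) (Real.log m), Real.exp_mul, Real.exp_log hm0,
          Real.rpow_natCast]
        field_simp
      rw [h2]
      have h3 : (N.card : ℝ) ≤ m ^ Fintype.card ι := by exact_mod_cast hN
      rw [mul_div_assoc', div_le_iff₀ (by positivity)]
      nlinarith

/-- Hoeffding's lemma for lower integrals. -/
theorem lintegral_exp_le_of_mem_Icc {X : Ω → ℝ} (hX : Measurable X) {a b : ℝ}
    (hab : ∀ᵐ x ∂μ, X x ∈ Set.Icc a b) (c : ℝ) :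
    ∫⁻ x, ENNReal.ofReal (Real.exp (c * (X x - ∫ y, X y ∂μ) - (b - a) ^ 2 * c ^ 2 / 8)) ∂μ ≤ 1 := by
  have h := ProbabilityTheory.hasSubgaussianMGF_of_mem_Icc hX.aemeasurable hab
  have h1 := h.mgf_le c
  have hint := h.integrable_exp_mul c
  have e : ∀ x, ENNReal.ofReal (Real.exp (c * (X x - ∫ y, X y ∂μ) - (b - a) ^ 2 * c ^ 2 / 8))
      = ENNReal.ofReal (Real.exp (-((b - a) ^ 2 * c ^ 2 / 8)))
        * ENNReal.ofReal (Real.exp (c * (X x - ∫ y, X y ∂μ))) := by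
    intro x
    rw [← ENNReal.ofReal_mul (Real.exp_pos _).le, ← Real.exp_add]
    congr 2; ring
  simp_rw [e]
  rw [lintegral_const_mul' _ _ ENNReal.ofReal_ne_top,
    ← ofReal_integral_eq_lintegral_ofReal hint (ae_of_all _ fun x => (Real.exp_pos _).le),
    ← ENNReal.ofReal_mul (Real.exp_pos _).le, ← ENNReal.ofReal_one]
  refine ENNReal.ofReal_le_ofReal ?_
  have h2 : (((‖b - a‖₊ / 2) ^ 2 : NNReal) : ℝ) * c ^ 2 / 2 = (b - a) ^ 2 * c ^ 2 / 8 := by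
    push_cast
    rw [Real.norm_eq_abs, div_pow, sq_abs]; ring
  rw [h2] at h1
  calc _ ≤ Real.exp (-((b - a) ^ 2 * c ^ 2 / 8)) * Real.exp ((b - a) ^ 2 * c ^ 2 / 8) := by
        gcongr; exact h1
    _ = 1 := by rw [← Real.exp_add]; simp

end Concentration

/-! ### The law of trajectories and the Markov property. -/

section TrajectoryLaw

variable {S A : Type*} {H : ℕ}

instance (M : MDP S A H) (s : S) (a : A) : IsProbabilityMeasure (M.reward s a) :=
  M.reward_prob s a

/-- Law of the next state-action pair when `π` is followed. -/
def stepLaw (M : MDP S A H) (π : Policy S A) (z : S × A) : PMF (S × A) :=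
  (M.trans z.1 z.2).bind (firstPair π)

theorem firstPair_apply (π : Policy S A) (s : S) (z : S × A) [DecidableEq S] :
    firstPair π s z = if z.1 = s then π s z.2 else 0 := by
  classical
  obtain ⟨s', a⟩ := z
  rw [firstPair, PMF.map_apply]
  by_cases h : s' = s
  · subst h
    simp only [if_true, Prod.mk.injEq, true_and]
    rw [tsum_eq_single a (fun b hb => by simp [hb.symm])]
    simp
  · simp [h]

theorem stepLaw_apply (M : MDP S A H) (π : Policy S A) (z z' : S × A) :
    stepLaw M π z z' = M.trans z.1 z.2 z'.1 * π z'.1 z'.2 := by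
  classical
  rw [stepLaw, PMF.bind_apply, tsum_eq_single z'.1]
  · simp [firstPair_apply]
  · intro s hs
    simp [firstPair_apply, hs.symm]

/-- The trajectory as a sequence that is constant after its last step. -/
def seqOf {k : ℕ} (T : Traj S A k) (i : ℕ) : (S × A) × ℝ :=
  T ⟨min i k, Nat.lt_succ_of_le (Nat.min_le_right _ _)⟩

theorem stepAt_eq_seqOf {k : ℕ} (T : Traj S A k) (h : ℕ) : stepAt T h = seqOf T (h - 1) := rfl

theorem seqOf_of_le {k i : ℕ} (T : Traj S A k) (h : i ≤ k) :
    seqOf T i = T ⟨i, Nat.lt_succ_of_le h⟩ := by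
  simp [seqOf, h]

/-- Prepend a step to a sequence. -/
def seqCons (x₀ : (S × A) × ℝ) (x : ℕ → (S × A) × ℝ) : ℕ → (S × A) × ℝ
  | 0 => x₀
  | i + 1 => x i

theorem seqOf_cons {k : ℕ} (x₀ : (S × A) × ℝ) (T : Traj S A k) :
    seqOf (Fin.cons x₀ T : Traj S A (k + 1)) = seqCons x₀ (seqOf T) := by
  funext i
  cases i with
  | zero => simp [seqOf, seqCons]
  | succ i =>
    simp only [seqOf, seqCons]
    have : (⟨min (i + 1) (k + 1), Nat.lt_succ_of_le (Nat.min_le_right _ _)⟩ : Fin (k + 1 + 1))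
        = Fin.succ ⟨min i k, Nat.lt_succ_of_le (Nat.min_le_right _ _)⟩ := by
      ext; simp
    rw [this, Fin.cons_succ]

variable [Fintype S] [Fintype A] [MeasurableSpace S] [MeasurableSpace A]

theorem measurable_seqOf {k : ℕ} : Measurable (seqOf : Traj S A k → ℕ → (S × A) × ℝ) :=
  measurable_pi_lambda _ fun _ => measurable_pi_apply _

theorem measurable_seqCons :
    Measurable fun x : ((S × A) × ℝ) × (ℕ → (S × A) × ℝ) => seqCons x.1 x.2 := by
  refine measurable_pi_lambda _ fun i => ?_
  cases i with
  | zero => exact measurable_fst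
  | succ i => exact (measurable_pi_apply i).comp measurable_snd

/-- Law of the trajectory with the given state-action pairs. -/
def pathLaw (M : MDP S A H) {k : ℕ} (z : Fin (k + 1) → S × A) : Measure (Traj S A k) :=
  (Measure.pi fun i => M.reward (z i).1 (z i).2).map (fun r i => (z i, r i))

/-- Expectation of a nonnegative function of the trajectory. -/
def trajE (M : MDP S A H) (π : Policy S A) (ν : PMF (S × A)) (k : ℕ)
    (Φ : (ℕ → (S × A) × ℝ) → ℝ≥0∞) : ℝ≥0∞ :=
  ∫⁻ T, Φ (seqOf T) ∂(trajLaw M π ν k)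

theorem measurable_pathMap {k : ℕ} (z : Fin (k + 1) → S × A) :
    Measurable (fun (r : Fin (k + 1) → ℝ) (i : Fin (k + 1)) => (z i, r i)) :=
  measurable_pi_lambda _ fun i => measurable_const.prodMk (measurable_pi_apply i)

instance (M : MDP S A H) {k : ℕ} (z : Fin (k + 1) → S × A) : IsProbabilityMeasure (pathLaw M z) :=
  Measure.isProbabilityMeasure_map (measurable_pathMap z).aemeasurable

theorem lintegral_trajLaw (M : MDP S A H) (π : Policy S A) (ν : PMF (S × A)) (k : ℕ)
    (Φ : Traj S A k → ℝ≥0∞) :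
    ∫⁻ T, Φ T ∂(trajLaw M π ν k) = ∑ z, pathProb M π ν z * ∫⁻ T, Φ T ∂(pathLaw M z) := by
  rw [trajLaw, lintegral_finsetSum_measure]
  refine Finset.sum_congr rfl fun z _ => ?_
  rw [lintegral_smul_measure, smul_eq_mul]
  rfl

theorem lintegral_pathLaw_cons (M : MDP S A H) {k : ℕ} (z₀ : S × A) (z : Fin (k + 1) → S × A)
    {Φ : Traj S A (k + 1) → ℝ≥0∞} (hΦ : Measurable Φ) :
    ∫⁻ T, Φ T ∂(pathLaw M (Fin.cons z₀ z : Fin (k + 2) → S × A))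
      = ∫⁻ r, ∫⁻ T, Φ (Fin.cons (z₀, r) T) ∂(pathLaw M z) ∂(M.reward z₀.1 z₀.2) := by
  set zz : Fin (k + 2) → S × A := Fin.cons z₀ z with hzz
  have hmp := (measurePreserving_piFinSuccAbove
    (fun i : Fin (k + 2) => M.reward (zz i).1 (zz i).2) 0).symm
  rw [pathLaw, lintegral_map hΦ (measurable_pathMap zz), ← hmp.lintegral_comp_emb
    (MeasurableEquiv.measurableEmbedding _)]
  have hcons : Measurable fun x : ℝ × (Fin (k + 1) → ℝ) =>
      (Fin.cons (z₀, x.1) (fun i => (z i, x.2 i)) : Traj S A (k + 1)) := by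
    refine measurable_pi_lambda _ fun i => ?_
    refine Fin.cases ?_ (fun i => ?_) i
    · simp only [Fin.cons_zero]
      exact measurable_const.prodMk measurable_fst
    · simp only [Fin.cons_succ]
      exact measurable_const.prodMk ((measurable_pi_apply i).comp measurable_snd)
  have e : ∀ x : ℝ × (Fin (k + 1) → ℝ),
      Φ (fun i => (zz i, (MeasurableEquiv.piFinSuccAbove (fun _ => ℝ) 0).symm x i))
      = Φ (Fin.cons (z₀, x.1) (fun i => (z i, x.2 i))) := by
    intro x
    congr 1
    funext i
    refine Fin.cases ?_ (fun i => ?_) i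
    · simp [hzz, MeasurableEquiv.piFinSuccAbove]
    · simp [hzz, MeasurableEquiv.piFinSuccAbove]
  simp_rw [e]
  have hm : AEMeasurable (fun x : ℝ × (Fin (k + 1) → ℝ) =>
      Φ (Fin.cons (z₀, x.1) (fun i => (z i, x.2 i)))) ((M.reward (zz 0).1 (zz 0).2).prod
        (Measure.pi fun j => M.reward (zz (Fin.succAbove 0 j)).1 (zz (Fin.succAbove 0 j)).2)) :=
    (hΦ.comp hcons).aemeasurable
  rw [lintegral_prod _ hm]
  simp only [hzz, Fin.cons_zero, Fin.succAbove_zero, Fin.cons_succ]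
  refine lintegral_congr fun r => ?_
  rw [pathLaw, lintegral_map _ (measurable_pathMap z)]
  refine hΦ.comp (measurable_pi_lambda _ fun i => ?_)
  refine Fin.cases ?_ (fun i => ?_) i
  · simp only [Fin.cons_zero]; exact measurable_const
  · simp only [Fin.cons_succ]; exact measurable_pi_apply i

theorem pathProb_cons (M : MDP S A H) (π : Policy S A) (ν : PMF (S × A)) {k : ℕ} (z₀ : S × A)
    (z : Fin (k + 1) → S × A) :
    pathProb M π ν (Fin.cons z₀ z : Fin (k + 2) → S × A)
      = ν z₀ * ∑ z', stepLaw M π z₀ z' * pathProb M π (PMF.pure z') z := by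
  classical
  rw [Finset.sum_eq_single (z 0)]
  · rw [pathProb, pathProb, Fin.prod_univ_succ, stepLaw_apply]
    simp only [Fin.cons_zero, PMF.pure_apply, if_true, one_mul, Fin.castSucc_zero, Fin.cons_succ,
      ← Fin.succ_castSucc]
  · intro b _ hb
    simp [pathProb, PMF.pure_apply, hb.symm]
  · simp

theorem pathProb_eq_sum (M : MDP S A H) (π : Policy S A) (ν : PMF (S × A)) {k : ℕ}
    (z : Fin (k + 1) → S × A) :
    pathProb M π ν z = ∑ z', ν z' * pathProb M π (PMF.pure z') z := by
  classical
  rw [Finset.sum_eq_single (z 0)]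
  · simp [pathProb]
  · intro b _ hb
    simp [pathProb, PMF.pure_apply, hb.symm]
  · simp

theorem trajE_eq_sum (M : MDP S A H) (π : Policy S A) (ν : PMF (S × A)) (k : ℕ)
    (Φ : (ℕ → (S × A) × ℝ) → ℝ≥0∞) :
    trajE M π ν k Φ = ∑ z, ν z * trajE M π (PMF.pure z) k Φ := by
  simp only [trajE, lintegral_trajLaw, Finset.mul_sum]
  rw [Finset.sum_comm]
  refine Finset.sum_congr rfl fun z _ => ?_
  rw [pathProb_eq_sum, Finset.sum_mul]
  simp only [mul_assoc]

/-- Decomposition by the first step: given the first pair, the reward and the rest of the trajectory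
are independent. Trajectories enter as infinite sequences so that the same function can be evaluated
at every length and shifted. -/
theorem trajE_succ (M : MDP S A H) (π : Policy S A) (ν : PMF (S × A)) (k : ℕ)
    {Φ : (ℕ → (S × A) × ℝ) → ℝ≥0∞} (hΦ : Measurable Φ) :
    trajE M π ν (k + 1) Φ = ∑ z, ν z * ∑ z', stepLaw M π z z' *
      ∫⁻ r, trajE M π (PMF.pure z') k (fun x => Φ (seqCons (z, r) x)) ∂(M.reward z.1 z.2) := by
  have hm : ∀ z : S × A, Measurable fun x : ℝ × Traj S A k => Φ (seqCons (z, x.1) (seqOf x.2)) :=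
    fun z => hΦ.comp (measurable_seqCons.comp
      ((measurable_const.prodMk measurable_fst).prodMk (measurable_seqOf.comp measurable_snd)))
  simp only [trajE, lintegral_trajLaw]
  rw [← (Fin.consEquiv fun _ : Fin (k + 2) => S × A).sum_comp, Fintype.sum_prod_type]
  refine Finset.sum_congr rfl fun z₀ _ => ?_
  simp only [Fin.consEquiv, Equiv.coe_fn_mk]
  have h1 : ∀ z : Fin (k + 1) → S × A,
      pathProb M π ν (Fin.cons z₀ z : Fin (k + 2) → S × A)
        * ∫⁻ T, Φ (seqOf T) ∂(pathLaw M (Fin.cons z₀ z : Fin (k + 2) → S × A))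
      = ∑ z', ν z₀ * (stepLaw M π z₀ z' * (pathProb M π (PMF.pure z') z *
        ∫⁻ r, ∫⁻ T, Φ (seqCons (z₀, r) (seqOf T)) ∂(pathLaw M z) ∂(M.reward z₀.1 z₀.2))) := by
    intro z
    have hc := lintegral_pathLaw_cons M z₀ z (hΦ.comp measurable_seqOf)
    simp only [Function.comp_apply] at hc
    rw [pathProb_cons, hc, mul_assoc,
      Finset.sum_mul, Finset.mul_sum]
    simp only [seqOf_cons, mul_assoc]
  rw [Finset.sum_congr rfl fun z _ => h1 z, Finset.sum_comm, Finset.mul_sum]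
  refine Finset.sum_congr rfl fun z' _ => ?_
  rw [← Finset.mul_sum, ← Finset.mul_sum]
  congr 2
  rw [lintegral_finsetSum _ fun z _ => ?_]
  · refine Finset.sum_congr rfl fun z _ => ?_
    rw [lintegral_const_mul]
    exact (hm z₀).lintegral_prod_right'
  · exact ((hm z₀).lintegral_prod_right').const_mul _

variable [DiscreteMeasurableSpace S] [DiscreteMeasurableSpace A]

/-- The weights of all continuations add up to one. For $\psi=1$ this gives the total mass of the
trajectory law. -/
theorem trajE_first (M : MDP S A H) (π : Policy S A) (ν : PMF (S × A)) (ψ : S × A → ℝ≥0∞)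
    (k : ℕ) : trajE M π ν k (fun x => ψ (x 0).1) = ∑ z, ν z * ψ z := by
  have hψ : Measurable fun x : ℕ → (S × A) × ℝ => ψ (x 0).1 :=
    (Measurable.of_discrete (f := ψ)).comp (measurable_fst.comp (measurable_pi_apply 0))
  induction k generalizing ν ψ with
  | zero =>
    rw [trajE, lintegral_trajLaw, ← (Equiv.funUnique (Fin 1) (S × A)).symm.sum_comp]
    refine Finset.sum_congr rfl fun z _ => ?_
    have hψ' : Measurable fun T : Traj S A 0 => ψ (seqOf T 0).1 := hψ.comp measurable_seqOf
    rw [pathLaw, lintegral_map hψ' (measurable_pathMap _)]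
    simp [pathProb, seqOf]
  | succ k ih =>
    rw [trajE_succ M π ν k hψ]
    refine Finset.sum_congr rfl fun z _ => ?_
    simp only [seqCons]
    have h1 : ∀ z' : S × A, trajE M π (PMF.pure z') k (fun _ => ψ z) = ψ z := by
      intro z'
      rw [ih (PMF.pure z') (fun _ => ψ z) measurable_const, ← Finset.sum_mul]
      have := (PMF.pure z').tsum_coe
      rw [tsum_fintype] at this
      rw [this, one_mul]
    simp only [h1, lintegral_const, measure_univ, mul_one]
    rw [← Finset.sum_mul]
    have := (stepLaw M π z).tsum_coe
    rw [tsum_fintype] at this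
    rw [this, one_mul]

instance (M : MDP S A H) (π : Policy S A) (ν : PMF (S × A)) (k : ℕ) :
    IsProbabilityMeasure (trajLaw M π ν k) := by
  constructor
  have h := trajE_first M π ν (fun _ => 1) k
  rw [trajE] at h
  simp only [lintegral_const, one_mul, mul_one] at h
  rw [h, ← ν.tsum_coe, tsum_fintype]

/-- Law of the state-action pair after `j` steps. -/
def pairLaw (M : MDP S A H) (π : Policy S A) (ν : PMF (S × A)) : ℕ → PMF (S × A)
  | 0 => ν
  | j + 1 => (pairLaw M π ν j).bind (stepLaw M π)

theorem pairLaw_succ' (M : MDP S A H) (π : Policy S A) (ν : PMF (S × A)) (j : ℕ) :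
    pairLaw M π ν (j + 1) = pairLaw M π (ν.bind (stepLaw M π)) j := by
  induction j with
  | zero => rfl
  | succ j ih => rw [pairLaw, ih]; rfl

theorem pmf_bind_apply_fintype {X Y : Type*} [Fintype X] (p : PMF X) (f : X → PMF Y) (y : Y) :
    p.bind f y = ∑ x, p x * f x y := by
  rw [PMF.bind_apply, tsum_fintype]

/-- Markov property. -/
theorem trajE_shift (M : MDP S A H) (π : Policy S A) (ν : PMF (S × A)) (m j k : ℕ) (hk : k = m + j)
    {Φ : (ℕ → (S × A) × ℝ) → ℝ≥0∞} (hΦ : Measurable Φ) :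
    trajE M π ν k (fun x => Φ fun i => x (i + j)) = trajE M π (pairLaw M π ν j) m Φ := by
  subst hk
  induction j generalizing ν with
  | zero => rfl
  | succ j ih =>
    have hs : ∀ j : ℕ, Measurable fun x : ℕ → (S × A) × ℝ => Φ fun i => x (i + j) := fun j =>
      hΦ.comp (measurable_pi_lambda _ fun i => measurable_pi_apply _)
    -- The induction removes steps from the front: $j+1$ steps from $\nu$ are $j$ steps from the law
    -- of the second pair.
    rw [pairLaw_succ', ← ih, ← add_assoc, trajE_succ _ _ _ _ (hs (j + 1)), trajE_eq_sum]
    simp only [pmf_bind_apply_fintype, Finset.sum_mul]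
    rw [Finset.sum_comm]
    refine Finset.sum_congr rfl fun z _ => ?_
    rw [Finset.mul_sum]
    refine Finset.sum_congr rfl fun z' _ => ?_
    rw [mul_assoc]
    congr 2
    have : ∀ r, (fun x : ℕ → (S × A) × ℝ => Φ fun i => seqCons (z, r) x (i + (j + 1)))
        = fun x => Φ fun i => x (i + j) := fun r => rfl
    simp [this]

/-- Rewards are in `[0, 1]`, and every transition is possible. -/
theorem ae_trajLaw (M : MDP S A H) (π : Policy S A) (ν : PMF (S × A)) (k : ℕ) :
    ∀ᵐ T ∂(trajLaw M π ν k), (∀ i, (T i).2 ∈ Set.Icc (0 : ℝ) 1) ∧ ν (T 0).1 ≠ 0 ∧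
      ∀ i : Fin k, stepLaw M π (T i.castSucc).1 (T i.succ).1 ≠ 0 := by
  rw [trajLaw, ae_finsetSum_measure_iff]
  intro z _
  by_cases hz : pathProb M π ν z = 0
  · rw [hz, zero_smul]; simp
  · refine Measure.ae_smul_measure ?_ _
    have h1 : ν (z 0) ≠ 0 := fun h => hz (by simp [pathProb, h])
    have h2 : ∀ i : Fin k, stepLaw M π (z i.castSucc) (z i.succ) ≠ 0 := by
      intro i h
      refine hz ?_
      rw [pathProb]
      refine mul_eq_zero_of_right _ (Finset.prod_eq_zero (Finset.mem_univ i) ?_)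
      rwa [stepLaw_apply] at h
    refine (ae_map_iff (measurable_pathMap z).aemeasurable ?_).2 ?_
    · have hcoord : ∀ i : Fin (k + 1), Measurable fun T : Traj S A k => (T i).1 := fun i =>
        measurable_fst.comp (measurable_pi_apply i)
      have a1 : MeasurableSet {T : Traj S A k | ∀ i, (T i).2 ∈ Set.Icc (0 : ℝ) 1} := by
        rw [Set.ofPred_forall]
        exact MeasurableSet.iInter fun i =>
          (measurable_snd.comp (measurable_pi_apply i)) measurableSet_Icc
      have a2 : MeasurableSet {T : Traj S A k | ν (T 0).1 ≠ 0} :=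
        hcoord 0 (MeasurableSet.of_discrete (s := {z | ν z ≠ 0}))
      have a3 : MeasurableSet {T : Traj S A k | ∀ i : Fin k,
          stepLaw M π (T i.castSucc).1 (T i.succ).1 ≠ 0} := by
        rw [Set.ofPred_forall]
        exact MeasurableSet.iInter fun i => ((hcoord i.castSucc).prodMk (hcoord i.succ))
          (MeasurableSet.of_discrete (s := {w : (S × A) × (S × A) | stepLaw M π w.1 w.2 ≠ 0}))
      exact a1.inter (a2.inter a3)
    · have h3 : ∀ᵐ r ∂(Measure.pi fun i => M.reward (z i).1 (z i).2),
          ∀ i, r i ∈ Set.Icc (0 : ℝ) 1 := by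
        rw [ae_all_iff]
        intro i
        exact Measure.tendsto_eval_ae_ae (M.reward_mem (z i).1 (z i).2)
      filter_upwards [h3] with r hr
      exact ⟨hr, h1, h2⟩

end TrajectoryLaw

/-! ### Backward recursions: action values and conditional means of stopped returns. -/

section Recursion

variable {S A : Type*} [Fintype S] [Fintype A] {H : ℕ}

/-- Transition probabilities as real numbers. -/
def tr (M : MDP S A H) (s : S) (a : A) (s' : S) : ℝ := (M.trans s a s').toReal

/-- Average over the actions of a policy. -/
def piAvg (π : Policy S A) (s : S) (x : A → ℝ) : ℝ := ∑ a, (π s a).toReal * x a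

/-- Mean reward. -/
def meanReward (M : MDP S A H) (s : S) (a : A) : ℝ := ∫ r, r ∂(M.reward s a)

theorem pmf_sum_toReal {X : Type*} [Fintype X] (p : PMF X) : ∑ x, (p x).toReal = 1 := by
  rw [← ENNReal.toReal_sum fun x _ => p.apply_ne_top x]
  have := p.tsum_coe
  rw [tsum_fintype] at this
  rw [this, ENNReal.toReal_one]

theorem tr_nonneg (M : MDP S A H) (s : S) (a : A) (s' : S) : 0 ≤ tr M s a s' :=
  ENNReal.toReal_nonneg

theorem tr_sum (M : MDP S A H) (s : S) (a : A) : ∑ s', tr M s a s' = 1 := pmf_sum_toReal _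

theorem stage_of_tr {M : MDP S A H} {s : S} {a : A} {s' : S} (hs : M.stage s ≤ H)
    (h : tr M s a s' ≠ 0) : M.stage s' = M.stage s + 1 := by
  refine M.stage_trans s a s' hs ?_
  rw [PMF.mem_support_iff]
  intro h0
  exact h (by simp [tr, h0])

theorem piAvg_add (π : Policy S A) (s : S) (x y : A → ℝ) :
    piAvg π s (fun a => x a + y a) = piAvg π s x + piAvg π s y := by
  simp [piAvg, mul_add, Finset.sum_add_distrib]

theorem piAvg_sub (π : Policy S A) (s : S) (x y : A → ℝ) :
    piAvg π s (fun a => x a - y a) = piAvg π s x - piAvg π s y := by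
  simp [piAvg, mul_sub, Finset.sum_sub_distrib]

theorem piAvg_const (π : Policy S A) (s : S) (c : ℝ) : piAvg π s (fun _ => c) = c := by
  rw [piAvg, ← Finset.sum_mul, pmf_sum_toReal, one_mul]

theorem piAvg_mono (π : Policy S A) (s : S) {x y : A → ℝ} (h : ∀ a, x a ≤ y a) :
    piAvg π s x ≤ piAvg π s y :=
  Finset.sum_le_sum fun a _ => mul_le_mul_of_nonneg_left (h a) ENNReal.toReal_nonneg

theorem piAvg_pure (s : S) (g : S → A) (x : A → ℝ) :
    piAvg (fun s => PMF.pure (g s)) s x = x (g s) := by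
  classical
  rw [piAvg, Finset.sum_eq_single (g s)]
  · simp
  · intro b _ hb; simp [PMF.pure_apply, hb]
  · simp

theorem piAvg_abs_sub_le (π : Policy S A) (s : S) {x y : A → ℝ} {c : ℝ}
    (h : ∀ a, |x a - y a| ≤ c) : |piAvg π s x - piAvg π s y| ≤ c := by
  rw [← piAvg_sub, abs_le]
  constructor
  · rw [← piAvg_const π s (-c)]
    exact piAvg_mono π s fun a => (abs_le.1 (h a)).1
  · rw [← piAvg_const π s c]
    exact piAvg_mono π s fun a => (abs_le.1 (h a)).2

/-- Average over the next state. -/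
def trAvg (M : MDP S A H) (s : S) (a : A) (y : S → ℝ) : ℝ := ∑ s', tr M s a s' * y s'

theorem trAvg_congr {M : MDP S A H} {s : S} (a : A) {y y' : S → ℝ} (hs : M.stage s ≤ H)
    (h : ∀ s', M.stage s' = M.stage s + 1 → y s' = y' s') : trAvg M s a y = trAvg M s a y' := by
  refine Finset.sum_congr rfl fun s' _ => ?_
  by_cases h0 : tr M s a s' = 0
  · simp [h0]
  · rw [h s' (stage_of_tr hs h0)]

theorem trAvg_mono {M : MDP S A H} {s : S} (a : A) {y y' : S → ℝ} (hs : M.stage s ≤ H)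
    (h : ∀ s', M.stage s' = M.stage s + 1 → y s' ≤ y' s') : trAvg M s a y ≤ trAvg M s a y' := by
  refine Finset.sum_le_sum fun s' _ => ?_
  by_cases h0 : tr M s a s' = 0
  · simp [h0]
  · exact mul_le_mul_of_nonneg_left (h s' (stage_of_tr hs h0)) (tr_nonneg _ _ _ _)

theorem trAvg_const (M : MDP S A H) (s : S) (a : A) (c : ℝ) : trAvg M s a (fun _ => c) = c := by
  rw [trAvg, ← Finset.sum_mul, tr_sum, one_mul]

theorem trAvg_add (M : MDP S A H) (s : S) (a : A) (y y' : S → ℝ) :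
    trAvg M s a (fun s' => y s' + y' s') = trAvg M s a y + trAvg M s a y' := by
  simp [trAvg, mul_add, Finset.sum_add_distrib]

theorem trAvg_sub (M : MDP S A H) (s : S) (a : A) (y y' : S → ℝ) :
    trAvg M s a (fun s' => y s' - y' s') = trAvg M s a y - trAvg M s a y' := by
  simp [trAvg, mul_sub, Finset.sum_sub_distrib]

theorem trAvg_abs_sub_le {M : MDP S A H} {s : S} (a : A) {y y' : S → ℝ} {c : ℝ}
    (hs : M.stage s ≤ H) (h : ∀ s', M.stage s' = M.stage s + 1 → |y s' - y' s'| ≤ c) :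
    |trAvg M s a y - trAvg M s a y'| ≤ c := by
  rw [← trAvg_sub, abs_le]
  constructor
  · rw [← trAvg_const M s a (-c)]
    exact trAvg_mono a hs fun s' h' => (abs_le.1 (h s' h')).1
  · rw [← trAvg_const M s a c]
    exact trAvg_mono a hs fun s' h' => (abs_le.1 (h s' h')).2

/-- Backward recursion over `k` steps with the rewards `f` and the aggregation `N` over the actions
of a state. -/
def dpK (M : MDP S A H) (f : S → A → ℝ) (N : S → (A → ℝ) → ℝ) : ℕ → S → A → ℝ
  | 0, _, _ => 0
  | k + 1, s, a => f s a + trAvg M s a fun s' => N s' (dpK M f N k s')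

/-- Backward recursion until the last stage. -/
def dp (M : MDP S A H) (f : S → A → ℝ) (N : S → (A → ℝ) → ℝ) (s : S) (a : A) : ℝ :=
  dpK M f N (H + 1 - M.stage s) s a

theorem dp_last (M : MDP S A H) (f : S → A → ℝ) (N : S → (A → ℝ) → ℝ) {s : S}
    (hs : H < M.stage s) (a : A) : dp M f N s a = 0 := by
  rw [dp, show H + 1 - M.stage s = 0 by omega]; rfl

theorem dp_eq (M : MDP S A H) (f : S → A → ℝ) (N : S → (A → ℝ) → ℝ) {s : S}
    (hs : M.stage s ≤ H) (a : A) :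
    dp M f N s a = f s a + trAvg M s a fun s' => N s' (dp M f N s') := by
  rw [dp, show H + 1 - M.stage s = (H - M.stage s) + 1 by omega, dpK]
  congr 1
  refine trAvg_congr a hs fun s' hs' => ?_
  have : H + 1 - M.stage s' = H - M.stage s := by omega
  congr 1
  funext a'
  rw [dp, this]

/-- Backward induction over the stages. -/
theorem stage_induction (M : MDP S A H) {P : S → Prop} (hlast : ∀ s, H < M.stage s → P s)
    (hstep : ∀ s, M.stage s ≤ H → (∀ s', M.stage s' = M.stage s + 1 → P s') → P s) : ∀ s, P s := by
  have : ∀ k s, H + 1 - M.stage s ≤ k → P s := by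
    intro k
    induction k with
    | zero => intro s hs; exact hlast s (by omega)
    | succ k ih =>
      intro s hs
      by_cases h : M.stage s ≤ H
      · exact hstep s h fun s' hs' => ih s' (by omega)
      · exact hlast s (by omega)
  exact fun s => this _ s le_rfl

/-- The means by which a function that satisfies a Bellman equation is identified; only the values
at the next stage enter the recursion, since transitions raise the stage by one. -/
theorem dp_unique (M : MDP S A H) {f : S → A → ℝ} {N : S → (A → ℝ) → ℝ} {q : S → A → ℝ}
    (hlast : ∀ s a, H < M.stage s → q s a = 0)
    (hstep : ∀ s a, M.stage s ≤ H → q s a = f s a + trAvg M s a fun s' => N s' (q s')) :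
    ∀ s, q s = dp M f N s := by
  refine stage_induction M (fun s hs => funext fun a => ?_) (fun s hs ih => funext fun a => ?_)
  · rw [hlast s a hs, dp_last M f N hs]
  · rw [hstep s a hs, dp_eq M f N hs]
    congr 1
    exact trAvg_congr a hs fun s' hs' => by rw [ih s' hs']

/-- The aggregation that stops with probability `1 - ω` and the value `g`. -/
def stopNode (ω g : S → ℝ) (π : Policy S A) (s : S) (x : A → ℝ) : ℝ :=
  (1 - ω s) * g s + ω s * piAvg π s x

theorem dpK_stop_bounds (M : MDP S A H) (π : Policy S A) {f : S → A → ℝ} {ω g : S → ℝ} {B : ℝ}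
    (hf : ∀ s a, f s a ∈ Set.Icc (0 : ℝ) 1) (hω : ∀ s, ω s ∈ Set.Icc (0 : ℝ) 1)
    (hg : ∀ s, g s ∈ Set.Icc 0 B) (hB : 0 ≤ B) (k : ℕ) (s : S) (a : A) :
    dpK M f (stopNode ω g π) k s a ∈ Set.Icc 0 (k + B) := by
  induction k generalizing s a with
  | zero => simp [dpK, hB]
  | succ k ih =>
    have h1 : ∀ s', stopNode ω g π s' (dpK M f (stopNode ω g π) k s') ∈ Set.Icc 0 (k + B) := by
      intro s'
      have ha : 0 ≤ piAvg π s' (dpK M f (stopNode ω g π) k s') := by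
        rw [← piAvg_const π s' 0]
        exact piAvg_mono π s' fun a => (ih s' a).1
      have hb : piAvg π s' (dpK M f (stopNode ω g π) k s') ≤ k + B := by
        rw [← piAvg_const π s' (k + B)]
        exact piAvg_mono π s' fun a => (ih s' a).2
      obtain ⟨h0, h1⟩ := hω s'
      obtain ⟨g0, g1⟩ := hg s'
      have hk : (0 : ℝ) ≤ k := Nat.cast_nonneg k
      constructor
      · exact add_nonneg (mul_nonneg (by linarith) g0) (mul_nonneg h0 ha)
      · rw [stopNode]; nlinarith
    have h2 : trAvg M s a (fun s' => stopNode ω g π s' (dpK M f (stopNode ω g π) k s'))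
        ∈ Set.Icc 0 (k + B) := by
      constructor
      · exact Finset.sum_nonneg fun s' _ => mul_nonneg (tr_nonneg _ _ _ _) (h1 s').1
      · rw [← trAvg_const M s a (k + B)]
        exact Finset.sum_le_sum fun s' _ =>
          mul_le_mul_of_nonneg_left (h1 s').2 (tr_nonneg _ _ _ _)
    have := hf s a
    rw [dpK]
    constructor
    · exact add_nonneg this.1 h2.1
    · push_cast; linarith [this.2, h2.2]

/-- The return until the stopping time that stops at `s` with probability `1 - ω s`, plus the
value `g` of the state where it stops, averaged over the stopping time. -/
def stopReturn (ω g : S → ℝ) : ℕ → (ℕ → (S × A) × ℝ) → ℝ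
  | 0, _ => 0
  | k + 1, x => (x 0).2 + ((1 - ω (x 1).1.1) * g (x 1).1.1
      + ω (x 1).1.1 * stopReturn ω g k fun i => x (i + 1))

theorem stopReturn_mem {ω g : S → ℝ} {B : ℝ} (hω : ∀ s, ω s ∈ Set.Icc (0 : ℝ) 1)
    (hg : ∀ s, g s ∈ Set.Icc 0 B) (hB : 0 ≤ B) (k : ℕ) (x : ℕ → (S × A) × ℝ)
    (hx : ∀ i, (x i).2 ∈ Set.Icc (0 : ℝ) 1) : stopReturn ω g k x ∈ Set.Icc 0 (k + B) := by
  induction k generalizing x with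
  | zero => simp [stopReturn, hB]
  | succ k ih =>
    obtain ⟨i0, i1⟩ := ih (fun i => x (i + 1)) fun i => hx _
    obtain ⟨h0, h1⟩ := hω (x 1).1.1
    obtain ⟨g0, g1⟩ := hg (x 1).1.1
    obtain ⟨x0, x1⟩ := hx 0
    have hk : (0 : ℝ) ≤ k := Nat.cast_nonneg k
    rw [stopReturn]
    constructor
    · exact add_nonneg x0 (add_nonneg (mul_nonneg (by linarith) g0) (mul_nonneg h0 i0))
    · push_cast; nlinarith

theorem stopReturn_one (g : S → ℝ) (k : ℕ) (x : ℕ → (S × A) × ℝ) :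
    stopReturn (fun _ => 1) g k x = ∑ i ∈ Finset.range k, (x i).2 := by
  induction k generalizing x with
  | zero => simp [stopReturn]
  | succ k ih => rw [stopReturn, Finset.sum_range_succ', ih]; ring

variable [MeasurableSpace S] [MeasurableSpace A] [DiscreteMeasurableSpace S]
  [DiscreteMeasurableSpace A]

theorem measurable_stopReturn (ω g : S → ℝ) (k : ℕ) :
    Measurable (stopReturn ω g k : (ℕ → (S × A) × ℝ) → ℝ) := by
  induction k with
  | zero => exact measurable_const
  | succ k ih =>
    have h1 : Measurable fun x : ℕ → (S × A) × ℝ => (x 1).1.1 :=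
      measurable_fst.comp (measurable_fst.comp (measurable_pi_apply 1))
    have h2 : Measurable fun x : ℕ → (S × A) × ℝ => stopReturn ω g k fun i => x (i + 1) :=
      ih.comp (measurable_pi_lambda _ fun i => measurable_pi_apply _)
    have hω : Measurable fun x : ℕ → (S × A) × ℝ => ω (x 1).1.1 :=
      (Measurable.of_discrete (f := ω)).comp h1
    have hg : Measurable fun x : ℕ → (S × A) × ℝ => g (x 1).1.1 :=
      (Measurable.of_discrete (f := g)).comp h1
    have h0 : Measurable fun x : ℕ → (S × A) × ℝ => (x 0).2 :=
      measurable_snd.comp (measurable_pi_apply 0)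
    exact h0.add (((measurable_const.sub hω).mul hg).add (hω.mul h2))

theorem ae_pure (M : MDP S A H) (π : Policy S A) (z : S × A) (k : ℕ) :
    ∀ᵐ T ∂(trajLaw M π (PMF.pure z) k),
      (seqOf T 0).1 = z ∧ ∀ i, (seqOf T i).2 ∈ Set.Icc (0 : ℝ) 1 := by
  classical
  filter_upwards [ae_trajLaw M π (PMF.pure z) k] with T hT
  refine ⟨?_, fun i => hT.1 _⟩
  have := hT.2.1
  by_contra h
  refine this ?_
  rw [PMF.pure_apply, if_neg]
  rwa [seqOf_of_le T (Nat.zero_le k)] at h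

theorem meanReward_mem (M : MDP S A H) (s : S) (a : A) : meanReward M s a ∈ Set.Icc (0 : ℝ) 1 := by
  constructor
  · exact integral_nonneg_of_ae ((M.reward_mem s a).mono fun r hr => hr.1)
  · have hint : Integrable (fun r : ℝ => r) (M.reward s a) :=
      Integrable.of_mem_Icc 0 1 measurable_id.aemeasurable (M.reward_mem s a)
    calc meanReward M s a ≤ ∫ _, (1 : ℝ) ∂(M.reward s a) :=
          integral_mono_ae hint (integrable_const _) ((M.reward_mem s a).mono fun r hr => hr.2)
      _ = 1 := by simp

theorem lintegral_reward (M : MDP S A H) (s : S) (a : A) :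
    ∫⁻ r, ENNReal.ofReal r ∂(M.reward s a) = ENNReal.ofReal (meanReward M s a) := by
  have hint : Integrable (fun r : ℝ => r) (M.reward s a) :=
    Integrable.of_mem_Icc 0 1 measurable_id.aemeasurable (M.reward_mem s a)
  rw [meanReward, ofReal_integral_eq_lintegral_ofReal hint
    ((M.reward_mem s a).mono fun r hr => hr.1)]

theorem stepLaw_toReal (M : MDP S A H) (π : Policy S A) (z z' : S × A) :
    (stepLaw M π z z').toReal = tr M z.1 z.2 z'.1 * (π z'.1 z'.2).toReal := by
  rw [stepLaw_apply, ENNReal.toReal_mul, tr]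

theorem sum_stepLaw (M : MDP S A H) (π : Policy S A) (z : S × A) (F : S → A → ℝ) :
    ∑ z', (stepLaw M π z z').toReal * F z'.1 z'.2
      = trAvg M z.1 z.2 fun s' => piAvg π s' (F s') := by
  rw [Fintype.sum_prod_type, trAvg]
  refine Finset.sum_congr rfl fun s' _ => ?_
  rw [piAvg, Finset.mul_sum]
  refine Finset.sum_congr rfl fun a' _ => ?_
  rw [stepLaw_toReal]; ring

/-- The definition of `stopReturn` peels off the first step, and averaging over reward, next state
and next action turns it into one step of `dpK`. Everything is nonnegative, so lower integrals
suffice and integrability plays no role. -/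
theorem trajE_stopReturn (M : MDP S A H) (π : Policy S A) {ω g : S → ℝ} {B : ℝ}
    (hω : ∀ s, ω s ∈ Set.Icc (0 : ℝ) 1) (hg : ∀ s, g s ∈ Set.Icc 0 B) (hB : 0 ≤ B) (k : ℕ)
    (z : S × A) :
    trajE M π (PMF.pure z) k (fun x => ENNReal.ofReal (stopReturn ω g k x))
      = ENNReal.ofReal (dpK M (meanReward M) (stopNode ω g π) k z.1 z.2) := by
  classical
  induction k generalizing z with
  | zero => simp [trajE, stopReturn, dpK]
  | succ k ih =>
    set q := dpK M (meanReward M) (stopNode ω g π) k with hq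
    have hq0 : ∀ s a, 0 ≤ q s a := fun s a =>
      (dpK_stop_bounds M π (meanReward_mem M) hω hg hB k s a).1
    rw [trajE_succ M π _ k (measurable_stopReturn ω g (k + 1)).ennreal_ofReal]
    rw [Finset.sum_eq_single z (fun b _ hb => by simp [PMF.pure_apply, hb]) (by simp)]
    simp only [PMF.pure_apply, if_true, one_mul]
    have hin : ∀ z' : S × A, ∫⁻ r, trajE M π (PMF.pure z') k
        (fun x => ENNReal.ofReal (stopReturn ω g (k + 1) (seqCons (z, r) x))) ∂(M.reward z.1 z.2)
        = ENNReal.ofReal (meanReward M z.1 z.2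
          + ((1 - ω z'.1) * g z'.1 + ω z'.1 * q z'.1 z'.2)) := by
      intro z'
      have h1w : 0 ≤ 1 - ω z'.1 := by linarith [(hω z'.1).2]
      have hc0 : 0 ≤ (1 - ω z'.1) * g z'.1 := mul_nonneg h1w (hg z'.1).1
      have hr : ∀ᵐ r ∂(M.reward z.1 z.2), trajE M π (PMF.pure z') k
          (fun x => ENNReal.ofReal (stopReturn ω g (k + 1) (seqCons (z, r) x)))
          = ENNReal.ofReal r + (ENNReal.ofReal ((1 - ω z'.1) * g z'.1)
            + ENNReal.ofReal (ω z'.1) * ENNReal.ofReal (q z'.1 z'.2)) := by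
        filter_upwards [M.reward_mem z.1 z.2] with r hr
        rw [← ih z', trajE, trajE]
        have e : ∀ᵐ T ∂(trajLaw M π (PMF.pure z') k),
            ENNReal.ofReal (stopReturn ω g (k + 1) (seqCons (z, r) (seqOf T)))
            = ENNReal.ofReal r + (ENNReal.ofReal ((1 - ω z'.1) * g z'.1)
              + ENNReal.ofReal (ω z'.1) * ENNReal.ofReal (stopReturn ω g k (seqOf T))) := by
          filter_upwards [ae_pure M π z' k] with T hT
          have hsr := (stopReturn_mem hω hg hB k (seqOf T) hT.2).1
          rw [stopReturn]
          simp only [seqCons, hT.1]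
          rw [ENNReal.ofReal_add hr.1 (add_nonneg hc0 (mul_nonneg (hω z'.1).1 hsr)),
            ENNReal.ofReal_add hc0 (mul_nonneg (hω z'.1).1 hsr), ENNReal.ofReal_mul (hω z'.1).1]
        have hms : Measurable fun T : Traj S A k => ENNReal.ofReal (stopReturn ω g k (seqOf T)) :=
          ((measurable_stopReturn ω g k).comp measurable_seqOf).ennreal_ofReal
        rw [lintegral_congr_ae e, lintegral_add_left measurable_const,
          lintegral_add_left measurable_const, lintegral_const_mul _ hms]
        simp
      rw [lintegral_congr_ae hr, lintegral_add_right _ measurable_const, lintegral_reward]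
      simp only [lintegral_const, measure_univ, mul_one]
      rw [ENNReal.ofReal_add (meanReward_mem M z.1 z.2).1
        (add_nonneg hc0 (mul_nonneg (hω z'.1).1 (hq0 _ _))),
        ENNReal.ofReal_add hc0 (mul_nonneg (hω z'.1).1 (hq0 _ _)), ENNReal.ofReal_mul (hω z'.1).1]
    simp only [hin]
    have hnn : ∀ z' : S × A, 0 ≤ meanReward M z.1 z.2
        + ((1 - ω z'.1) * g z'.1 + ω z'.1 * q z'.1 z'.2) := fun z' =>
      add_nonneg (meanReward_mem M z.1 z.2).1 (add_nonneg
        (mul_nonneg (by linarith [(hω z'.1).2]) (hg z'.1).1) (mul_nonneg (hω z'.1).1 (hq0 _ _)))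
    have hterm : ∀ z' : S × A, stepLaw M π z z' * ENNReal.ofReal (meanReward M z.1 z.2
          + ((1 - ω z'.1) * g z'.1 + ω z'.1 * q z'.1 z'.2))
        = ENNReal.ofReal ((stepLaw M π z z').toReal * (meanReward M z.1 z.2
          + ((1 - ω z'.1) * g z'.1 + ω z'.1 * q z'.1 z'.2))) := by
      intro z'
      rw [ENNReal.ofReal_mul ENNReal.toReal_nonneg,
        ENNReal.ofReal_toReal ((stepLaw M π z).apply_ne_top z')]
    simp only [hterm]
    rw [← ENNReal.ofReal_sum_of_nonneg fun z' _ => mul_nonneg ENNReal.toReal_nonneg (hnn z')]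
    congr 1
    rw [sum_stepLaw M π z (fun s a => meanReward M z.1 z.2
      + ((1 - ω s) * g s + ω s * q s a)), dpK]
    have h2 : ∀ s', piAvg π s' (fun a => meanReward M z.1 z.2 + ((1 - ω s') * g s' + ω s' * q s' a))
        = meanReward M z.1 z.2 + stopNode ω g π s' (q s') := by
      intro s'
      rw [piAvg_add, piAvg_const, piAvg_add, piAvg_const, stopNode]
      congr 2
      simp only [piAvg, Finset.mul_sum]
      exact Finset.sum_congr rfl fun a _ => by ring
    simp only [h2]
    rw [trAvg_add, trAvg_const]

theorem integral_stopReturn (M : MDP S A H) (π : Policy S A) {ω g : S → ℝ} {B : ℝ}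
    (hω : ∀ s, ω s ∈ Set.Icc (0 : ℝ) 1) (hg : ∀ s, g s ∈ Set.Icc 0 B) (hB : 0 ≤ B) (k : ℕ)
    (z : S × A) :
    ∫ T, stopReturn ω g k (seqOf T) ∂(trajLaw M π (PMF.pure z) k)
      = dpK M (meanReward M) (stopNode ω g π) k z.1 z.2 := by
  rw [integral_eq_lintegral_of_nonneg_ae
    ((ae_pure M π z k).mono fun T hT => (stopReturn_mem hω hg hB k (seqOf T) hT.2).1)
    ((measurable_stopReturn ω g k).comp measurable_seqOf).aestronglyMeasurable]
  have h := trajE_stopReturn M π hω hg hB k z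
  rw [trajE] at h
  rw [h, ENNReal.toReal_ofReal (dpK_stop_bounds M π (meanReward_mem M) hω hg hB k _ _).1]

theorem sum_rewards_eq {k : ℕ} (T : Traj S A k) :
    ∑ i : Fin k, (T i.castSucc).2 = stopReturn (fun _ => 1) (fun _ => 0) k (seqOf T) := by
  rw [stopReturn_one, ← Fin.sum_univ_eq_sum_range (fun i => (seqOf T i).2)]
  refine Finset.sum_congr rfl fun i _ => ?_
  rw [seqOf_of_le T i.2.le]
  rfl

theorem stopNode_one (π : Policy S A) : stopNode (fun _ => 1) (fun _ => 0) π = piAvg π := by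
  funext s x; simp [stopNode]

/-- With $\omega=1$ one never stops, so the stopped return is the plain sum of rewards and the
aggregation is the average under $\pi$. -/
theorem qPi_eq_dp (M : MDP S A H) (π : Policy S A) : qPi M π = dp M (meanReward M) (piAvg π) := by
  funext s a
  rw [qPi]
  simp only [sum_rewards_eq]
  rw [integral_stopReturn M π (B := 0) (fun s => by simp) (fun s => by simp) le_rfl, stopNode_one]
  rfl

theorem vPi_eq (M : MDP S A H) (π : Policy S A) (s : S) : vPi M π s = piAvg π s (qPi M π s) := by
  classical
  rw [vPi]
  simp only [sum_rewards_eq]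
  set k := H + 1 - M.stage s with hk
  have h1 : ∀ s : S, (1 : ℝ) ∈ Set.Icc (0 : ℝ) 1 := fun s => by simp
  have h0 : ∀ s : S, (0 : ℝ) ∈ Set.Icc (0 : ℝ) 0 := fun s => by simp
  rw [integral_eq_lintegral_of_nonneg_ae
    ((ae_trajLaw M π _ k).mono fun T hT => (stopReturn_mem h1 h0 le_rfl k (seqOf T)
      (fun i => hT.1 _)).1)
    ((measurable_stopReturn _ _ k).comp measurable_seqOf).aestronglyMeasurable]
  have h := trajE_eq_sum M π (firstPair π s) k
    (fun x => ENNReal.ofReal (stopReturn (fun _ => 1) (fun _ => 0) k x))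
  rw [trajE] at h
  rw [h, ENNReal.toReal_sum]
  · rw [Fintype.sum_prod_type, Finset.sum_eq_single s]
    · refine Finset.sum_congr rfl fun a _ => ?_
      rw [ENNReal.toReal_mul, trajE_stopReturn M π h1 h0 le_rfl, ENNReal.toReal_ofReal
        (dpK_stop_bounds M π (meanReward_mem M) h1 h0 le_rfl k _ _).1, firstPair_apply, if_pos rfl,
        qPi_eq_dp, stopNode_one, dp]
    · intro s' _ hs'
      refine Finset.sum_eq_zero fun a _ => ?_
      rw [firstPair_apply, if_neg hs']; simp
    · simp
  · intro z _
    rw [trajE_stopReturn M π h1 h0 le_rfl]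
    exact ENNReal.mul_ne_top (PMF.apply_ne_top _ _) ENNReal.ofReal_ne_top

theorem qPi_last (M : MDP S A H) (π : Policy S A) {s : S} (hs : H < M.stage s) (a : A) :
    qPi M π s a = 0 := by
  rw [qPi_eq_dp, dp_last M _ _ hs]

theorem qPi_bellman (M : MDP S A H) (π : Policy S A) {s : S} (hs : M.stage s ≤ H) (a : A) :
    qPi M π s a = meanReward M s a + trAvg M s a fun s' => piAvg π s' (qPi M π s') := by
  rw [qPi_eq_dp, dp_eq M _ _ hs]

theorem qPi_unique (M : MDP S A H) (π : Policy S A) {q : S → A → ℝ}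
    (hlast : ∀ s a, H < M.stage s → q s a = 0)
    (hstep : ∀ s a, M.stage s ≤ H →
      q s a = meanReward M s a + trAvg M s a fun s' => piAvg π s' (q s')) : q = qPi M π := by
  rw [qPi_eq_dp]
  exact funext (dp_unique M hlast hstep)

theorem qPi_mem (M : MDP S A H) (π : Policy S A) (s : S) (a : A) :
    qPi M π s a ∈ Set.Icc (0 : ℝ) H := by
  have h := dpK_stop_bounds M π (meanReward_mem M) (ω := fun _ => 1) (g := fun _ => 0) (B := 0)
    (fun s => by simp) (fun s => by simp) le_rfl (H + 1 - M.stage s) s a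
  rw [stopNode_one] at h
  rw [qPi_eq_dp, dp]
  refine ⟨h.1, h.2.trans ?_⟩
  have := M.one_le_stage s
  rw [add_zero]
  exact_mod_cast (by omega : H + 1 - M.stage s ≤ H)

end Recursion

/-! ### Occupancies of policies and concentrability. -/

section Occupancy

variable {S A : Type*} [Fintype S] [Fintype A] {H : ℕ}

/-- Expectation of a function of the state-action pair after `t` steps. -/
def occE (M : MDP S A H) (π : Policy S A) (t : ℕ) (f : S → A → ℝ) : ℝ :=
  ∑ z, (pairLaw M π (firstPair π M.start) t z).toReal * f z.1 z.2

theorem occE_zero (M : MDP S A H) (π : Policy S A) (f : S → A → ℝ) :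
    occE M π 0 f = piAvg π M.start (f M.start) := by
  classical
  rw [occE, Fintype.sum_prod_type, Finset.sum_eq_single M.start]
  · refine Finset.sum_congr rfl fun a _ => ?_
    rw [pairLaw, firstPair_apply, if_pos rfl]
  · intro s' _ hs'
    refine Finset.sum_eq_zero fun a _ => ?_
    rw [pairLaw, firstPair_apply, if_neg hs']; simp
  · simp

theorem occE_succ (M : MDP S A H) (π : Policy S A) (t : ℕ) (f : S → A → ℝ) :
    occE M π (t + 1) f = occE M π t fun s a => trAvg M s a fun s' => piAvg π s' (f s') := by
  have h1 : ∀ z : S × A, trAvg M z.1 z.2 (fun s' => piAvg π s' (f s'))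
      = ∑ z', (stepLaw M π z z').toReal * f z'.1 z'.2 := by
    intro z
    rw [Fintype.sum_prod_type, trAvg]
    refine Finset.sum_congr rfl fun s' _ => ?_
    rw [piAvg, Finset.mul_sum]
    refine Finset.sum_congr rfl fun a' _ => ?_
    rw [stepLaw_apply, ENNReal.toReal_mul, tr]; ring
  simp only [occE, h1, Finset.mul_sum]
  rw [Finset.sum_comm]
  refine Finset.sum_congr rfl fun z' _ => ?_
  rw [pairLaw, pmf_bind_apply_fintype, ENNReal.toReal_sum, Finset.sum_mul]
  · refine Finset.sum_congr rfl fun z _ => ?_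
    rw [ENNReal.toReal_mul, mul_assoc]
  · exact fun z _ => ENNReal.mul_ne_top (PMF.apply_ne_top _ _) (PMF.apply_ne_top _ _)

theorem occE_const (M : MDP S A H) (π : Policy S A) (t : ℕ) (c : ℝ) :
    occE M π t (fun _ _ => c) = c := by
  rw [occE, ← Finset.sum_mul, pmf_sum_toReal, one_mul]

theorem occE_add (M : MDP S A H) (π : Policy S A) (t : ℕ) (f g : S → A → ℝ) :
    occE M π t (fun s a => f s a + g s a) = occE M π t f + occE M π t g := by
  simp [occE, mul_add, Finset.sum_add_distrib]

theorem occE_sub (M : MDP S A H) (π : Policy S A) (t : ℕ) (f g : S → A → ℝ) :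
    occE M π t (fun s a => f s a - g s a) = occE M π t f - occE M π t g := by
  simp [occE, mul_sub, Finset.sum_sub_distrib]

theorem stage_of_pairLaw (M : MDP S A H) (π : Policy S A) {t : ℕ} (ht : t ≤ H) {z : S × A}
    (hz : pairLaw M π (firstPair π M.start) t z ≠ 0) : M.stage z.1 = t + 1 := by
  classical
  induction t generalizing z with
  | zero =>
    rw [pairLaw, firstPair_apply] at hz
    have : z.1 = M.start := by
      by_contra h; simp [h] at hz
    rw [(M.stage_eq_one z.1).2 this]
  | succ t ih =>
    rw [pairLaw, pmf_bind_apply_fintype] at hz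
    obtain ⟨y, _, hy⟩ := Finset.exists_ne_zero_of_sum_ne_zero hz
    have h1 := ih (by omega) (left_ne_zero_of_mul hy)
    have h2 := right_ne_zero_of_mul hy
    rw [stepLaw_apply] at h2
    have h3 := M.stage_trans y.1 y.2 z.1 (by omega) ((PMF.mem_support_iff _ _).2
      (left_ne_zero_of_mul h2))
    omega

theorem occE_mono (M : MDP S A H) (π : Policy S A) {t : ℕ} (ht : t ≤ H) {f g : S → A → ℝ}
    (h : ∀ s a, M.stage s = t + 1 → f s a ≤ g s a) : occE M π t f ≤ occE M π t g := by
  refine Finset.sum_le_sum fun z _ => ?_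
  by_cases hz : pairLaw M π (firstPair π M.start) t z = 0
  · simp [hz]
  · exact mul_le_mul_of_nonneg_left (h _ _ (stage_of_pairLaw M π ht hz)) ENNReal.toReal_nonneg

theorem occE_congr (M : MDP S A H) (π : Policy S A) {t : ℕ} (ht : t ≤ H) {f g : S → A → ℝ}
    (h : ∀ s a, M.stage s = t + 1 → f s a = g s a) : occE M π t f = occE M π t g :=
  le_antisymm (occE_mono M π ht fun s a hs => (h s a hs).le)
    (occE_mono M π ht fun s a hs => (h s a hs).ge)

/-- Policies that agree on the first stages have the same occupancies there. -/
theorem occE_policy_congr (M : MDP S A H) {π π' : Policy S A} {t : ℕ} (ht : t ≤ H)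
    (h : ∀ s, M.stage s ≤ t + 1 → π s = π' s) (f : S → A → ℝ) : occE M π t f = occE M π' t f := by
  induction t generalizing f with
  | zero =>
    rw [occE_zero, occE_zero, piAvg, piAvg, h M.start]
    rw [(M.stage_eq_one _).2 rfl]
  | succ t ih =>
    rw [occE_succ, occE_succ, ih (by omega) fun s hs => h s (by omega)]
    refine occE_congr M π' (by omega) fun s a hs => ?_
    refine trAvg_congr a (by omega) fun s' hs' => ?_
    rw [piAvg, piAvg, h s' (by omega)]

variable [MeasurableSpace S] [MeasurableSpace A] [DiscreteMeasurableSpace S]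
  [DiscreteMeasurableSpace A]

theorem lintegral_stepAt (M : MDP S A H) (π : Policy S A) {t : ℕ} (ht : t ≤ H)
    (ψ : S × A → ℝ≥0∞) :
    ∫⁻ T, ψ (seqOf T t).1 ∂(startLaw M π)
      = ∑ z, pairLaw M π (firstPair π M.start) t z * ψ z := by
  have hψ : Measurable fun x : ℕ → (S × A) × ℝ => ψ (x 0).1 :=
    (Measurable.of_discrete (f := ψ)).comp (measurable_fst.comp (measurable_pi_apply 0))
  have h := trajE_shift M π (firstPair π M.start) (H - t) t H (by omega) hψ
  rw [trajE_first] at h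
  simp only [zero_add] at h
  exact h

theorem occupancy_eq (M : MDP S A H) (π : Policy S A) (t : Fin H) (z : S × A) :
    occupancy M π t z = pairLaw M π (firstPair π M.start) t z := by
  classical
  have h := lintegral_stepAt M π t.2.le (fun y => if y = z then 1 else 0)
  have hm : MeasurableSet {T : Traj S A H | (T t.castSucc).1 = z} :=
    (measurable_fst.comp (measurable_pi_apply t.castSucc)) (MeasurableSet.singleton z)
  rw [Finset.sum_eq_single z (fun b _ hb => by simp [hb]) (by simp)] at h
  rw [if_pos rfl, mul_one] at h
  rw [← h, occupancy, ← lintegral_indicator_one hm]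
  refine lintegral_congr fun T => ?_
  rw [seqOf_of_le T t.2.le, Set.indicator_apply]
  rfl

theorem occE_le_of_concentrable {M : MDP S A H} {π₀ : Policy S A} {C : ℝ} (hC : 0 ≤ C)
    (hconc : Concentrable M π₀ C) (π : Policy S A) {t : ℕ} (ht : t < H) {f : S → A → ℝ}
    (hf : ∀ s a, M.stage s = t + 1 → 0 ≤ f s a) : occE M π t f ≤ C * occE M π₀ t f := by
  rw [occE, occE, Finset.mul_sum]
  refine Finset.sum_le_sum fun z _ => ?_
  have h := hconc (occupancy M π) ⟨π, fun _ _ => rfl⟩ ⟨t, ht⟩ z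
  rw [occupancy_eq, occupancy_eq] at h
  simp only at h
  have h' := ENNReal.toReal_mono (ENNReal.mul_ne_top ENNReal.ofReal_ne_top
    (PMF.apply_ne_top _ _)) h
  rw [ENNReal.toReal_mul, ENNReal.toReal_ofReal hC] at h'
  -- The sign of $f$ is known only at the stage $t+1$. Pairs of probability zero under $\pi^0$ have
  -- probability zero under $\pi$ as well, and all the others are in that stage.
  by_cases hz : pairLaw M π₀ (firstPair π₀ M.start) t z = 0
  · rw [hz] at h' ⊢
    have h0 : (pairLaw M π (firstPair π M.start) t z).toReal = 0 := by
      refine le_antisymm (by simpa using h') ENNReal.toReal_nonneg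
    rw [h0]; simp
  · rw [← mul_assoc]
    exact mul_le_mul_of_nonneg_right h' (hf _ _ (stage_of_pairLaw M π₀ ht.le hz))

end Occupancy

/-! ### Clipped values, the size of a guess and the skipping probability. -/

section Learner

theorem clip_mem (H : ℕ) (x : ℝ) : clip H x ∈ Set.Icc (0 : ℝ) H :=
  ⟨le_max_left _ _, max_le (Nat.cast_nonneg H) (min_le_left _ _)⟩

theorem clip_of_mem {H : ℕ} {x : ℝ} (hx : x ∈ Set.Icc (0 : ℝ) H) : clip H x = x := by
  rw [clip, min_eq_right hx.2, max_eq_right hx.1]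

theorem clip_mono (H : ℕ) : Monotone (clip H) := fun _ _ h =>
  max_le_max le_rfl (min_le_min le_rfl h)

theorem abs_clip_sub_le (H : ℕ) (x y : ℝ) : |clip H x - clip H y| ≤ |x - y| := by
  refine (abs_max_sub_max_le_max _ _ _ _).trans (max_le (by simp) ?_)
  refine (abs_min_sub_min_le_max _ _ _ _).trans (max_le (by simp) le_rfl)

theorem abs_clip_sub_of_mem {H : ℕ} {x y : ℝ} (hy : y ∈ Set.Icc (0 : ℝ) H) :
    |clip H x - y| ≤ |x - y| := by
  have := abs_clip_sub_le H x y
  rwa [clip_of_mem hy] at this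

theorem abs_iSup_sub_iSup_le {X : Type*} [Finite X] [Nonempty X] {f g : X → ℝ} {c : ℝ}
    (h : ∀ x, |f x - g x| ≤ c) : |(⨆ x, f x) - ⨆ x, g x| ≤ c := by
  have hf := Set.finite_range f |>.bddAbove
  have hg := Set.finite_range g |>.bddAbove
  rw [abs_le]
  constructor
  · rw [neg_le_sub_iff_le_add]
    exact ciSup_le fun x => by linarith [(abs_le.1 (h x)).1, le_ciSup hf x]
  · rw [sub_le_iff_le_add]
    exact ciSup_le fun x => by linarith [(abs_le.1 (h x)).2, le_ciSup hg x]

theorem norm_le_of_coord {d : ℕ} (hd : 1 ≤ d) {x : Vec d} {r : ℝ}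
    (h : ∀ i, |x i| ≤ r) : ‖x‖ ≤ d * r := by
  have hr : 0 ≤ r := (abs_nonneg _).trans (h ⟨0, hd⟩)
  rw [EuclideanSpace.norm_eq]
  refine Real.sqrt_le_iff.2 ⟨by positivity, ?_⟩
  have h1 : ∀ i ∈ Finset.univ, ‖x i‖ ^ 2 ≤ r ^ 2 := fun i _ => by
    rw [Real.norm_eq_abs]; exact pow_le_pow_left₀ (abs_nonneg _) (h i) 2
  have h2 := Finset.sum_le_sum h1
  simp only [Finset.sum_const, Finset.card_univ, Fintype.card_fin, nsmul_eq_mul] at h2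
  refine h2.trans ?_
  rw [mul_pow]
  have : (1 : ℝ) ≤ d := by exact_mod_cast hd
  nlinarith [sq_nonneg r, mul_nonneg (sq_nonneg r) (by linarith : (0 : ℝ) ≤ d - 1)]

theorem abs_coord_le_norm {d : ℕ} (x : Vec d) (i : Fin d) : |x i| ≤ ‖x‖ := by
  have := PiLp.norm_apply_le x i
  simpa using this

variable {S A : Type*} [Fintype A] [Nonempty A] (p : Params) (stage : S → ℕ) (φ : S → A → Vec p.d)

theorem vBar_mem (θ : Vec p.d) (s : S) : vBar p φ θ s ∈ Set.Icc (0 : ℝ) p.H := clip_mem _ _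

theorem qBar_mem (θ : Vec p.d) (s : S) (a : A) : qBar p φ θ s a ∈ Set.Icc (0 : ℝ) p.H :=
  clip_mem _ _

theorem qBar_le_vBar (θ : Vec p.d) (s : S) (a : A) : qBar p φ θ s a ≤ vBar p φ θ s :=
  clip_mono _ (le_ciSup (f := fun a => inner ℝ (φ s a) θ) (Set.finite_range _).bddAbove a)

theorem exists_vBar_eq (θ : Vec p.d) (s : S) : ∃ a, vBar p φ θ s = qBar p φ θ s a := by
  obtain ⟨a, ha⟩ := exists_eq_ciSup_of_finite (f := fun a => inner ℝ (φ s a) θ)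
  exact ⟨a, by rw [vBar, qBar, ← ha]⟩

theorem abs_vBar_sub_le {θ θ' : Vec p.d} {s : S} {c : ℝ}
    (h : ∀ a, |qBar p φ θ s a - qBar p φ θ' s a| ≤ c) :
    |vBar p φ θ s - vBar p φ θ' s| ≤ c := by
  obtain ⟨a, ha⟩ := exists_vBar_eq p φ θ s
  obtain ⟨b, hb⟩ := exists_vBar_eq p φ θ' s
  have h1 := qBar_le_vBar p φ θ s b
  have h2 := qBar_le_vBar p φ θ' s a
  have h3 := abs_le.1 (h a)
  have h4 := abs_le.1 (h b)
  rw [abs_le]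
  constructor <;> linarith

theorem abs_qBar_sub_le {L₁ : ℝ} (hφ : ∀ s a, ‖φ s a‖ ≤ L₁) (θ θ' : Vec p.d) (s : S) (a : A) :
    |qBar p φ θ s a - qBar p φ θ' s a| ≤ L₁ * ‖θ - θ'‖ := by
  refine (abs_clip_sub_le _ _ _).trans ?_
  rw [← inner_sub_right]
  exact (abs_real_inner_le_norm _ _).trans (mul_le_mul_of_nonneg_right (hφ s a) (norm_nonneg _))

variable {p}

theorem Params.Valid.alpha_pos (hp : p.Valid) : 0 < p.alpha := by
  obtain ⟨h1, h2, h3, -⟩ := hp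
  unfold Params.alpha
  positivity

theorem Params.Valid.sqrt_pos (hp : p.Valid) : 0 < Real.sqrt (2 * p.d) := by
  have : (1 : ℝ) ≤ p.d := by exact_mod_cast hp.2.1
  exact Real.sqrt_pos.2 (by linarith)

/-- The design needs $2d$ vectors per stage. For $d\ge 6$ one has $\log\log d\ge 1/2$, and for $3\le
d\le5$ the double logarithm is nonnegative. For $d=2$ it is at least $-1$ and for $d=1$ it is $0$ by
convention; in these cases the summand $16$ leaves enough room. -/
theorem Params.Valid.d₀_pos (hp : p.Valid) : 2 * p.d ≤ p.d₀ := by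
  have hd := hp.2.1
  rw [Params.d₀]
  have key : (2 * p.d : ℝ) ≤ 4 * (p.d : ℝ) * Real.log (Real.log p.d) + 16 := by
    by_cases h6 : 6 ≤ p.d
    · have h6' : (6 : ℝ) ≤ p.d := by exact_mod_cast h6
      have e1 : Real.exp (1 / 2) ≤ 1.65 := by
        have h := Real.exp_one_lt_d9
        have h2 : Real.exp (1 / 2) ^ 2 = Real.exp 1 := by
          rw [← Real.exp_nat_mul]; norm_num
        nlinarith [Real.exp_pos (1 / 2)]
      have e2 : (1.65 : ℝ) ≤ Real.log p.d := by
        rw [Real.le_log_iff_exp_le (by linarith)]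
        refine le_trans ?_ h6'
        have h := Real.exp_one_lt_d9
        have h2 : Real.exp 1.65 ^ 20 = Real.exp 1 ^ 33 := by
          rw [← Real.exp_nat_mul, ← Real.exp_nat_mul]; norm_num
        have h3 : Real.exp 1 ^ 33 ≤ 6 ^ 20 := by
          refine (pow_le_pow_left₀ (Real.exp_pos 1).le h.le 33).trans ?_
          norm_num
        rw [← h2] at h3
        exact le_of_pow_le_pow_left₀ (by norm_num) (by norm_num) h3
      have e3 : (1 / 2 : ℝ) ≤ Real.log (Real.log p.d) := by
        rw [Real.le_log_iff_exp_le (by linarith)]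
        exact e1.trans e2
      nlinarith
    · have hcase : p.d = 1 ∨ p.d = 2 ∨ 3 ≤ p.d := by omega
      rcases hcase with h | h | h
      · rw [h]; simp; norm_num
      · rw [h]
        have e1 : (1 / 2 : ℝ) ≤ Real.log 2 := by linarith [Real.log_two_gt_d9]
        have e2 : -1 ≤ Real.log (Real.log 2) := by
          rw [Real.le_log_iff_exp_le (by linarith)]
          refine le_trans ?_ e1
          rw [Real.exp_neg, inv_le_comm₀ (Real.exp_pos _) (by norm_num)]
          linarith [Real.exp_one_gt_d9]
        push_cast; linarith
      · have h3 : (3 : ℝ) ≤ p.d := by exact_mod_cast h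
        have h5 : (p.d : ℝ) ≤ 5 := by exact_mod_cast (by omega : p.d ≤ 5)
        have e1 : 1 ≤ Real.log p.d := by
          rw [Real.le_log_iff_exp_le (by linarith)]
          linarith [Real.exp_one_lt_d9]
        have e2 : 0 ≤ Real.log (Real.log p.d) := Real.log_nonneg e1
        nlinarith
  have := Nat.le_ceil (4 * (p.d : ℝ) * Real.log (Real.log p.d) + 16)
  exact_mod_cast key.trans this

theorem Params.Valid.nonempty_d₀ (hp : p.Valid) : Nonempty (Fin p.d₀) :=
  ⟨⟨0, by have := hp.d₀_pos; have := hp.2.1; omega⟩⟩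

theorem Params.Valid.d₀_le (hp : p.Valid) : (p.d₀ : ℝ) ≤ 4 * p.d * Real.log p.d + 17 := by
  have hd : (1 : ℝ) ≤ p.d := by exact_mod_cast hp.2.1
  have h17 : (p.d₀ : ℝ) ≤ max (4 * (p.d : ℝ) * Real.log (Real.log p.d) + 16) 0 + 1 := by
    rw [Params.d₀]
    rcases le_or_gt 0 (4 * (p.d : ℝ) * Real.log (Real.log p.d) + 16) with h | h
    · exact (Nat.ceil_lt_add_one h).le.trans (by gcongr; exact le_max_left _ _)
    · rw [Nat.ceil_eq_zero.2 h.le]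
      push_cast
      positivity
  have h0 : 0 ≤ Real.log p.d := Real.log_nonneg hd
  have h1 : Real.log (Real.log p.d) ≤ Real.log p.d := Real.log_le_self h0
  refine h17.trans ?_
  have : max (4 * (p.d : ℝ) * Real.log (Real.log p.d) + 16) 0 ≤ 4 * p.d * Real.log p.d + 16 := by
    refine max_le ?_ (by positivity)
    gcongr
  linarith

-- The three branches are the pieces of a clamped affine function of the range; Lipschitz continuity
-- is easier to read off from this form.
open Classical in
theorem omega_eq (hp : p.Valid) (G : ℕ → Fin p.d₀ → Vec p.d) (s : S) :
    omega p stage φ G s = if stage s = 1 ∨ stage s = p.H + 1 then 0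
      else min 1 (max 0 (2 - Real.sqrt (2 * p.d) * rangeG p stage φ G s / p.alpha)) := by
  have hα := hp.alpha_pos
  have hc := hp.sqrt_pos
  rw [omega]
  split_ifs with h1 h2 h3
  · rfl
  · rw [le_div_iff₀ hc] at h2
    have : Real.sqrt (2 * p.d) * rangeG p stage φ G s / p.alpha ≤ 1 := by
      rw [div_le_one hα]; linarith
    rw [min_eq_left]
    exact le_max_of_le_right (by linarith)
  · rw [le_div_iff₀ hc] at h3
    rw [not_le, div_lt_iff₀ hc] at h2
    have e1 : Real.sqrt (2 * p.d) * rangeG p stage φ G s / p.alpha ≤ 2 := by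
      rw [div_le_iff₀ hα]; linarith
    have e2 : 1 ≤ Real.sqrt (2 * p.d) * rangeG p stage φ G s / p.alpha := by
      rw [le_div_iff₀ hα]; linarith
    rw [max_eq_right (by linarith), min_eq_right (by linarith)]
  · rw [not_le, div_lt_iff₀ hc] at h3
    have e1 : 2 ≤ Real.sqrt (2 * p.d) * rangeG p stage φ G s / p.alpha := by
      rw [le_div_iff₀ hα]; linarith
    rw [max_eq_left (by linarith), min_eq_right (by norm_num)]

theorem omega_mem (hp : p.Valid) (G : ℕ → Fin p.d₀ → Vec p.d) (s : S) :
    omega p stage φ G s ∈ Set.Icc (0 : ℝ) 1 := by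
  rw [omega_eq stage φ hp]
  split_ifs
  · simp
  · exact ⟨le_min zero_le_one (le_max_left _ _), min_le_left _ _⟩

theorem omega_last (G : ℕ → Fin p.d₀ → Vec p.d) {s : S} (hs : stage s = p.H + 1) :
    omega p stage φ G s = 0 := by
  rw [omega, if_pos (Or.inr hs)]

theorem omega_first (G : ℕ → Fin p.d₀ → Vec p.d) {s : S} (hs : stage s = 1) :
    omega p stage φ G s = 0 := by
  rw [omega, if_pos (Or.inl hs)]

theorem le_rangeG (G : ℕ → Fin p.d₀ → Vec p.d) (s : S) (i : Fin p.d₀) (a a' : A) :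
    inner ℝ (φ s a - φ s a') (G (stage s) i) ≤ rangeG p stage φ G s :=
  le_ciSup (f := fun x : Fin p.d₀ × A × A => inner ℝ (φ s x.2.1 - φ s x.2.2) (G (stage s) x.1))
    (Set.finite_range _).bddAbove (i, a, a')

theorem exists_rangeG_eq (hp : p.Valid) (G : ℕ → Fin p.d₀ → Vec p.d) (s : S) :
    ∃ i a a', rangeG p stage φ G s = inner ℝ (φ s a - φ s a') (G (stage s) i) := by
  have := hp.nonempty_d₀
  obtain ⟨x, hx⟩ := exists_eq_ciSup_of_finite
    (f := fun x : Fin p.d₀ × A × A => inner ℝ (φ s x.2.1 - φ s x.2.2) (G (stage s) x.1))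
  exact ⟨x.1, x.2.1, x.2.2, hx.symm⟩

theorem rangeG_le_of_omega_ne_zero (hp : p.Valid) (G : ℕ → Fin p.d₀ → Vec p.d) {s : S}
    (h : omega p stage φ G s ≠ 0) :
    Real.sqrt (2 * p.d) * rangeG p stage φ G s ≤ 2 * p.alpha := by
  have hα := hp.alpha_pos
  rw [omega_eq stage φ hp] at h
  split_ifs at h with h1
  · exact absurd rfl h
  · by_contra hcon
    push Not at hcon
    refine h ?_
    have e1 : 2 ≤ Real.sqrt (2 * p.d) * rangeG p stage φ G s / p.alpha := by
      rw [le_div_iff₀ hα]; linarith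
    rw [max_eq_left (by linarith), min_eq_right (by norm_num)]

theorem lt_rangeG_of_omega_ne_one (G : ℕ → Fin p.d₀ → Vec p.d) {s : S}
    (h1 : stage s ≠ 1) (h2 : stage s ≠ p.H + 1) (h : omega p stage φ G s ≠ 1) :
    p.alpha / Real.sqrt (2 * p.d) < rangeG p stage φ G s := by
  rw [omega, if_neg (by tauto)] at h
  by_contra hcon
  push Not at hcon
  rw [if_pos hcon] at h
  exact h rfl

/-- This continuity in the guess is the purpose of interpolating $\omega_G$ between $0$ and $1$: a
hard threshold would not allow the covering argument over guesses. -/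
theorem abs_omega_sub_le (hp : p.Valid) {L₁ : ℝ} (hφ : ∀ s a, ‖φ s a‖ ≤ L₁)
    {G G' : ℕ → Fin p.d₀ → Vec p.d} {s : S} {r : ℝ} (hr : 0 ≤ r)
    (h : ∀ i, stage s ≠ p.H + 1 → ‖G (stage s) i - G' (stage s) i‖ ≤ r) :
    |omega p stage φ G s - omega p stage φ G' s|
      ≤ Real.sqrt (2 * p.d) / p.alpha * (2 * L₁ * r) := by
  have := hp.nonempty_d₀
  have hα := hp.alpha_pos
  have hL₁ : 0 ≤ L₁ := (norm_nonneg _).trans (hφ s (Classical.arbitrary A))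
  rw [omega_eq stage φ hp, omega_eq stage φ hp]
  split_ifs with h1
  · rw [sub_self, abs_zero]; positivity
  · push Not at h1
    have hrange : |rangeG p stage φ G s - rangeG p stage φ G' s| ≤ 2 * L₁ * r := by
      refine abs_iSup_sub_iSup_le fun x => ?_
      rw [← inner_sub_right]
      refine (abs_real_inner_le_norm _ _).trans
        (mul_le_mul ?_ (h x.1 h1.2) (norm_nonneg _) (by positivity))
      refine (norm_sub_le _ _).trans ?_
      linarith [hφ s x.2.1, hφ s x.2.2]
    refine (abs_min_sub_min_le_max _ _ _ _).trans (max_le (by simp; positivity) ?_)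
    refine (abs_max_sub_max_le_max _ _ _ _).trans (max_le (by simp; positivity) ?_)
    have e : 2 - Real.sqrt (2 * p.d) * rangeG p stage φ G s / p.alpha
        - (2 - Real.sqrt (2 * p.d) * rangeG p stage φ G' s / p.alpha)
        = -(Real.sqrt (2 * p.d) / p.alpha * (rangeG p stage φ G s - rangeG p stage φ G' s)) := by
      ring
    rw [e, abs_neg, abs_mul, abs_of_nonneg (by positivity : 0 ≤ Real.sqrt (2 * p.d) / p.alpha)]
    gcongr

end Learner

/-! ### The least-squares targets as stopped returns. -/

section Target

variable {S A : Type*} [Fintype A] [Nonempty A]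

theorem sum_stopProb_seq {ω : S → ℝ} (k : ℕ) (x : ℕ → (S × A) × ℝ)
    (hk : ω (x (k + 1)).1.1 = 0) :
    ∑ i ∈ Finset.range (k + 1), (1 - ω (x (i + 1)).1.1)
      * ∏ u ∈ Finset.range i, ω (x (u + 1)).1.1 = 1 := by
  induction k generalizing x with
  | zero => simpa using hk
  | succ k ih =>
    have h := ih (fun i => x (i + 1)) hk
    rw [Finset.sum_range_succ']
    have : ∀ i, (1 - ω (x (i + 1 + 1)).1.1) * ∏ u ∈ Finset.range (i + 1), ω (x (u + 1)).1.1
        = ω (x 1).1.1 * ((1 - ω (x (i + 1 + 1)).1.1)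
          * ∏ u ∈ Finset.range i, ω (x (u + 1 + 1)).1.1) := by
      intro i
      rw [Finset.prod_range_succ']
      ring
    simp only [this, ← Finset.mul_sum, h]
    simp

/-- Splitting off the first step leaves the same sum for the shifted sequence. The first reward
occurs in every summand, and its total weight is one because stopping is forced at the last step. -/
theorem sum_stop_eq_stopReturn {ω g : S → ℝ} (k : ℕ) (x : ℕ → (S × A) × ℝ)
    (hk : ω (x (k + 1)).1.1 = 0) :
    ∑ i ∈ Finset.range (k + 1), ((1 - ω (x (i + 1)).1.1)
      * ∏ u ∈ Finset.range i, ω (x (u + 1)).1.1)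
        * (∑ u ∈ Finset.range (i + 1), (x u).2 + g (x (i + 1)).1.1)
      = stopReturn ω g (k + 1) x := by
  induction k generalizing x with
  | zero =>
    simp only [zero_add, Finset.range_one, Finset.sum_singleton, Finset.range_zero,
      Finset.prod_empty, mul_one, stopReturn]
    simp only [zero_add] at hk
    rw [hk]; ring
  | succ k ih =>
    have h := ih (fun i => x (i + 1)) hk
    have h1 := sum_stopProb_seq (ω := ω) k (fun i => x (i + 1)) hk
    rw [Finset.sum_range_succ', stopReturn]
    have e : ∀ i, ((1 - ω (x (i + 1 + 1)).1.1) * ∏ u ∈ Finset.range (i + 1), ω (x (u + 1)).1.1)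
        * (∑ u ∈ Finset.range (i + 1 + 1), (x u).2 + g (x (i + 1 + 1)).1.1)
        = (ω (x 1).1.1 * (x 0).2) * ((1 - ω (x (i + 1 + 1)).1.1)
            * ∏ u ∈ Finset.range i, ω (x (u + 1 + 1)).1.1)
          + ω (x 1).1.1 * (((1 - ω (x (i + 1 + 1)).1.1)
            * ∏ u ∈ Finset.range i, ω (x (u + 1 + 1)).1.1)
            * (∑ u ∈ Finset.range (i + 1), (x (u + 1)).2 + g (x (i + 1 + 1)).1.1)) := by
      intro i
      rw [Finset.prod_range_succ', Finset.sum_range_succ']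
      ring
    simp only [e, Finset.sum_add_distrib, ← Finset.mul_sum, h, h1]
    simp
    ring

variable {p : Params} {M : MDP S A p.H}

/-- Rewards are in `[0, 1]`, and the states are in the right stages. -/
def GoodTraj (M : MDP S A p.H) (T : Traj S A p.H) : Prop :=
  (∀ i, (seqOf T i).2 ∈ Set.Icc (0 : ℝ) 1) ∧ ∀ i ≤ p.H, M.stage (seqOf T i).1.1 = i + 1

/-- Stage $h$ is at position $h-1$ of the trajectory, and $H+1-h$ steps remain. The terminal state
has $\omega_G=0$, which forces the stop. -/
theorem target_eq_stopReturn (φ : S → A → Vec p.d) (G : ℕ → Fin p.d₀ → Vec p.d)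
    {T : Traj S A p.H} (hT : GoodTraj M T) {h : ℕ} (h1 : 1 ≤ h) (hH : h ≤ p.H)
    (θ : ℕ → Vec p.d) :
    target p M.stage φ G T h θ = stopReturn (omega p M.stage φ G)
      (fun s => vBar p φ (θ (M.stage s)) s) (p.H + 1 - h) (fun i => seqOf T (i + (h - 1))) := by
  obtain ⟨k, hk⟩ : ∃ k, p.H + 1 - h = k + 1 := ⟨p.H - h, by omega⟩
  have hlast : omega p M.stage φ G (seqOf T (k + 1 + (h - 1))).1.1 = 0 := by
    refine omega_last M.stage φ G ?_
    have := hT.2 (k + 1 + (h - 1)) (by omega)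
    omega
  rw [hk, ← sum_stop_eq_stopReturn k _ hlast, target]
  have e1 : Finset.Icc (h + 1) (p.H + 1) = Finset.Ico (h + 1) (p.H + 2) := by
    ext; simp; omega
  rw [e1, Finset.sum_Ico_eq_sum_range, show p.H + 2 - (h + 1) = k + 1 by omega]
  refine Finset.sum_congr rfl fun i _ => ?_
  rw [stopProb, Finset.prod_Ico_eq_prod_range, Finset.sum_Ico_eq_sum_range,
    show h + 1 + i - (h + 1) = i by omega, show h + 1 + i - h = i + 1 by omega]
  have e2 : ∀ j, stepAt T (h + 1 + j) = seqOf T (j + 1 + (h - 1)) := fun j => by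
    rw [stepAt_eq_seqOf]; congr 1; omega
  have e3 : ∀ j, stepAt T (h + j) = seqOf T (j + (h - 1)) := fun j => by
    rw [stepAt_eq_seqOf]; congr 1; omega
  simp only [e2, e3]

theorem stopReturn_congr {ω ω' g g' : S → ℝ} (k : ℕ) (x : ℕ → (S × A) × ℝ)
    (h : ∀ i < k, ω (x (i + 1)).1.1 = ω' (x (i + 1)).1.1 ∧ g (x (i + 1)).1.1 = g' (x (i + 1)).1.1) :
    stopReturn ω g k x = stopReturn ω' g' k x := by
  induction k generalizing x with
  | zero => rfl
  | succ k ih =>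
    obtain ⟨h1, h2⟩ := h 0 (by omega)
    simp only [zero_add] at h1 h2
    rw [stopReturn, stopReturn, ih (fun i => x (i + 1)) fun i hi => h (i + 1) (by omega), h1, h2]

/-- Values of the families at stages that the target never reads may be changed freely; at the stage
$H+1$ the guess is not read because $\omega_G$ is zero there. -/
theorem target_congr (hp : p.Valid) (φ : S → A → Vec p.d)
    {G G' : ℕ → Fin p.d₀ → Vec p.d}
    {T : Traj S A p.H} (hT : GoodTraj M T) {h : ℕ} (h1 : 1 ≤ h) (hH : h ≤ p.H)
    {θ θ' : ℕ → Vec p.d} (hG : ∀ u ≤ p.H, G u = G' u)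
    (hθ : ∀ u, h < u → u ≤ p.H + 1 → θ u = θ' u) :
    target p M.stage φ G T h θ = target p M.stage φ G' T h θ' := by
  rw [target_eq_stopReturn φ G hT h1 hH, target_eq_stopReturn φ G' hT h1 hH]
  refine stopReturn_congr _ _ fun i hi => ?_
  have hs := hT.2 (i + 1 + (h - 1)) (by omega)
  constructor
  · by_cases hl : i + 1 + (h - 1) = p.H
    · rw [omega_last _ _ _ (by rw [hs, hl]), omega_last _ _ _ (by rw [hs, hl])]
    · rw [omega_eq _ _ hp, omega_eq _ _ hp, rangeG, rangeG, hG _ (by omega)]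
  · rw [hθ _ (by omega) (by omega)]

variable [Fintype S] [MeasurableSpace S] [MeasurableSpace A]
  [DiscreteMeasurableSpace S] [DiscreteMeasurableSpace A]

theorem ae_goodTraj (M : MDP S A p.H) (π : Policy S A) : ∀ᵐ T ∂(startLaw M π), GoodTraj M T := by
  classical
  filter_upwards [ae_trajLaw M π (firstPair π M.start) p.H] with T hT
  refine ⟨fun i => hT.1 _, fun i => ?_⟩
  induction i with
  | zero =>
    intro _
    have := hT.2.1
    rw [firstPair_apply] at this
    rw [seqOf_of_le T (Nat.zero_le _), zero_add, M.stage_eq_one]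
    by_contra h
    exact this (if_neg h)
  | succ i ih =>
    intro hi
    have h := hT.2.2 ⟨i, by omega⟩
    have hi' := ih (by omega)
    rw [seqOf_of_le T (by omega)] at hi' ⊢
    rw [stepLaw_apply] at h
    have := M.stage_trans _ _ _ (by
      have : M.stage (T (Fin.castSucc ⟨i, by omega⟩)).1.1 = i + 1 := hi'
      omega) ((PMF.mem_support_iff _ _).2 (left_ne_zero_of_mul h))
    exact this.trans (by
      have : M.stage (T (Fin.castSucc ⟨i, by omega⟩)).1.1 = i + 1 := hi'
      omega)

end Target

/-! ### Stability of backward recursions and of stopped returns. -/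

section Comparison

variable {S A : Type*} [Fintype S] [Fintype A] [Nonempty A] {H : ℕ}

/-- The aggregations are nonexpansive up to $K$, so each remaining stage adds at most $a+K$ and
errors grow linearly in the number of stages. -/
theorem dp_abs_sub_le (M : MDP S A H) {f f' : S → A → ℝ} {N N' : S → (A → ℝ) → ℝ} {a K : ℝ}
    (ha : 0 ≤ a) (hK : 0 ≤ K) (hf : ∀ s b, M.stage s ≤ H → |f s b - f' s b| ≤ a)
    (hN : ∀ s c, (∀ b, |dp M f N s b - dp M f' N' s b| ≤ c) →
      |N s (dp M f N s) - N' s (dp M f' N' s)| ≤ K + c) :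
    ∀ s b, |dp M f N s b - dp M f' N' s b| ≤ ((H + 1 : ℝ) - M.stage s) * (a + K) := by
  refine stage_induction M (fun s hs b => ?_) (fun s hs ih b => ?_)
  · rw [dp_last M _ _ hs, dp_last M _ _ hs, sub_self, abs_zero]
    have h1 : (M.stage s : ℝ) ≤ H + 1 := by exact_mod_cast M.stage_le s
    exact mul_nonneg (by linarith) (by linarith)
  · rw [dp_eq M _ _ hs, dp_eq M _ _ hs]
    have h1 := trAvg_abs_sub_le (M := M) (s := s) b
      (y := fun s' => N s' (dp M f N s')) (y' := fun s' => N' s' (dp M f' N' s'))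
      (c := K + ((H + 1 : ℝ) - (M.stage s + 1)) * (a + K)) hs (fun s' hs' => by
        have h2 := ih s' hs'
        rw [hs'] at h2
        push_cast at h2
        exact hN s' _ h2)
    have h3 := hf s b hs
    have e : ∀ x y u v : ℝ, x + y - (u + v) = (x - u) + (y - v) := fun _ _ _ _ => by ring
    rw [e]
    refine (abs_add_le _ _).trans ((add_le_add h3 h1).trans (le_of_eq ?_))
    ring

theorem stopMix_abs_sub_le {w w' g g' x x' Δω Δg B c : ℝ} (hw' : w' ∈ Set.Icc (0 : ℝ) 1)
    (hω : |w - w'| ≤ Δω) (hg : |g - g'| ≤ Δg) (hB : |x - g| ≤ B) (hx : |x - x'| ≤ c) :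
    |(1 - w) * g + w * x - ((1 - w') * g' + w' * x')| ≤ (B * Δω + Δg) + c := by
  have e : (1 - w) * g + w * x - ((1 - w') * g' + w' * x')
      = (w - w') * (x - g) + ((1 - w') * (g - g') + w' * (x - x')) := by ring
  obtain ⟨h0, h1⟩ := hw'
  rw [e]
  have hΔg : 0 ≤ Δg := (abs_nonneg _).trans hg
  have hc : 0 ≤ c := (abs_nonneg _).trans hx
  have hB0 : 0 ≤ B := (abs_nonneg _).trans hB
  refine (abs_add_le _ _).trans ?_
  have t1 : |(w - w') * (x - g)| ≤ B * Δω := by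
    rw [abs_mul, mul_comm]; exact mul_le_mul hB hω (abs_nonneg _) hB0
  have t2 : |(1 - w') * (g - g')| ≤ Δg := by
    rw [abs_mul, abs_of_nonneg (by linarith : 0 ≤ 1 - w')]
    nlinarith [abs_nonneg (g - g')]
  have t3 : |w' * (x - x')| ≤ c := by
    rw [abs_mul, abs_of_nonneg h0]
    nlinarith [abs_nonneg (x - x')]
  have t4 := abs_add_le ((1 - w') * (g - g')) (w' * (x - x'))
  linarith

theorem stopReturn_abs_sub_le {ω ω' g g' : S → ℝ} {B Δω Δg : ℝ}
    (hω : ∀ s, ω s ∈ Set.Icc (0 : ℝ) 1) (hω' : ∀ s, ω' s ∈ Set.Icc (0 : ℝ) 1)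
    (hg : ∀ s, g s ∈ Set.Icc 0 B) (hB : 0 ≤ B)
    (hΔω : ∀ s, |ω s - ω' s| ≤ Δω) (hΔg : ∀ s, |g s - g' s| ≤ Δg) (k : ℕ)
    (x : ℕ → (S × A) × ℝ) (hx : ∀ i, (x i).2 ∈ Set.Icc (0 : ℝ) 1) :
    |stopReturn ω g k x - stopReturn ω' g' k x| ≤ k * ((k + B) * Δω + Δg) := by
  have main : ∀ j ≤ k, ∀ x : ℕ → (S × A) × ℝ, (∀ i, (x i).2 ∈ Set.Icc (0 : ℝ) 1) →
      |stopReturn ω g j x - stopReturn ω' g' j x| ≤ j * ((k + B) * Δω + Δg) := by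
    intro j
    induction j with
    | zero => intro _ x _; simp [stopReturn]
    | succ j ih =>
      intro hj x hx
      have h1 := ih (by omega) (fun i => x (i + 1)) fun i => hx _
      have h2 := stopReturn_mem hω hg hB j (fun i => x (i + 1)) fun i => hx _
      have hjk : (j : ℝ) ≤ k := by exact_mod_cast (by omega : j ≤ k)
      have h3 : |stopReturn ω g j (fun i => x (i + 1)) - g (x 1).1.1| ≤ k + B := by
        have h4 := hg (x 1).1.1
        have : (0 : ℝ) ≤ k := Nat.cast_nonneg k
        rw [abs_le]; constructor <;> linarith [h2.1, h2.2, h4.1, h4.2]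
      have h5 := stopMix_abs_sub_le (hω' (x 1).1.1) (hΔω (x 1).1.1) (hΔg (x 1).1.1) h3 h1
      rw [stopReturn, stopReturn, add_sub_add_left_eq_sub]
      refine h5.trans (le_of_eq ?_)
      push_cast; ring
  exact main k le_rfl x hx

theorem dp_stop_mem (M : MDP S A H) (π : Policy S A) {ω g : S → ℝ}
    (hω : ∀ s, ω s ∈ Set.Icc (0 : ℝ) 1) (hg : ∀ s, g s ∈ Set.Icc (0 : ℝ) H) [MeasurableSpace S]
    [MeasurableSpace A] [DiscreteMeasurableSpace S] [DiscreteMeasurableSpace A] (s : S) (a : A) :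
    dp M (meanReward M) (stopNode ω g π) s a ∈ Set.Icc (0 : ℝ) (2 * H) := by
  have h := dpK_stop_bounds M π (meanReward_mem M) hω hg (Nat.cast_nonneg H) (H + 1 - M.stage s) s a
  refine ⟨h.1, h.2.trans ?_⟩
  have := M.one_le_stage s
  have h2 : ((H + 1 - M.stage s : ℕ) : ℝ) ≤ H := by exact_mod_cast (by omega)
  linarith

theorem dp_stop_abs_sub_le (M : MDP S A H) (π : Policy S A) {ω ω' g g' : S → ℝ} {Δω Δg : ℝ}
    [MeasurableSpace S]
    [MeasurableSpace A] [DiscreteMeasurableSpace S] [DiscreteMeasurableSpace A]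
    (hω : ∀ s, ω s ∈ Set.Icc (0 : ℝ) 1) (hω' : ∀ s, ω' s ∈ Set.Icc (0 : ℝ) 1)
    (hg : ∀ s, g s ∈ Set.Icc (0 : ℝ) H)
    (hΔω : ∀ s, |ω s - ω' s| ≤ Δω) (hΔg : ∀ s, |g s - g' s| ≤ Δg) (s : S) (a : A) :
    |dp M (meanReward M) (stopNode ω g π) s a - dp M (meanReward M) (stopNode ω' g' π) s a|
      ≤ H * (2 * H * Δω + Δg) := by
  have h0 : 0 ≤ Δω := (abs_nonneg _).trans (hΔω s)
  have h1 : 0 ≤ Δg := (abs_nonneg _).trans (hΔg s)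
  have hK : 0 ≤ 2 * H * Δω + Δg := by positivity
  have h := dp_abs_sub_le M (f := meanReward M) (f' := meanReward M) (N := stopNode ω g π)
    (N' := stopNode ω' g' π) (a := 0) (K := 2 * H * Δω + Δg) le_rfl hK
    (fun s b _ => by simp) (fun s c hc => by
      refine stopMix_abs_sub_le (hω' s) (hΔω s) (hΔg s) ?_ (piAvg_abs_sub_le π s hc)
      have h2 : piAvg π s (dp M (meanReward M) (stopNode ω g π) s) ∈ Set.Icc (0 : ℝ) (2 * H) := by
        constructor
        · rw [← piAvg_const π s 0]
          exact piAvg_mono π s fun a => (dp_stop_mem M π hω hg s a).1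
        · rw [← piAvg_const π s (2 * H)]
          exact piAvg_mono π s fun a => (dp_stop_mem M π hω hg s a).2
      have h3 := hg s
      have hH : (0 : ℝ) ≤ H := Nat.cast_nonneg H
      rw [abs_le]; constructor <;> linarith [h2.1, h2.2, h3.1, h3.2]) s a
  refine h.trans ?_
  rw [zero_add]
  refine mul_le_mul_of_nonneg_right ?_ hK
  have : (1 : ℝ) ≤ M.stage s := by exact_mod_cast M.one_le_stage s
  linarith

end Comparison

/-! ### Uniform control of the least-squares noise over directions, guesses and parameters. -/

section NoiseProcess

variable {S A : Type*} [Fintype S] [Fintype A] [Nonempty A] {p : Params}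

/-- Index type of the parameters of the noise process: a direction, a guess, and the parameters of
the stages. -/
abbrev NoiseIdx (p : Params) : Type :=
  Fin p.d ⊕ (Fin (p.H + 1) × Fin p.d₀ × Fin p.d) ⊕ (Fin (p.H + 1) × Fin p.d)

/-- The direction encoded in a parameter. -/
def decV (w : NoiseIdx p → ℝ) : Vec p.d := WithLp.toLp 2 fun i => w (Sum.inl i)

/-- The guess encoded in a parameter. -/
def decG (w : NoiseIdx p → ℝ) (u : ℕ) (i : Fin p.d₀) : Vec p.d :=
  if hu : u < p.H + 1 then WithLp.toLp 2 fun j => w (Sum.inr (Sum.inl (⟨u, hu⟩, i, j))) else 0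

/-- The stage parameters encoded in a parameter. -/
def decθ (w : NoiseIdx p → ℝ) (u : ℕ) : Vec p.d :=
  if hu : u < p.H + 1 then WithLp.toLp 2 fun j => w (Sum.inr (Sum.inr (⟨u, hu⟩, j))) else 0

/-- The terminal values of the least-squares targets. -/
def vBarAt (M : MDP S A p.H) (φ : S → A → Vec p.d) (θ : ℕ → Vec p.d) (s : S) : ℝ :=
  vBar p φ (θ (M.stage s)) s

/-- Conditional mean of the least-squares target. -/
def targetMean (M : MDP S A p.H) (φ : S → A → Vec p.d) (π : Policy S A)
    (G : ℕ → Fin p.d₀ → Vec p.d) (θ : ℕ → Vec p.d) : S → A → ℝ :=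
  dp M (meanReward M) (stopNode (omega p M.stage φ G) (vBarAt M φ θ) π)

/-- Exponent of the noise process after `t` steps. -/
def noiseExp (M : MDP S A p.H) (φ : S → A → Vec p.d) (π : Policy S A) (t : ℕ) (v : Vec p.d)
    (G : ℕ → Fin p.d₀ → Vec p.d) (θ : ℕ → Vec p.d) (T : Traj S A p.H) : ℝ :=
  inner ℝ (φ (seqOf T t).1.1 (seqOf T t).1.2) v
      * (stopReturn (omega p M.stage φ G) (vBarAt M φ θ) (p.H - t) (fun i => seqOf T (i + t))
        - targetMean M φ π G θ (seqOf T t).1.1 (seqOf T t).1.2)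
    - (p.H : ℝ) ^ 2 * (inner ℝ (φ (seqOf T t).1.1 (seqOf T t).1.2) v) ^ 2 / 2

theorem prod_abs_sub_le {c c' x x' C Δc X Δx : ℝ} (hc' : |c'| ≤ C) (hΔc : |c - c'| ≤ Δc)
    (hx : |x| ≤ X) (hΔx : |x - x'| ≤ Δx) : |c * x - c' * x'| ≤ Δc * X + C * Δx := by
  have e : c * x - c' * x' = (c - c') * x + c' * (x - x') := by ring
  rw [e]
  refine (abs_add_le _ _).trans (add_le_add ?_ ?_)
  · rw [abs_mul]
    exact mul_le_mul hΔc hx (abs_nonneg _) ((abs_nonneg _).trans hΔc)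
  · rw [abs_mul]
    exact mul_le_mul hc' hΔx (abs_nonneg _) ((abs_nonneg _).trans hc')

variable [MeasurableSpace S] [MeasurableSpace A]
  [DiscreteMeasurableSpace S] [DiscreteMeasurableSpace A]

/-- The three summands of the constant come from moving the direction, from moving the target
together with its mean, and from the quadratic term. -/
theorem noiseExp_lipschitz (hp : p.Valid) (M : MDP S A p.H) {φ : S → A → Vec p.d} (π : Policy S A)
    (hφ : ∀ s a, ‖φ s a‖ ≤ p.L₁) {t : ℕ} {R ρ : ℝ} (hρ0 : 0 ≤ ρ) (hρ : ρ ≤ 1)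
    {w w' : NoiseIdx p → ℝ} (hw : ∀ i, |w i| ≤ R) (hww' : ∀ i, |w i - w' i| ≤ ρ)
    {T : Traj S A p.H} (hT : GoodTraj M T) :
    noiseExp M φ π t (decV w) (decG w) (decθ w) T
      ≤ noiseExp M φ π t (decV w') (decG w') (decθ w') T
        + ρ * (p.L₁ * p.d * (2 * p.H) + p.L₁ * p.d * (R + 1) * (2 * (p.H * (2 * p.H
          * (Real.sqrt (2 * p.d) / p.alpha * (2 * p.L₁ * p.d)) + p.L₁ * p.d)))
          + (p.H : ℝ) ^ 2 * (p.L₁ * p.d * (p.L₁ * p.d * (R + 1)))) := by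
  have hd := hp.2.1
  have hL₁ : 0 < p.L₁ := hp.2.2.2.2.2.2.2.1
  have hα := hp.alpha_pos
  have hH : (0 : ℝ) ≤ p.H := Nat.cast_nonneg _
  have hw'R : ∀ i, |w' i| ≤ R + 1 := fun i => by
    have h1 := abs_sub_abs_le_abs_sub (w' i) (w i)
    rw [abs_sub_comm] at h1
    linarith [hw i, hww' i]
  set z := (seqOf T t).1 with hz
  have hv : ‖decV w - decV w'‖ ≤ p.d * ρ := norm_le_of_coord hd fun i => hww' _
  have hv' : ‖decV w'‖ ≤ p.d * (R + 1) := norm_le_of_coord hd fun i => hw'R _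
  have hvv : ‖decV w‖ ≤ p.d * (R + 1) := norm_le_of_coord hd fun i => (hw _).trans (by linarith)
  have hG : ∀ u i, ‖decG w u i - decG w' u i‖ ≤ p.d * ρ := by
    intro u i
    unfold decG
    split_ifs with hu
    · exact norm_le_of_coord hd fun j => hww' _
    · rw [sub_self, norm_zero]; positivity
  have hθ : ∀ u, ‖decθ w u - decθ w' u‖ ≤ p.d * ρ := by
    intro u
    unfold decθ
    split_ifs with hu
    · exact norm_le_of_coord hd fun j => hww' _
    · rw [sub_self, norm_zero]; positivity
  have hcoef : ∀ v : Vec p.d, ∀ r, ‖v‖ ≤ p.d * r → |inner ℝ (φ z.1 z.2) v| ≤ p.L₁ * p.d * r := by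
    intro v r hr
    refine (abs_real_inner_le_norm _ _).trans ?_
    rw [mul_assoc]
    exact mul_le_mul (hφ _ _) hr (norm_nonneg _) hL₁.le
  set c := inner ℝ (φ z.1 z.2) (decV w) with hc
  set c' := inner ℝ (φ z.1 z.2) (decV w') with hc'
  have hcc : |c - c'| ≤ p.L₁ * p.d * ρ := by
    rw [hc, hc', ← inner_sub_right]; exact hcoef _ _ hv
  have hc'b : |c'| ≤ p.L₁ * p.d * (R + 1) := hcoef _ _ hv'
  have hcb : |c| ≤ p.L₁ * p.d * (R + 1) := hcoef _ _ hvv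
  set ω := omega p M.stage φ (decG w) with hω
  set ω' := omega p M.stage φ (decG w') with hω'
  set g := vBarAt M φ (decθ w) with hg
  set g' := vBarAt M φ (decθ w') with hg'
  set Δω := Real.sqrt (2 * p.d) / p.alpha * (2 * p.L₁ * (p.d * ρ)) with hΔω
  set Δg := p.L₁ * (p.d * ρ) with hΔg
  have h1 : ∀ s, |ω s - ω' s| ≤ Δω := fun s =>
    abs_omega_sub_le M.stage φ hp hφ (by positivity) fun i _ => hG _ i
  have h2 : ∀ s, |g s - g' s| ≤ Δg := fun s =>
    abs_vBar_sub_le p φ fun a => (abs_qBar_sub_le p φ hφ _ _ s a).trans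
      (mul_le_mul_of_nonneg_left (hθ _) hL₁.le)
  have hωm : ∀ s, ω s ∈ Set.Icc (0 : ℝ) 1 := omega_mem M.stage φ hp _
  have hωm' : ∀ s, ω' s ∈ Set.Icc (0 : ℝ) 1 := omega_mem M.stage φ hp _
  have hgm : ∀ s, g s ∈ Set.Icc (0 : ℝ) p.H := fun s => vBar_mem p φ _ s
  have hK0 : 0 ≤ 2 * p.H * Δω + Δg := by
    have : 0 ≤ Δω := by positivity
    positivity
  have htH : ((p.H - t : ℕ) : ℝ) ≤ p.H := by exact_mod_cast Nat.sub_le _ _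
  have hx : ∀ i, (seqOf T (i + t)).2 ∈ Set.Icc (0 : ℝ) 1 := fun i => hT.1 _
  have h3 := stopReturn_abs_sub_le hωm hωm' hgm hH h1 h2 (p.H - t) (fun i => seqOf T (i + t)) hx
  have h3' : |stopReturn ω g (p.H - t) (fun i => seqOf T (i + t))
      - stopReturn ω' g' (p.H - t) (fun i => seqOf T (i + t))| ≤ p.H * (2 * p.H * Δω + Δg) := by
    refine h3.trans (mul_le_mul htH ?_ ?_ hH)
    · have : 0 ≤ Δω := by positivity
      have : ((p.H - t : ℕ) : ℝ) + p.H ≤ 2 * p.H := by linarith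
      gcongr
    · have : 0 ≤ Δω := by positivity
      positivity
  have h4 : |dp M (meanReward M) (stopNode ω g π) z.1 z.2
      - dp M (meanReward M) (stopNode ω' g' π) z.1 z.2| ≤ p.H * (2 * p.H * Δω + Δg) :=
    dp_stop_abs_sub_le M π hωm hωm' hgm h1 h2 _ _
  have h5 := stopReturn_mem hωm hgm hH (p.H - t) (fun i => seqOf T (i + t)) hx
  have h6 := dp_stop_mem M π hωm hgm z.1 z.2
  set X := stopReturn ω g (p.H - t) (fun i => seqOf T (i + t)) with hX
  set X' := stopReturn ω' g' (p.H - t) (fun i => seqOf T (i + t)) with hX'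
  set Q := dp M (meanReward M) (stopNode ω g π) z.1 z.2 with hQ
  set Q' := dp M (meanReward M) (stopNode ω' g' π) z.1 z.2 with hQ'
  have h7 : |X - Q| ≤ 2 * p.H := by
    rw [abs_le]; constructor <;> linarith [h5.1, h5.2, h6.1, h6.2]
  have h8 : |(X - Q) - (X' - Q')| ≤ 2 * (p.H * (2 * p.H * Δω + Δg)) := by
    have e : (X - Q) - (X' - Q') = (X - X') - (Q - Q') := by ring
    rw [e]
    refine (abs_sub _ _).trans ?_
    linarith
  have h9 := prod_abs_sub_le hc'b hcc h7 h8
  have h10 : |c * c - c' * c'| ≤ p.L₁ * p.d * ρ * (p.L₁ * p.d * (R + 1))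
      + p.L₁ * p.d * (R + 1) * (p.L₁ * p.d * ρ) := prod_abs_sub_le hc'b hcc hcb hcc
  have h11 := (abs_le.1 h9).2
  have h12 := (abs_le.1 h10).1
  have h13 : c * (X - Q) - (p.H : ℝ) ^ 2 * c ^ 2 / 2 ≤ c' * (X' - Q') - (p.H : ℝ) ^ 2 * c' ^ 2 / 2
      + (p.L₁ * p.d * ρ * (2 * p.H)
        + p.L₁ * p.d * (R + 1) * (2 * (p.H * (2 * p.H * Δω + Δg)))
        + (p.H : ℝ) ^ 2 * (p.L₁ * p.d * ρ * (p.L₁ * p.d * (R + 1)))) := by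
    have hH2 : 0 ≤ (p.H : ℝ) ^ 2 / 2 := by positivity
    have := mul_le_mul_of_nonneg_left h12 hH2
    nlinarith
  have e : ρ * (p.L₁ * p.d * (2 * p.H) + p.L₁ * p.d * (R + 1) * (2 * (p.H * (2 * p.H
          * (Real.sqrt (2 * p.d) / p.alpha * (2 * p.L₁ * p.d)) + p.L₁ * p.d)))
          + (p.H : ℝ) ^ 2 * (p.L₁ * p.d * (p.L₁ * p.d * (R + 1))))
      = p.L₁ * p.d * ρ * (2 * p.H)
        + p.L₁ * p.d * (R + 1) * (2 * (p.H * (2 * p.H * Δω + Δg)))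
        + (p.H : ℝ) ^ 2 * (p.L₁ * p.d * ρ * (p.L₁ * p.d * (R + 1))) := by
    rw [hΔω, hΔg]; ring
  rw [e]
  exact h13

theorem measurable_seqOf_fst {k : ℕ} (t : ℕ) (f : S × A → ℝ) :
    Measurable fun T : Traj S A k => f (seqOf T t).1 :=
  (Measurable.of_discrete (f := f)).comp
    (measurable_fst.comp ((measurable_pi_apply t).comp measurable_seqOf))

theorem measurable_noiseExp (M : MDP S A p.H) (φ : S → A → Vec p.d) (π : Policy S A) (t : ℕ)
    (v : Vec p.d) (G : ℕ → Fin p.d₀ → Vec p.d) (θ : ℕ → Vec p.d) :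
    Measurable (noiseExp M φ π t v G θ) := by
  have h1 := measurable_seqOf_fst (S := S) (A := A) (k := p.H) t fun z => inner ℝ (φ z.1 z.2) v
  have h2 := measurable_seqOf_fst (S := S) (A := A) (k := p.H) t
    fun z => targetMean M φ π G θ z.1 z.2
  have h3 : Measurable fun T : Traj S A p.H =>
      stopReturn (omega p M.stage φ G) (vBarAt M φ θ) (p.H - t) (fun i => seqOf T (i + t)) :=
    (measurable_stopReturn _ _ _).comp
      (measurable_pi_lambda _ fun i => (measurable_pi_apply (i + t)).comp measurable_seqOf)
  exact (h1.mul (h3.sub h2)).sub (((h1.pow_const 2).const_mul _).div_const 2)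

/-- Given the pair after $t$ steps, the target is a bounded variable whose mean is `targetMean`. So
Hoeffding's lemma applies conditionally, through the Markov property, with the coefficient
$\langle\phi,v\rangle$. -/
theorem lintegral_noiseExp_le (hp : p.Valid) (M : MDP S A p.H) (φ : S → A → Vec p.d)
    (π : Policy S A) {t : ℕ} (ht : t ≤ p.H) (v : Vec p.d) (G : ℕ → Fin p.d₀ → Vec p.d)
    (θ : ℕ → Vec p.d) :
    ∫⁻ T, ENNReal.ofReal (Real.exp (noiseExp M φ π t v G θ T)) ∂(startLaw M π) ≤ 1 := by
  set ω := omega p M.stage φ G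
  set g := vBarAt M φ θ
  set m := p.H - t with hm
  have hωm : ∀ s, ω s ∈ Set.Icc (0 : ℝ) 1 := omega_mem M.stage φ hp _
  have hgm : ∀ s, g s ∈ Set.Icc (0 : ℝ) p.H := fun s => vBar_mem p φ _ s
  have hH : (0 : ℝ) ≤ p.H := Nat.cast_nonneg _
  have hmH : (m : ℝ) ≤ p.H := by exact_mod_cast Nat.sub_le _ _
  let Φ : (ℕ → (S × A) × ℝ) → ℝ≥0∞ := fun x => ENNReal.ofReal (Real.exp
    (inner ℝ (φ (x 0).1.1 (x 0).1.2) v * (stopReturn ω g m x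
        - targetMean M φ π G θ (x 0).1.1 (x 0).1.2)
      - (p.H : ℝ) ^ 2 * (inner ℝ (φ (x 0).1.1 (x 0).1.2) v) ^ 2 / 2))
  have hfirst : ∀ f : S × A → ℝ, Measurable fun x : ℕ → (S × A) × ℝ => f (x 0).1 := fun f =>
    (Measurable.of_discrete (f := f)).comp (measurable_fst.comp (measurable_pi_apply 0))
  have hΦ : Measurable Φ := by
    have h1 := hfirst fun z => inner ℝ (φ z.1 z.2) v
    have h2 := hfirst fun z => targetMean M φ π G θ z.1 z.2
    exact (Real.measurable_exp.comp ((h1.mul ((measurable_stopReturn ω g m).sub h2)).sub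
      (((h1.pow_const 2).const_mul _).div_const 2))).ennreal_ofReal
  have hshift := trajE_shift M π (firstPair π M.start) m t p.H (by omega) hΦ
  have hL : ∫⁻ T, ENNReal.ofReal (Real.exp (noiseExp M φ π t v G θ T)) ∂(startLaw M π)
      = trajE M π (firstPair π M.start) p.H (fun x => Φ fun i => x (i + t)) := by
    rw [trajE, startLaw]
    refine lintegral_congr fun T => ?_
    simp only [Φ, zero_add]
    rfl
  rw [hL, hshift, trajE_eq_sum]
  have hz : ∀ z : S × A, pairLaw M π (firstPair π M.start) t z * trajE M π (PMF.pure z) m Φ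
      ≤ pairLaw M π (firstPair π M.start) t z * 1 := by
    intro z
    by_cases h0 : pairLaw M π (firstPair π M.start) t z = 0
    · simp [h0]
    have hst := stage_of_pairLaw M π ht h0
    refine mul_le_mul_right ?_ _
    have hX : Measurable fun T : Traj S A m => stopReturn ω g m (seqOf T) :=
      (measurable_stopReturn ω g m).comp measurable_seqOf
    -- At most $H$ rewards and a terminal value of at most $H$: the range is $2H$, and
    -- $(2H)^2/8=H^2/2$ is the coefficient of the quadratic term.
    have hab : ∀ᵐ T ∂(trajLaw M π (PMF.pure z) m),
        stopReturn ω g m (seqOf T) ∈ Set.Icc (0 : ℝ) (2 * p.H) := by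
      filter_upwards [ae_pure M π z m] with T hT
      have := stopReturn_mem hωm hgm hH m (seqOf T) hT.2
      exact ⟨this.1, by linarith [this.2]⟩
    have hmain := lintegral_exp_le_of_mem_Icc (trajLaw M π (PMF.pure z) m) hX hab
      (inner ℝ (φ z.1 z.2) v)
    refine le_trans (le_of_eq ?_) hmain
    rw [trajE]
    refine lintegral_congr_ae ?_
    filter_upwards [ae_pure M π z m] with T hT
    simp only [Φ, hT.1]
    rw [integral_stopReturn M π hωm hgm hH]
    have e : targetMean M φ π G θ z.1 z.2
        = dpK M (meanReward M) (stopNode ω g π) m z.1 z.2 := by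
      rw [targetMean, dp, hst, show p.H + 1 - (t + 1) = m by omega]
    rw [e]
    congr 2
    ring
  refine (Finset.sum_le_sum fun z _ => hz z).trans (le_of_eq ?_)
  simp only [mul_one]
  rw [← tsum_fintype (L := .unconditional _), PMF.tsum_coe]

/-- The direction, the guess and the stage parameters are packed into one vector, to which
`uniform_chernoff` applies. The union over guesses and parameters is needed because those of the
learner depend on the data. -/
theorem noise_event (hp : p.Valid) (M : MDP S A p.H) {φ : S → A → Vec p.d} (π : Policy S A)
    (hφ : ∀ s a, ‖φ s a‖ ≤ p.L₁) {t n : ℕ} (ht : t ≤ p.H) {R ρ δ L : ℝ} (hR : 0 ≤ R) (hρ0 : 0 < ρ)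
    (hρ : ρ ≤ 1) (hδ : 0 < δ) {m : ℕ} (hm : 2 * R / ρ + 1 ≤ m)
    (hζ : n * (ρ * (p.L₁ * p.d * (2 * p.H) + p.L₁ * p.d * (R + 1) * (2 * (p.H * (2 * p.H
          * (Real.sqrt (2 * p.d) / p.alpha * (2 * p.L₁ * p.d)) + p.L₁ * p.d)))
          + (p.H : ℝ) ^ 2 * (p.L₁ * p.d * (p.L₁ * p.d * (R + 1))))) ≤ 1)
    (hL : Fintype.card (NoiseIdx p) * Real.log m + Real.log (1 / δ) + 1 ≤ L) :
    dataLaw M π n {D | (∀ j, GoodTraj M (D j)) ∧ ∃ v G θ, (∀ i, |v i| ≤ R) ∧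
      (∀ u ≤ p.H, ∀ i j, |G u i j| ≤ R) ∧ (∀ u ≤ p.H, ∀ j, |θ u j| ≤ R) ∧ θ (p.H + 1) = 0 ∧
      L < ∑ j, noiseExp M φ π t v G θ (D j)} ≤ ENNReal.ofReal δ := by
  have : IsProbabilityMeasure (startLaw M π) := by unfold startLaw; infer_instance
  have h := uniform_chernoff (startLaw M π) (n := n)
    (F := fun (w : NoiseIdx p → ℝ) T => noiseExp M φ π t (decV w) (decG w) (decθ w) T)
    (fun w => measurable_noiseExp M φ π t _ _ _)
    (fun w => lintegral_noiseExp_le hp M φ π ht _ _ _) (good := GoodTraj M) hR hρ0 hδ hm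
    (fun w w' hw hww' T hT => noiseExp_lipschitz hp M π hφ hρ0.le hρ hw hww' hT)
    (L := L) (by linarith)
  refine (measure_mono ?_).trans h
  rintro D ⟨hg, v, G, θ, hv, hG, hθ, hlast, hlt⟩
  refine ⟨hg, Sum.elim (fun i => v i) (Sum.elim (fun x => G x.1 x.2.1 x.2.2) fun x => θ x.1 x.2),
    ?_, ?_⟩
  · rintro (i | x | x)
    · exact hv i
    · exact hG _ (by omega) _ _
    · exact hθ _ (by omega) _
  · refine hlt.trans_le (le_of_eq (Finset.sum_congr rfl fun j _ => ?_))
    set w : NoiseIdx p → ℝ :=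
      Sum.elim (fun i => v i) (Sum.elim (fun x => G x.1 x.2.1 x.2.2) fun x => θ x.1 x.2) with hw
    have e1 : decV w = v := rfl
    have e2 : ∀ u ≤ p.H, decG w u = G u := by
      intro u hu
      funext i
      rw [decG, dif_pos (by omega)]
      rfl
    -- The encoding covers the stages $0,\dots,H$ and decodes to zero beyond them, which agrees with
    -- $\theta$ at the stage $H+1$.
    have e3 : ∀ u ≤ p.H + 1, decθ w u = θ u := by
      intro u hu
      rcases Nat.lt_or_ge u (p.H + 1) with h1 | h1
      · rw [decθ, dif_pos h1]; rfl
      · rw [decθ, dif_neg (by omega), show u = p.H + 1 by omega, hlast]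
    have e4 : omega p M.stage φ (decG w) = omega p M.stage φ G := by
      funext s
      by_cases hs : M.stage s = p.H + 1
      · rw [omega_last _ _ _ hs, omega_last _ _ _ hs]
      · have := M.stage_le s
        rw [omega_eq _ _ hp, omega_eq _ _ hp, rangeG, rangeG, e2 _ (by omega)]
    have e5 : vBarAt M φ (decθ w) = vBarAt M φ θ := by
      funext s
      rw [vBarAt, vBarAt, e3 _ (M.stage_le s)]
    rw [noiseExp, noiseExp, targetMean, targetMean, e4, e5, e1]

end NoiseProcess

/-! ### Uniform deviations of empirical averages of state-action functions. -/

section ClassEvents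

variable {S A : Type*} [Fintype S] [Fintype A] [Nonempty A] {p : Params}
  [MeasurableSpace S] [MeasurableSpace A] [DiscreteMeasurableSpace S] [DiscreteMeasurableSpace A]

/-- Empirical average of a function of the state-action pair after `t` steps. -/
def empE {H n : ℕ} (D : Fin n → Traj S A H) (t : ℕ) (f : S → A → ℝ) : ℝ :=
  (1 / (n : ℝ)) * ∑ j, f (seqOf (D j) t).1.1 (seqOf (D j) t).1.2

theorem integral_seqOf (M : MDP S A p.H) (π : Policy S A) {t : ℕ} (ht : t ≤ p.H)
    {f : S → A → ℝ} (hf : ∀ s a, 0 ≤ f s a) :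
    ∫ T, f (seqOf T t).1.1 (seqOf T t).1.2 ∂(startLaw M π) = occE M π t f := by
  rw [integral_eq_lintegral_of_nonneg_ae (ae_of_all _ fun T => hf _ _)
    (measurable_seqOf_fst t fun z => f z.1 z.2).aestronglyMeasurable]
  have h := lintegral_stepAt M π ht (fun z => ENNReal.ofReal (f z.1 z.2))
  rw [h, ENNReal.toReal_sum fun z _ =>
    ENNReal.mul_ne_top (PMF.apply_ne_top _ _) ENNReal.ofReal_ne_top]
  refine Finset.sum_congr rfl fun z _ => ?_
  rw [ENNReal.toReal_mul, ENNReal.toReal_ofReal (hf _ _)]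

/-- Uniform deviation bound for a parametric class of functions of the state-action pair. -/
theorem class_event (M : MDP S A p.H) (π : Policy S A) {ι : Type*} [Fintype ι] [DecidableEq ι]
    {f : (ι → ℝ) → S → A → ℝ} {t n : ℕ} (ht : t ≤ p.H) (hn : 0 < n) {B R ρ κ δ L : ℝ} (hB : 0 < B)
    (hR : 0 ≤ R) (hρ0 : 0 < ρ) (hδ : 0 < δ) (hL0 : 0 < L)
    (hf : ∀ w s a, f w s a ∈ Set.Icc 0 B)
    (hlip : ∀ w w' : ι → ℝ, (∀ i, |w i| ≤ R) → (∀ i, |w i - w' i| ≤ ρ) →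
      ∀ s a, |f w s a - f w' s a| ≤ κ)
    (hκ : 2 * Real.sqrt (n * L) * κ ≤ B) {m : ℕ} (hm : 2 * R / ρ + 1 ≤ m)
    (hL : Fintype.card ι * Real.log m + Real.log (1 / δ) + 1 ≤ L) :
    dataLaw M π n {D | (∀ j, GoodTraj M (D j)) ∧ ∃ w : ι → ℝ, (∀ i, |w i| ≤ R) ∧
      empE D t (f w) + 2 * B * Real.sqrt (L / n) < occE M π t (f w)} ≤ ENNReal.ofReal δ := by
  have : IsProbabilityMeasure (startLaw M π) := by unfold startLaw; infer_instance
  have hn' : (0 : ℝ) < n := by exact_mod_cast hn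
  -- With this scale a deviation of $2B\sqrt{L/n}$ contributes $2L$ to the exponent and the
  -- Hoeffding correction is $L/8$, so the exponent exceeds $L$.
  set σ := Real.sqrt (L / n) / B with hσ
  have hσ0 : 0 < σ := div_pos (Real.sqrt_pos.2 (by positivity)) hB
  have hX : ∀ w, Measurable fun T : Traj S A p.H => f w (seqOf T t).1.1 (seqOf T t).1.2 := fun w =>
    measurable_seqOf_fst t fun z => f w z.1 z.2
  have hocc : ∀ w w' : ι → ℝ, (∀ i, |w i| ≤ R) → (∀ i, |w i - w' i| ≤ ρ) →
      occE M π t (f w) ≤ occE M π t (f w') + κ := by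
    intro w w' hw hww'
    rw [← occE_const M π t κ, ← occE_add]
    exact occE_mono M π ht fun s a _ => by linarith [(abs_le.1 (hlip w w' hw hww' s a)).2]
  have h := uniform_chernoff (startLaw M π) (n := n)
    (F := fun (w : ι → ℝ) T => -σ * (f w (seqOf T t).1.1 (seqOf T t).1.2 - occE M π t (f w))
      - (B - 0) ^ 2 * (-σ) ^ 2 / 8) (fun w => (((hX w).sub_const _).const_mul _).sub_const _)
    (fun w => by
      have h1 := lintegral_exp_le_of_mem_Icc (startLaw M π) (hX w)
        (ae_of_all _ fun T => hf w _ _) (-σ)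
      rwa [integral_seqOf M π ht (fun s a => (hf w s a).1)] at h1)
    (good := GoodTraj M) hR hρ0 hδ hm (ζ := 2 * σ * κ)
    (fun w w' hw hww' T _ => by
      have h1 := (abs_le.1 (hlip w w' hw hww' (seqOf T t).1.1 (seqOf T t).1.2)).1
      have h2 := hocc w w' hw hww'
      nlinarith)
    (L := L) (by
      have e : (n : ℝ) * (2 * σ * κ) = 2 * Real.sqrt (n * L) * κ / B := by
        have e1 : Real.sqrt (n * L) = n * Real.sqrt (L / n) := by
          rw [show (n : ℝ) * L = n ^ 2 * (L / n) by field_simp, Real.sqrt_mul (by positivity),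
            Real.sqrt_sq hn'.le]
        rw [e1, hσ]; ring
      rw [e]
      have : 2 * Real.sqrt (n * L) * κ / B ≤ 1 := by rw [div_le_one hB]; exact hκ
      linarith)
  refine (measure_mono ?_).trans h
  rintro D ⟨hg, w, hw, hlt⟩
  refine ⟨hg, w, hw, ?_⟩
  have e : ∑ j, (-σ * (f w (seqOf (D j) t).1.1 (seqOf (D j) t).1.2 - occE M π t (f w))
      - (B - 0) ^ 2 * (-σ) ^ 2 / 8)
      = n * σ * (occE M π t (f w) - empE D t (f w)) - n * (B ^ 2 * σ ^ 2 / 8) := by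
    rw [Finset.sum_sub_distrib, ← Finset.mul_sum, Finset.sum_sub_distrib, empE]
    simp only [Finset.sum_const, Finset.card_univ, Fintype.card_fin, nsmul_eq_mul]
    field_simp
    ring
  rw [e]
  have hs2 : Real.sqrt (L / n) ^ 2 = L / n := Real.sq_sqrt (by positivity)
  have e2 : B ^ 2 * σ ^ 2 = L / n := by rw [hσ, div_pow, hs2]; field_simp
  have e3 : n * σ * (2 * B * Real.sqrt (L / n)) = 2 * L := by
    rw [hσ]; field_simp; rw [hs2]; field_simp
  have h4 : n * σ * (2 * B * Real.sqrt (L / n)) < n * σ * (occE M π t (f w) - empE D t (f w)) := by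
    have : 0 < (n : ℝ) * σ := by positivity
    refine mul_lt_mul_of_pos_left ?_ this
    linarith
  rw [e2]
  have e4 : (n : ℝ) * (L / n / 8) = L / 8 := by field_simp
  rw [e4]
  linarith

/-- The same for the deviation in the other direction. -/
theorem class_event' (M : MDP S A p.H) (π : Policy S A) {ι : Type*} [Fintype ι] [DecidableEq ι]
    {f : (ι → ℝ) → S → A → ℝ} {t n : ℕ} (ht : t ≤ p.H) (hn : 0 < n) {B R ρ κ δ L : ℝ} (hB : 0 < B)
    (hR : 0 ≤ R) (hρ0 : 0 < ρ) (hδ : 0 < δ) (hL0 : 0 < L)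
    (hf : ∀ w s a, f w s a ∈ Set.Icc 0 B)
    (hlip : ∀ w w' : ι → ℝ, (∀ i, |w i| ≤ R) → (∀ i, |w i - w' i| ≤ ρ) →
      ∀ s a, |f w s a - f w' s a| ≤ κ)
    (hκ : 2 * Real.sqrt (n * L) * κ ≤ B) {m : ℕ} (hm : 2 * R / ρ + 1 ≤ m)
    (hL : Fintype.card ι * Real.log m + Real.log (1 / δ) + 1 ≤ L) :
    dataLaw M π n {D | (∀ j, GoodTraj M (D j)) ∧ ∃ w : ι → ℝ, (∀ i, |w i| ≤ R) ∧
      occE M π t (f w) + 2 * B * Real.sqrt (L / n) < empE D t (f w)} ≤ ENNReal.ofReal δ := by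
  have hn' : (0 : ℝ) < n := by exact_mod_cast hn
  have h := class_event M π (f := fun w s a => B - f w s a) ht hn hB hR hρ0 hδ hL0
    (fun w s a => ⟨by linarith [(hf w s a).2], by linarith [(hf w s a).1]⟩)
    (fun w w' hw hww' s a => by
      rw [sub_sub_sub_cancel_left, abs_sub_comm]; exact hlip w w' hw hww' s a) hκ hm hL
  refine (measure_mono ?_).trans h
  rintro D ⟨hg, w, hw, hlt⟩
  refine ⟨hg, w, hw, ?_⟩
  have e1 : empE D t (fun s a => B - f w s a) = B - empE D t (f w) := by
    simp only [empE, Finset.sum_sub_distrib, Finset.sum_const, Finset.card_univ, Fintype.card_fin,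
      nsmul_eq_mul]
    field_simp
  rw [e1, occE_sub, occE_const]
  linarith

end ClassEvents

/-! ### Bonuses and the recursion for the widths of the confidence sets. -/

section Widths

variable {S A : Type*} [Fintype S] [Fintype A] [Nonempty A] {p : Params}

/-- Aggregation that maximizes over the actions with probability `1 - ω`. -/
def greedyNode (ω : S → ℝ) (π : Policy S A) (s : S) (x : A → ℝ) : ℝ :=
  (1 - ω s) * (⨆ a, x a) + ω s * piAvg π s x

theorem greedyNode_abs_sub_le {ω : S → ℝ} (hω : ∀ s, ω s ∈ Set.Icc (0 : ℝ) 1) (π : Policy S A)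
    (s : S) {x x' : A → ℝ} {c : ℝ} (h : ∀ a, |x a - x' a| ≤ c) :
    |greedyNode ω π s x - greedyNode ω π s x'| ≤ c := by
  have h1 := abs_iSup_sub_iSup_le h
  have h2 := piAvg_abs_sub_le π s h
  obtain ⟨h3, h4⟩ := hω s
  have e : greedyNode ω π s x - greedyNode ω π s x' = (1 - ω s) * ((⨆ a, x a) - ⨆ a, x' a)
      + ω s * (piAvg π s x - piAvg π s x') := by
    rw [greedyNode, greedyNode]; ring
  rw [e]
  refine (abs_add_le _ _).trans ?_
  rw [abs_mul, abs_mul, abs_of_nonneg h3, abs_of_nonneg (by linarith : 0 ≤ 1 - ω s)]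
  nlinarith

theorem greedyNode_mono {ω : S → ℝ} (hω : ∀ s, ω s ∈ Set.Icc (0 : ℝ) 1) (π : Policy S A)
    (s : S) {x x' : A → ℝ} (h : ∀ a, x a ≤ x' a) : greedyNode ω π s x ≤ greedyNode ω π s x' := by
  obtain ⟨h3, h4⟩ := hω s
  exact add_le_add
    (mul_le_mul_of_nonneg_left (ciSup_mono (Set.finite_range _).bddAbove h) (by linarith))
    (mul_le_mul_of_nonneg_left (piAvg_mono π s h) h3)

theorem greedyNode_const (ω : S → ℝ) (π : Policy S A) (s : S) (c : ℝ) :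
    greedyNode ω π s (fun _ => c) = c := by
  rw [greedyNode, ciSup_const, piAvg_const]; ring

/-- Bonus of a state-action pair, given by the inverse Gram matrices of the stages. -/
def bonus (φ : S → A → Vec p.d) (c η : ℝ) (Y : Matrix (Fin p.d) (Fin p.d) ℝ) (s : S) (a : A) : ℝ :=
  min (p.H : ℝ) (c * Real.sqrt ((φ s a).ofLp ⬝ᵥ Y.mulVec (φ s a).ofLp) + η)

theorem bonus_mem (φ : S → A → Vec p.d) {c η : ℝ} (hc : 0 ≤ c) (hη : 0 ≤ η)
    (Y : Matrix (Fin p.d) (Fin p.d) ℝ) (s : S) (a : A) :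
    bonus φ c η Y s a ∈ Set.Icc (0 : ℝ) p.H :=
  ⟨le_min (Nat.cast_nonneg _) (by positivity), min_le_left _ _⟩

/-- Bonuses are only $1/2$-Hölder in the inverse Gram matrix, so their covering error is of order
$\sqrt\rho$ instead of $\rho$; this is harmless, as only the logarithm of $\rho$ matters. -/
theorem abs_sqrt_sub_sqrt_le (x y : ℝ) : |Real.sqrt x - Real.sqrt y| ≤ Real.sqrt |x - y| := by
  have key : ∀ x y : ℝ, Real.sqrt x - Real.sqrt y ≤ Real.sqrt |x - y| := by
    intro x y
    rw [sub_le_iff_le_add]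
    rcases le_or_gt x 0 with hx | hx
    · rw [Real.sqrt_eq_zero'.2 hx]; positivity
    refine Real.sqrt_le_iff.2 ⟨by positivity, ?_⟩
    rcases le_or_gt y 0 with hy | hy
    · rw [Real.sqrt_eq_zero'.2 hy, add_zero, Real.sq_sqrt (abs_nonneg _)]
      exact (by linarith : x ≤ x - y).trans (le_abs_self _)
    · rw [add_sq, Real.sq_sqrt (abs_nonneg _), Real.sq_sqrt hy.le]
      have := le_abs_self (x - y)
      have h2 : 0 ≤ 2 * Real.sqrt |x - y| * Real.sqrt y := by positivity
      linarith
  rw [abs_le]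
  constructor
  · have := key y x
    rw [abs_sub_comm] at this
    linarith
  · exact key x y

theorem abs_quad_sub_le {L₁ ρ : ℝ} {d : ℕ} {x : Vec d} (hx : ‖x‖ ≤ L₁)
    {Y Y' : Matrix (Fin d) (Fin d) ℝ} (hY : ∀ i j, |Y i j - Y' i j| ≤ ρ) :
    |x.ofLp ⬝ᵥ Y.mulVec x.ofLp - x.ofLp ⬝ᵥ Y'.mulVec x.ofLp| ≤ (d * L₁) ^ 2 * ρ := by
  have hL : 0 ≤ L₁ := (norm_nonneg _).trans hx
  rw [← dotProduct_sub, ← Matrix.sub_mulVec]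
  simp only [dotProduct, Matrix.mulVec, Matrix.sub_apply, Finset.mul_sum]
  have hterm : ∀ i j, |x.ofLp i * ((Y i j - Y' i j) * x.ofLp j)| ≤ L₁ * (ρ * L₁) := by
    intro i j
    have h1 : ∀ i, |x.ofLp i| ≤ L₁ := fun i => (abs_coord_le_norm x i).trans hx
    have hρ := (abs_nonneg _).trans (hY i j)
    rw [abs_mul, abs_mul]
    exact mul_le_mul (h1 i) (mul_le_mul (hY i j) (h1 j) (abs_nonneg _) hρ) (by positivity) hL
  refine (Finset.abs_sum_le_sum_abs _ _).trans ?_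
  refine (Finset.sum_le_sum fun i _ => (Finset.abs_sum_le_sum_abs _ _).trans
    (Finset.sum_le_sum fun j _ => hterm i j)).trans (le_of_eq ?_)
  simp only [Finset.sum_const, Finset.card_univ, Fintype.card_fin, nsmul_eq_mul]
  ring

theorem bonus_abs_sub_le {φ : S → A → Vec p.d} {L₁ : ℝ} (hφ : ∀ s a, ‖φ s a‖ ≤ L₁) {c η ρ : ℝ}
    (hc : 0 ≤ c) {Y Y' : Matrix (Fin p.d) (Fin p.d) ℝ}
    (hY : ∀ i j, |Y i j - Y' i j| ≤ ρ) (s : S) (a : A) :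
    |bonus φ c η Y s a - bonus φ c η Y' s a| ≤ c * (p.d * L₁ * Real.sqrt ρ) := by
  have hL : 0 ≤ L₁ := (norm_nonneg _).trans (hφ s a)
  refine (abs_min_sub_min_le_max _ _ _ _).trans (max_le (by simp; positivity) ?_)
  rw [add_sub_add_right_eq_sub, ← mul_sub, abs_mul, abs_of_nonneg hc]
  refine mul_le_mul_of_nonneg_left ?_ hc
  refine (abs_sqrt_sub_sqrt_le _ _).trans ?_
  refine (Real.sqrt_le_sqrt (abs_quad_sub_le (hφ s a) hY)).trans (le_of_eq ?_)
  rw [Real.sqrt_mul (by positivity), Real.sqrt_sq (by positivity)]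

/-- Upper bound on the widths of the confidence sets, for the bonuses `b`. -/
def widthBound (M : MDP S A p.H) (ω : S → ℝ) (π : Policy S A) (b : S → A → ℝ) : S → A → ℝ :=
  dp M b (greedyNode ω π)

theorem widthBound_abs_sub_le (M : MDP S A p.H) {ω : S → ℝ}
    (hω : ∀ s, ω s ∈ Set.Icc (0 : ℝ) 1) (π : Policy S A) {b b' : S → A → ℝ} {κ : ℝ} (hκ : 0 ≤ κ)
    (hb : ∀ s a, |b s a - b' s a| ≤ κ) (s : S) (a : A) :
    |widthBound M ω π b s a - widthBound M ω π b' s a| ≤ p.H * κ := by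
  have h := dp_abs_sub_le M (f := b) (f' := b') (N := greedyNode ω π) (N' := greedyNode ω π)
    hκ le_rfl (fun s a _ => hb s a) (fun s c hc => by
      rw [zero_add]; exact greedyNode_abs_sub_le hω π s hc) s a
  refine h.trans ?_
  rw [add_zero]
  refine mul_le_mul_of_nonneg_right ?_ hκ
  have : (1 : ℝ) ≤ M.stage s := by exact_mod_cast M.one_le_stage s
  linarith

theorem widthBound_mem (M : MDP S A p.H) {ω : S → ℝ}
    (hω : ∀ s, ω s ∈ Set.Icc (0 : ℝ) 1) (π : Policy S A) {b : S → A → ℝ}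
    (hb : ∀ s a, b s a ∈ Set.Icc (0 : ℝ) p.H) (s : S) (a : A) :
    widthBound M ω π b s a ∈ Set.Icc (0 : ℝ) ((p.H : ℝ) * p.H) := by
  have h0 : ∀ s a, dp M (fun _ _ => (0 : ℝ)) (greedyNode ω π) s a = 0 := by
    have := dp_unique M (f := fun _ _ => (0 : ℝ)) (N := greedyNode ω π) (q := fun _ _ => 0)
      (fun _ _ _ => rfl) (fun s a _ => by simp [greedyNode_const, trAvg_const])
    intro s a
    rw [← this s]
  have h1 := widthBound_abs_sub_le M hω π (b := b) (b' := fun _ _ => 0) (κ := p.H)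
    (Nat.cast_nonneg _) (fun s a => by
      rw [sub_zero, abs_of_nonneg (hb s a).1]; exact (hb s a).2) s a
  rw [widthBound, widthBound, h0, sub_zero] at h1
  refine ⟨?_, (abs_le.1 h1).2⟩
  have key : ∀ s a, 0 ≤ dp M b (greedyNode ω π) s a := by
    refine stage_induction M (fun s hs a => by rw [dp_last M _ _ hs]) (fun s hs ih a => ?_)
    rw [dp_eq M _ _ hs]
    refine add_nonneg (hb s a).1 ?_
    rw [← trAvg_const M s a 0]
    refine trAvg_mono a hs fun s' hs' => ?_
    rw [← greedyNode_const ω π s' 0]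
    exact greedyNode_mono hω π s' (ih s' hs')
  exact key s a

end Widths

/-! ### Mixed policies, performance differences and linearization by action gaps. -/

section Policies

variable {S A : Type*} [Fintype S] [Fintype A] [Nonempty A] {H : ℕ}

theorem exists_mix (q r : PMF A) {t : ℝ} (ht : t ∈ Set.Icc (0 : ℝ) 1) :
    ∃ m : PMF A, ∀ x : A → ℝ, ∑ a, (m a).toReal * x a
      = (1 - t) * (∑ a, (q a).toReal * x a) + t * ∑ a, (r a).toReal * x a := by
  have h0 : ∀ a, 0 ≤ (1 - t) * (q a).toReal + t * (r a).toReal := fun a =>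
    add_nonneg (mul_nonneg (by linarith [ht.2]) ENNReal.toReal_nonneg)
      (mul_nonneg ht.1 ENNReal.toReal_nonneg)
  have h1 : ∑ a, ENNReal.ofReal ((1 - t) * (q a).toReal + t * (r a).toReal) = 1 := by
    rw [← ENNReal.ofReal_sum_of_nonneg fun a _ => h0 a, Finset.sum_add_distrib, ← Finset.mul_sum,
      ← Finset.mul_sum, pmf_sum_toReal, pmf_sum_toReal]
    simp
  refine ⟨PMF.ofFintype _ h1, fun x => ?_⟩
  simp only [PMF.ofFintype_apply, ENNReal.toReal_ofReal (h0 _), Finset.mul_sum]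
  rw [← Finset.sum_add_distrib]
  exact Finset.sum_congr rfl fun a _ => by ring

/-- Randomized memoryless policies can mix a maximizing action with $\pi$ state by state, so the
aggregation of the width recursion is attained by an actual policy. -/
theorem exists_policy_greedyNode {ω : S → ℝ} (hω : ∀ s, ω s ∈ Set.Icc (0 : ℝ) 1) (π : Policy S A)
    (Q : S → A → ℝ) : ∃ σ : Policy S A, ∀ s, piAvg σ s (Q s) = greedyNode ω π s (Q s) := by
  have h1 : ∀ s, ∃ a, Q s a = ⨆ a, Q s a := fun s => exists_eq_ciSup_of_finite
  choose g hg using h1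
  have h2 : ∀ s, ∃ m : PMF A, ∀ x : A → ℝ, ∑ a, (m a).toReal * x a
      = (1 - ω s) * (∑ a, (PMF.pure (g s) a).toReal * x a) + ω s * ∑ a, (π s a).toReal * x a :=
    fun s => exists_mix _ _ (hω s)
  choose σ hσ using h2
  refine ⟨σ, fun s => ?_⟩
  have h3 := piAvg_pure s g (Q s)
  rw [piAvg] at h3
  rw [piAvg, hσ, h3, hg]
  rfl

/-- Occupancies of the policy that switches from `π` to `σ` at the stage `t + 1`. -/
theorem occE_switch (M : MDP S A H) (π σ : Policy S A) {t : ℕ} (ht : t ≤ H) (f : S → A → ℝ) :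
    occE M π t (fun s _ => piAvg σ s (f s))
      = occE M (fun s => if M.stage s ≤ t then π s else σ s) t f := by
  cases t with
  | zero =>
    rw [occE_zero, occE_zero, piAvg_const, piAvg, piAvg, if_neg]
    have := M.one_le_stage M.start
    omega
  | succ t =>
    rw [occE_succ, occE_succ]
    rw [← occE_policy_congr M (π := π)
      (π' := fun s => if M.stage s ≤ t + 1 then π s else σ s) (by omega)
      (fun s hs => by simp only [if_pos hs])]
    refine occE_congr M π (by omega) fun s a hs => trAvg_congr a (by omega) fun s' hs' => ?_
    rw [piAvg_const, piAvg, piAvg, if_neg (by omega)]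

/-- Performance difference between a policy and a policy that is greedy with respect to an
approximation of its action values. -/
theorem performance_difference [MeasurableSpace S] [MeasurableSpace A]
    [DiscreteMeasurableSpace S] [DiscreteMeasurableSpace A] (M : MDP S A H) (σ : Policy S A)
    {qb : S → A → ℝ} {g : S → A} (hg : ∀ s a, qb s a ≤ qb s (g s)) {ξ : ℝ}
    (hξ : ∀ (π : Policy S A), ∀ t < H, occE M π t (fun s a => |qb s a - qPi M σ s a|) ≤ ξ) :
    vPi M σ M.start - vPi M (fun s => PMF.pure (g s)) M.start ≤ 2 * H * ξ := by
  set π' : Policy S A := fun s => PMF.pure (g s) with hπ'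
  set q := qPi M σ with hq
  set q' := qPi M π' with hq'
  set Δ : S → ℝ := fun s => piAvg σ s (q s) - piAvg π' s (q s) with hΔ
  -- The value gap at a stage is the loss of one action of $\pi'$, measured by $q^\sigma$, plus the
  -- gap at the next stage; $k$ is the number of remaining stages.
  have htel : ∀ k t, t + k = H → occE M π' t (fun s _ => piAvg σ s (q s) - piAvg π' s (q' s))
      ≤ 2 * k * ξ := by
    intro k
    induction k with
    | zero =>
      intro t ht
      have : occE M π' t (fun s _ => piAvg σ s (q s) - piAvg π' s (q' s))
          = occE M π' t (fun _ _ => 0) := by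
        refine occE_congr M π' (by omega) fun s a hs => ?_
        have h1 : q s = fun _ => 0 := funext fun a => qPi_last M σ (by omega) a
        have h2 : q' s = fun _ => 0 := funext fun a => qPi_last M π' (by omega) a
        rw [h1, h2, piAvg_const, piAvg_const, sub_zero]
      rw [this, occE_const]; simp
    | succ k ih =>
      intro t ht
      have h1 := ih (t + 1) (by omega)
      have h2 : occE M π' t (fun s _ => piAvg σ s (q s) - piAvg π' s (q' s))
          = occE M π' t (fun s _ => Δ s)
            + occE M π' (t + 1) (fun s _ => piAvg σ s (q s) - piAvg π' s (q' s)) := by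
        rw [occE_succ]
        have e1 : ∀ s, piAvg σ s (q s) - piAvg π' s (q' s)
            = Δ s + piAvg π' s (fun a => q s a - q' s a) := by
          intro s; rw [piAvg_sub, hΔ]; ring
        simp only [e1]
        rw [occE_add]
        congr 1
        rw [occE_switch M π' π' (by omega)]
        simp only [ite_self]
        refine occE_congr M π' (by omega) fun s a hs => ?_
        have h3 : M.stage s ≤ H := by omega
        have h4 := qPi_bellman M σ h3 a
        have h5 := qPi_bellman M π' h3 a
        simp only [piAvg_const]
        rw [hq, hq', h4, h5, add_sub_add_left_eq_sub, ← trAvg_sub]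
        congr 1
        funext s'
        rw [piAvg_sub, hΔ]
        ring
      -- The greedy choice limits the loss to the errors of `qb` at the actions of $\sigma$ and of
      -- $\pi'$. Both are averages along genuine policies, one of which switches from $\pi'$ to
      -- $\sigma$ at this stage, and so each is at most $\xi$.
      have h3 : occE M π' t (fun s _ => Δ s) ≤ 2 * ξ := by
        set F : S → A → ℝ := fun s a => |qb s a - q s a| with hF
        have hΔF : ∀ s, Δ s ≤ piAvg σ s (F s) + piAvg π' s (F s) := by
          intro s
          have e2 : piAvg σ s (q s) ≤ qb s (g s) + piAvg σ s (F s) := by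
            rw [← piAvg_const σ s (qb s (g s)), ← piAvg_add]
            refine piAvg_mono σ s fun a => ?_
            have := (abs_le.1 (le_refl |qb s a - q s a|)).1
            have := hg s a
            simp only [hF]; linarith
          have e3 : qb s (g s) ≤ piAvg π' s (q s) + piAvg π' s (F s) := by
            rw [hπ', piAvg_pure, piAvg_pure]
            have := (abs_le.1 (le_refl |qb s (g s) - q s (g s)|)).2
            simp only [hF]; linarith
          simp only [hΔ]; linarith
        have h4 : occE M π' t (fun s _ => Δ s)
            ≤ occE M π' t (fun s _ => piAvg σ s (F s) + piAvg π' s (F s)) :=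
          occE_mono M π' (by omega) fun s a _ => hΔF s
        rw [occE_add, occE_switch M π' σ (by omega), occE_switch M π' π' (by omega)] at h4
        have h5 := hξ (fun s => if M.stage s ≤ t then π' s else σ s) t (by omega)
        have h6 := hξ (fun s => if M.stage s ≤ t then π' s else π' s) t (by omega)
        linarith
      rw [h2]
      push_cast
      linarith
  have h := htel H 0 (by omega)
  rw [occE_zero, piAvg_const] at h
  rw [vPi_eq, vPi_eq]
  exact h

/-- Unrolling the recursion along a policy that attains the greedy aggregation gives a sum of
bonuses under that policy. Concentrability is then applied once per stage to the bonuses themselves,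
so $C$ is not compounded over the stages. -/
theorem widthBound_occE_le {p : Params} [MeasurableSpace S] [MeasurableSpace A]
    [DiscreteMeasurableSpace S] [DiscreteMeasurableSpace A] {M : MDP S A p.H}
    {π : Policy S A} {C : ℝ} (hC : 0 ≤ C) (hconc : Concentrable M π C) {ω : S → ℝ}
    (hω : ∀ s, ω s ∈ Set.Icc (0 : ℝ) 1) {b : S → A → ℝ} (hb : ∀ s a, 0 ≤ b s a) {t : ℕ}
    (ht : t < p.H) :
    occE M π t (widthBound M ω π b) ≤ C * ∑ u ∈ Finset.Ico t p.H, occE M π u b := by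
  set U := widthBound M ω π b with hU
  obtain ⟨σ, hσ⟩ := exists_policy_greedyNode hω π U
  -- Up to the stage $t+1$ this is $\pi$, which keeps the law of the pair after $t$ steps.
  set σ' : Policy S A := fun s => if M.stage s ≤ t + 1 then π s else σ s with hσ'
  have htel : ∀ k u, t ≤ u → u + k = p.H →
      occE M σ' u U ≤ ∑ v ∈ Finset.Ico u p.H, occE M σ' v b := by
    intro k
    induction k with
    | zero =>
      intro u _ hu
      have : occE M σ' u U = occE M σ' u (fun _ _ => 0) :=
        occE_congr M σ' (by omega) fun s a hs => dp_last M _ _ (by omega) a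
      rw [this, occE_const, show u = p.H by omega]; simp
    | succ k ih =>
      intro u htu hu
      have h1 := ih (u + 1) (by omega) (by omega)
      rw [Finset.sum_eq_sum_Ico_succ_bot (by omega)]
      have h2 : occE M σ' u U = occE M σ' u b + occE M σ' (u + 1) U := by
        rw [occE_succ, ← occE_add]
        refine occE_congr M σ' (by omega) fun s a hs => ?_
        rw [hU, widthBound, dp_eq M _ _ (by omega)]
        congr 1
        refine trAvg_congr a (by omega) fun s' hs' => ?_
        have : piAvg σ' s' (U s') = piAvg σ s' (U s') := by
          rw [piAvg, piAvg, hσ']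
          simp only
          rw [if_neg (by omega)]
        rw [← widthBound, ← hU, this, hσ]
      linarith
  have h1 := htel (p.H - t) t le_rfl (by omega)
  have h2 : occE M σ' t U = occE M π t U :=
    occE_policy_congr M ht.le (fun s hs => by simp [hσ', hs]) U
  rw [← h2, Finset.mul_sum]
  refine h1.trans (Finset.sum_le_sum fun v hv => ?_)
  rw [Finset.mem_Ico] at hv
  exact occE_le_of_concentrable hC hconc σ' hv.2 fun s a _ => hb s a

variable [MeasurableSpace S] [MeasurableSpace A] [DiscreteMeasurableSpace S]
  [DiscreteMeasurableSpace A]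

theorem qPi_congr (M : MDP S A H) {π π' : Policy S A} {t : ℕ}
    (h : ∀ s, t < M.stage s → π s = π' s) : ∀ s, t ≤ M.stage s → qPi M π s = qPi M π' s := by
  refine stage_induction M (fun s hs _ => ?_) (fun s hs ih hts => ?_)
  · funext a; rw [qPi_last M _ hs, qPi_last M _ hs]
  · funext a
    rw [qPi_bellman M _ hs, qPi_bellman M _ hs]
    congr 1
    refine trAvg_congr a hs fun s' hs' => ?_
    rw [ih s' hs' (by omega), piAvg, piAvg, h s' (by omega)]

/-- Aggregation that adds a function of the state. -/
def addNode (f : S → ℝ) (π : Policy S A) (s : S) (x : A → ℝ) : ℝ := f s + piAvg π s x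

/-- Expected sum of a function of the later states. -/
def futureSum (M : MDP S A H) (π : Policy S A) (f : S → ℝ) : S → A → ℝ :=
  dp M (fun _ _ => 0) (addNode f π)

theorem futureSum_eq (M : MDP S A H) (π : Policy S A) (f : S → ℝ) {s : S} (hs : M.stage s ≤ H)
    (a : A) : futureSum M π f s a = trAvg M s a fun s' => f s' + piAvg π s' (futureSum M π f s') := by
  rw [futureSum, dp_eq M _ _ hs, zero_add]; rfl

theorem futureSum_unique (M : MDP S A H) (π : Policy S A) {f : S → ℝ} {q : S → A → ℝ}
    (hlast : ∀ s a, H < M.stage s → q s a = 0)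
    (hstep : ∀ s a, M.stage s ≤ H → q s a = trAvg M s a fun s' => f s' + piAvg π s' (q s')) :
    ∀ s, q s = futureSum M π f s :=
  dp_unique M hlast fun s a hs => by rw [hstep s a hs, zero_add]; rfl

theorem futureSum_sum (M : MDP S A H) (π : Policy S A) {κ : Type*} (K : Finset κ)
    (f : κ → S → ℝ) {g : S → ℝ} (hg : ∀ s, 1 < M.stage s → g s = ∑ k ∈ K, f k s) (s : S) (a : A) :
    futureSum M π g s a = ∑ k ∈ K, futureSum M π (f k) s a := by
  have h := futureSum_unique M π (f := g) (q := fun s a => ∑ k ∈ K, futureSum M π (f k) s a)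
    (fun s a hs => Finset.sum_eq_zero fun k _ => dp_last M _ _ hs a)
    (fun s a hs => by
      have h1 : ∀ k ∈ K, futureSum M π (f k) s a
          = trAvg M s a fun s' => f k s' + piAvg π s' (futureSum M π (f k) s') :=
        fun k _ => futureSum_eq M π (f k) hs a
      rw [Finset.sum_congr rfl h1]
      have h2 : trAvg M s a (fun s' => g s' + piAvg π s' fun a => ∑ k ∈ K, futureSum M π (f k) s' a)
          = trAvg M s a (fun s' => ∑ k ∈ K, (f k s' + piAvg π s' (futureSum M π (f k) s'))) := by
        refine trAvg_congr a hs fun s' hs' => ?_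
        rw [hg s' (by have := M.one_le_stage s; omega), Finset.sum_add_distrib]
        congr 1
        simp only [piAvg, Finset.mul_sum]
        rw [Finset.sum_comm]
      rw [h2]
      simp only [trAvg, Finset.mul_sum]
      rw [Finset.sum_comm])
  rw [← h s]

theorem futureSum_eq_zero (M : MDP S A H) (π : Policy S A) {f : S → ℝ} {t : ℕ}
    (hf : ∀ s, M.stage s ≠ t → f s = 0) : ∀ s, t ≤ M.stage s → ∀ a, futureSum M π f s a = 0 := by
  refine stage_induction M (fun s hs _ a => dp_last M _ _ hs a) (fun s hs ih hts a => ?_)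
  rw [futureSum_eq M π f hs, ← trAvg_const M s a 0]
  refine trAvg_congr a hs fun s' hs' => ?_
  have h1 : futureSum M π f s' = fun _ => 0 := funext fun b => ih s' hs' (by omega) b
  rw [h1, piAvg_const, hf s' (by omega), add_zero]

/-- A function of the states of one stage that is dominated by action gaps of a policy is a
difference of action values. -/
theorem exists_difference (M : MDP S A H) (π π₁ : Policy S A) {t : ℕ} {f : S → ℝ} {κ : ℝ}
    (hf : ∀ s, M.stage s ≠ t → f s = 0) (a₁ a₂ : S → A)
    (hgap : ∀ s, f s ≠ 0 → |κ * f s| ≤ qPi M π₁ s (a₁ s) - qPi M π₁ s (a₂ s)) :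
    ∃ σ₁ σ₂ : Policy S A, ∀ s, M.stage s < t → ∀ a,
      qPi M σ₁ s a - qPi M σ₂ s a = κ * futureSum M π f s a := by
  set gap : S → ℝ := fun s => qPi M π₁ s (a₁ s) - qPi M π₁ s (a₂ s) with hgapdef
  -- The signed weight for which $c$ times the gap equals $\kappa f$. The domination by the gap
  -- gives $|c|\le1$, and where the gap vanishes so does $\kappa f$.
  set c : S → ℝ := fun s => if f s = 0 then 0 else κ * f s / gap s with hc
  have hc1 : ∀ s, |c s| ≤ 1 := by
    intro s
    simp only [hc]
    split_ifs with h0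
    · simp
    · have h1 := hgap s h0
      rw [abs_div]
      exact div_le_one_of_le₀ (h1.trans (le_abs_self _)) (abs_nonneg _)
  have hcgap : ∀ s, c s * gap s = κ * f s := by
    intro s
    simp only [hc]
    split_ifs with h0
    · simp [h0]
    · have h1 := hgap s h0
      by_cases hg : gap s = 0
      · have h2 : |κ * f s| ≤ 0 := by rw [← hg]; exact h1
        have h3 := abs_nonpos_iff.1 h2
        rw [h3]; simp
      · field_simp
  have hmix : ∀ w : S → ℝ, (∀ s, w s ∈ Set.Icc (0 : ℝ) 1) → ∃ μ : Policy S A, ∀ s x,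
      piAvg μ s x = (1 - w s) * x (a₂ s) + w s * x (a₁ s) := by
    intro w hw
    have h2 : ∀ s, ∃ m : PMF A, ∀ x : A → ℝ, ∑ a, (m a).toReal * x a
        = (1 - w s) * (∑ a, (PMF.pure (a₂ s) a).toReal * x a)
          + w s * ∑ a, (PMF.pure (a₁ s) a).toReal * x a := fun s => exists_mix _ _ (hw s)
    choose μ hμ using h2
    refine ⟨μ, fun s x => ?_⟩
    have h3 := piAvg_pure s a₁ x
    have h4 := piAvg_pure s a₂ x
    rw [piAvg] at h3 h4
    rw [piAvg, hμ, h3, h4]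
  obtain ⟨μ₁, hμ₁⟩ := hmix (fun s => max (c s) 0) fun s =>
    ⟨le_max_right _ _, max_le (abs_le.1 (hc1 s)).2 zero_le_one⟩
  obtain ⟨μ₂, hμ₂⟩ := hmix (fun s => max (-c s) 0) fun s =>
    ⟨le_max_right _ _, max_le (by linarith [(abs_le.1 (hc1 s)).1]) zero_le_one⟩
  -- Both policies follow $\pi$ before the stage $t$ and $\pi_1$ after it. At the stage $t$ they
  -- play $a_1$ with the probabilities $c^+$ and $c^-$, and $a_2$ otherwise, so their values differ
  -- there by $(c^+-c^-)$ times the gap.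
  set σ : Policy S A → Policy S A := fun μ s =>
    if M.stage s < t then π s else if M.stage s = t then μ s else π₁ s with hσ
  have hq : ∀ μ s, t ≤ M.stage s → qPi M (σ μ) s = qPi M π₁ s := fun μ =>
    qPi_congr M fun s hs => by simp only [hσ]; rw [if_neg (by omega), if_neg (by omega)]
  refine ⟨σ μ₁, σ μ₂, ?_⟩
  refine stage_induction M (fun s hs _ a => ?_) (fun s hs ih hst a => ?_)
  · rw [qPi_last M _ hs, qPi_last M _ hs, futureSum, dp_last M _ _ hs]; simp
  · rw [qPi_bellman M _ hs, qPi_bellman M _ hs, add_sub_add_left_eq_sub, ← trAvg_sub,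
      futureSum_eq M π f hs]
    have e : κ * trAvg M s a (fun s' => f s' + piAvg π s' (futureSum M π f s'))
        = trAvg M s a (fun s' => κ * (f s' + piAvg π s' (futureSum M π f s'))) := by
      simp only [trAvg, Finset.mul_sum]
      exact Finset.sum_congr rfl fun s' _ => by ring
    rw [e]
    refine trAvg_congr a hs fun s' hs' => ?_
    rcases Nat.lt_or_ge (M.stage s') t with h1 | h1
    · have e1 : ∀ μ x, piAvg (σ μ) s' x = piAvg π s' x := by
        intro μ x; rw [piAvg, piAvg]; simp only [hσ]; rw [if_pos h1]
      rw [e1, e1, ← piAvg_sub, hf s' (by omega), zero_add]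
      simp only [ih s' hs' h1, piAvg, Finset.mul_sum]
      exact Finset.sum_congr rfl fun b _ => by ring
    · have h2 : M.stage s' = t := by omega
      have e1 : ∀ μ x, piAvg (σ μ) s' x = piAvg μ s' x := by
        intro μ x; rw [piAvg, piAvg]; simp only [hσ]; rw [if_neg (by omega), if_pos h2]
      have e2 : futureSum M π f s' = fun _ => 0 :=
        funext fun b => futureSum_eq_zero M π hf s' h1 b
      rw [e1, e1, hq _ _ h1, hq _ _ h1, hμ₁, hμ₂, e2, piAvg_const, add_zero, ← hcgap s']
      have e3 : max (c s') 0 - max (-c s') 0 = c s' := by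
        rcases le_total 0 (c s') with h | h
        · rw [max_eq_left h, max_eq_right (by linarith)]; ring
        · rw [max_eq_right h, max_eq_left (by linarith)]; ring
      simp only [hgapdef]
      linear_combination (qPi M π₁ s' (a₁ s') - qPi M π₁ s' (a₂ s')) * e3

end Policies

/-! ### The good guess: cheap skipping and linear target means. -/

section Guesses

variable {S A : Type*} [Fintype S] [Fintype A] [Nonempty A] {p : Params}
  [MeasurableSpace S] [MeasurableSpace A] [DiscreteMeasurableSpace S] [DiscreteMeasurableSpace A]

/-- `θ` realizes the action values of `π` in the stage `t`. -/
def Realizes (M : MDP S A p.H) (φ : S → A → Vec p.d) (η : ℝ) (t : ℕ) (π : Policy S A)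
    (θ : Vec p.d) : Prop :=
  ‖θ‖ ≤ p.L₂ ∧ ∀ s a, M.stage s = t → |qPi M π s a - inner ℝ (φ s a) θ| ≤ η

/-- All components of the guess realize action values. -/
def GoodGuess (M : MDP S A p.H) (φ : S → A → Vec p.d) (η : ℝ) (G : ℕ → Fin p.d₀ → Vec p.d) : Prop :=
  ∀ t, 1 ≤ t → t ≤ p.H + 1 → ∀ i, ∃ π, Realizes M φ η t π (G t i)

/-- In each stage the parameters that realize some policy form a nonempty set, bounded by $L_2$, and
the guess is a design in it. It depends on the MDP but not on the data. -/
theorem exists_goodGuess (hp : p.Valid) {M : MDP S A p.H} {φ : S → A → Vec p.d} {η : ℝ}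
    (hreal : ApproxRealizable M φ η p.L₂) {τ : ℝ} (hτ : 0 < τ) :
    ∃ G : ℕ → Fin p.d₀ → Vec p.d, GoodGuess M φ η G ∧
      ∀ t, 1 ≤ t → t ≤ p.H + 1 → ∀ π θ, Realizes M φ η t π θ → ∀ y : Vec p.d, ∀ m : ℝ,
        (∀ i, |inner ℝ y (G t i)| ≤ m) → |inner ℝ y θ| ≤ Real.sqrt (2 * p.d) * m + τ * ‖y‖ := by
  have h1 : ∀ t, ∃ g : Fin p.d₀ → Vec p.d, 1 ≤ t → t ≤ p.H + 1 →
      (∀ i, ∃ π, Realizes M φ η t π (g i)) ∧ ∀ π θ, Realizes M φ η t π θ → ∀ y : Vec p.d, ∀ m : ℝ,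
        (∀ i, |inner ℝ y (g i)| ≤ m) → |inner ℝ y θ| ≤ Real.sqrt (2 * p.d) * m + τ * ‖y‖ := by
    intro t
    by_cases ht : 1 ≤ t ∧ t ≤ p.H + 1
    · obtain ⟨ϑ, hϑ, hd⟩ := exists_design hp.2.1 hp.d₀_pos
        (K := {θ | ∃ π, Realizes M φ η t π θ}) (by
          obtain ⟨θ, h1, h2⟩ := hreal (fun _ => PMF.pure (Classical.arbitrary A)) t ht.1 ht.2
          exact ⟨θ, _, h1, h2⟩) (by
          refine (Metric.isBounded_closedBall (x := (0 : Vec p.d)) (r := p.L₂)).subset ?_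
          rintro θ ⟨π, h1, -⟩
          simpa using h1) hτ
      exact ⟨ϑ, fun _ _ => ⟨hϑ, fun π θ h => hd θ ⟨π, h⟩⟩⟩
    · exact ⟨fun _ => 0, fun h1 h2 => absurd ⟨h1, h2⟩ ht⟩
  choose G hG using h1
  exact ⟨G, fun t h1 h2 => (hG t h1 h2).1, fun t h1 h2 => (hG t h1 h2).2⟩

theorem abs_inner_le_rangeG (M : MDP S A p.H) (φ : S → A → Vec p.d) (G : ℕ → Fin p.d₀ → Vec p.d)
    (s : S) (a a' : A) (i : Fin p.d₀) :
    |inner ℝ (φ s a - φ s a') (G (M.stage s) i)| ≤ rangeG p M.stage φ G s := by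
  rw [abs_le]
  constructor
  · have := le_rangeG M.stage φ G s i a' a
    rw [← neg_sub, inner_neg_left] at this
    linarith
  · exact le_rangeG M.stage φ G s i a a'

/-- The required policy is greedy with respect to its own action values. The circularity is resolved
by computing these values first, by backward recursion, and choosing the policy afterwards. -/
theorem exists_greedy_policy (M : MDP S A p.H) {ω : S → ℝ}
    (hω : ∀ s, ω s ∈ Set.Icc (0 : ℝ) 1) (π : Policy S A) :
    ∃ σ : Policy S A, qPi M σ = dp M (meanReward M) (greedyNode ω π) ∧
      ∀ s, piAvg σ s (qPi M σ s) = greedyNode ω π s (qPi M σ s) := by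
  obtain ⟨σ, hσ⟩ := exists_policy_greedyNode hω π (dp M (meanReward M) (greedyNode ω π))
  have h : dp M (meanReward M) (greedyNode ω π) = qPi M σ :=
    qPi_unique M σ (fun s a hs => dp_last M _ _ hs a) (fun s a hs => by
      rw [dp_eq M _ _ hs]; simp only [hσ])
  refine ⟨σ, h.symm, fun s => ?_⟩
  rw [← h]; exact hσ s

/-- For a near-optimal guess, skipping costs at most `3 α` per stage. -/
theorem vStar_le_of_design (hp : p.Valid) {M : MDP S A p.H} {φ : S → A → Vec p.d} {η : ℝ}
    (hφ : ∀ s a, ‖φ s a‖ ≤ p.L₁) (hη : η ≤ p.alpha / 4)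
    (hreal : ApproxRealizable M φ η p.L₂) {G : ℕ → Fin p.d₀ → Vec p.d}
    (hG : ∀ t, 1 ≤ t → t ≤ p.H + 1 → ∀ π θ, Realizes M φ η t π θ → ∀ y : Vec p.d, ∀ m : ℝ,
        (∀ i, |inner ℝ y (G t i)| ≤ m) →
          |inner ℝ y θ| ≤ Real.sqrt (2 * p.d) * m + p.alpha / (4 * p.L₁) * ‖y‖)
    (π σ : Policy S A)
    (hσ : ∀ s, piAvg σ s (qPi M σ s) = greedyNode (omega p M.stage φ G) π s (qPi M σ s)) :
    vStar M M.start ≤ vPi M σ M.start + 3 * p.alpha * p.H := by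
  have hα := hp.alpha_pos
  have hL₁ : 0 < p.L₁ := hp.2.2.2.2.2.2.2.1
  have hωm := omega_mem M.stage φ hp G
  have hnode : ∀ s, (⨆ a, qPi M σ s a) ≤ piAvg σ s (qPi M σ s) + 3 * p.alpha := by
    intro s
    rw [hσ, greedyNode]
    by_cases h0 : omega p M.stage φ G s = 0
    · rw [h0]; linarith
    · have hr := rangeG_le_of_omega_ne_zero M.stage φ hp G h0
      obtain ⟨θ, hθ1, hθ2⟩ := hreal σ (M.stage s) (M.one_le_stage s) (M.stage_le s)
      -- Where skipping is possible the range is at most $2\alpha/\sqrt{2d}$. The gap is then at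
      -- most $2\alpha$ by the design inequality, plus $\alpha/2$ for the error of the design and
      -- $2\eta\le\alpha/2$ for the misspecification.
      have hspan : ∀ a a', qPi M σ s a - 3 * p.alpha ≤ qPi M σ s a' := by
        intro a a'
        have h1 := hG (M.stage s) (M.one_le_stage s) (M.stage_le s) σ θ ⟨hθ1, hθ2⟩
          (φ s a - φ s a') _ (abs_inner_le_rangeG M φ G s a a')
        have h2 : ‖φ s a - φ s a'‖ ≤ 2 * p.L₁ := by
          refine (norm_sub_le _ _).trans ?_
          linarith [hφ s a, hφ s a']
        have h3 : p.alpha / (4 * p.L₁) * ‖φ s a - φ s a'‖ ≤ p.alpha / 2 := by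
          refine (mul_le_mul_of_nonneg_left h2 (by positivity)).trans (le_of_eq ?_)
          field_simp; norm_num
        have h4 := (abs_le.1 h1).2
        rw [inner_sub_left] at h4
        have h5 := (abs_le.1 (hθ2 s a rfl)).2
        have h6 := (abs_le.1 (hθ2 s a' rfl)).1
        linarith
      have hmax : (⨆ a, qPi M σ s a) ≤ piAvg π s (qPi M σ s) + 3 * p.alpha := by
        refine ciSup_le fun a => ?_
        have : qPi M σ s a - 3 * p.alpha ≤ piAvg π s (qPi M σ s) := by
          rw [← piAvg_const π s (qPi M σ s a - 3 * p.alpha)]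
          exact piAvg_mono π s fun a' => hspan a a'
        linarith
      obtain ⟨w0, w1⟩ := hωm s
      nlinarith
  have hle : ∀ π' : Policy S A, ∀ s a,
      qPi M π' s a ≤ qPi M σ s a + ((p.H + 1 : ℝ) - M.stage s) * (3 * p.alpha) := by
    intro π'
    refine stage_induction M (fun s hs a => ?_) (fun s hs ih a => ?_)
    · rw [qPi_last M _ hs, qPi_last M _ hs]
      have h1 : (M.stage s : ℝ) ≤ p.H + 1 := by exact_mod_cast M.stage_le s
      have : 0 ≤ ((p.H + 1 : ℝ) - M.stage s) * (3 * p.alpha) :=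
        mul_nonneg (by linarith) (by linarith)
      linarith
    · rw [qPi_bellman M _ hs, qPi_bellman M _ hs, add_assoc]
      gcongr
      rw [← trAvg_const M s a (((p.H + 1 : ℝ) - M.stage s) * (3 * p.alpha)), ← trAvg_add]
      refine trAvg_mono a hs fun s' hs' => ?_
      have h1 : piAvg π' s' (qPi M π' s')
          ≤ (⨆ a, qPi M σ s' a) + ((p.H + 1 : ℝ) - M.stage s') * (3 * p.alpha) := by
        rw [← piAvg_const π' s' (_ + _)]
        refine piAvg_mono π' s' fun a' => ?_
        have := le_ciSup (f := fun a => qPi M σ s' a) (Set.finite_range _).bddAbove a'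
        linarith [ih s' hs' a']
      have h2 := hnode s'
      rw [hs'] at h1
      push_cast at h1
      linarith
  have hstart : M.stage M.start = 1 := (M.stage_eq_one _).2 rfl
  have hv : vPi M σ M.start = ⨆ a, qPi M σ M.start a := by
    rw [vPi_eq, hσ, greedyNode, omega_first M.stage φ G hstart]; ring
  rw [hv, vStar]
  refine ciSup_le fun a => ?_
  rw [qStar]
  have : Nonempty (Policy S A) := ⟨σ⟩
  refine ciSup_le fun π' => ?_
  have h1 := hle π' M.start a
  rw [hstart] at h1
  have h2 := le_ciSup (f := fun a => qPi M σ M.start a) (Set.finite_range _).bddAbove a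
  push_cast at h1
  linarith

/-- The action values of the policy that is greedy outside the skipped states are approximately
the conditional means of the targets for the parameters that realize them. -/
theorem targetMean_sub_qPi_le (hp : p.Valid) {M : MDP S A p.H} {φ : S → A → Vec p.d} {η : ℝ}
    (hη : 0 ≤ η) {G : ℕ → Fin p.d₀ → Vec p.d} (π σ : Policy S A)
    (hσ : qPi M σ = dp M (meanReward M) (greedyNode (omega p M.stage φ G) π))
    {θ : ℕ → Vec p.d} (hlast : θ (p.H + 1) = 0)
    (hθ : ∀ t, 1 ≤ t → t ≤ p.H → Realizes M φ η t σ (θ t)) (s : S) (a : A) :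
    |targetMean M φ π G θ s a - qPi M σ s a| ≤ p.H * η := by
  set ω := omega p M.stage φ G with hω
  have hωm : ∀ s, ω s ∈ Set.Icc (0 : ℝ) 1 := omega_mem M.stage φ hp G
  have hv : ∀ s, |vBarAt M φ θ s - ⨆ a, qPi M σ s a| ≤ η := by
    intro s
    rcases Nat.lt_or_ge p.H (M.stage s) with h | h
    · have h1 : M.stage s = p.H + 1 := by have := M.stage_le s; omega
      have h2 : ∀ a, qPi M σ s a = 0 := fun a => qPi_last M σ h a
      simp only [h2, vBarAt, vBar, h1, hlast, inner_zero_right, ciSup_const, sub_zero]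
      rw [clip_of_mem ⟨le_rfl, Nat.cast_nonneg _⟩, abs_zero]
      exact hη
    · have h3 : (⨆ a, qPi M σ s a) ∈ Set.Icc (0 : ℝ) p.H := by
        refine ⟨?_, ciSup_le fun a => (qPi_mem M σ s a).2⟩
        exact (qPi_mem M σ s (Classical.arbitrary A)).1.trans
          (le_ciSup (f := fun a => qPi M σ s a) (Set.finite_range _).bddAbove _)
      refine (abs_clip_sub_of_mem h3).trans (abs_iSup_sub_iSup_le fun a => ?_)
      rw [abs_sub_comm]
      exact (hθ _ (M.one_le_stage s) h).2 s a rfl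
  rw [targetMean, hσ]
  have h := dp_abs_sub_le M (f := meanReward M) (f' := meanReward M)
    (N := stopNode ω (vBarAt M φ θ) π) (N' := greedyNode ω π) (a := 0) (K := η) le_rfl hη
    (fun s b _ => by simp) (fun s c hc => by
      have h1 := piAvg_abs_sub_le π s hc
      have h2 := hv s
      rw [hσ] at h2
      obtain ⟨w0, w1⟩ := hωm s
      have e : stopNode ω (vBarAt M φ θ) π s (dp M (meanReward M) (stopNode ω (vBarAt M φ θ) π) s)
          - greedyNode ω π s (dp M (meanReward M) (greedyNode ω π) s)
          = (1 - ω s) * (vBarAt M φ θ s - ⨆ a, dp M (meanReward M) (greedyNode ω π) s a)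
            + ω s * (piAvg π s (dp M (meanReward M) (stopNode ω (vBarAt M φ θ) π) s)
              - piAvg π s (dp M (meanReward M) (greedyNode ω π) s)) := by
        rw [stopNode, greedyNode]; ring
      rw [e]
      refine (abs_add_le _ _).trans ?_
      rw [abs_mul, abs_mul, abs_of_nonneg w0, abs_of_nonneg (by linarith : 0 ≤ 1 - ω s)]
      have hc0 : 0 ≤ c := (abs_nonneg _).trans h1
      nlinarith) s a
  refine h.trans ?_
  rw [zero_add]
  refine mul_le_mul_of_nonneg_right ?_ hη
  have : (1 : ℝ) ≤ M.stage s := by exact_mod_cast M.one_le_stage s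
  linarith

/-- For a good guess, the conditional means of all targets are approximately linear. -/
theorem targetMean_linear (hp : p.Valid) {M : MDP S A p.H} {φ : S → A → Vec p.d} {η : ℝ}
    (hη : 0 ≤ η) (hη2 : 2 * η ≤ p.alpha / (2 * Real.sqrt (2 * p.d)))
    (hreal : ApproxRealizable M φ η p.L₂) (π : Policy S A) {G : ℕ → Fin p.d₀ → Vec p.d}
    (hG : GoodGuess M φ η G) {θ : ℕ → Vec p.d} (hlast : θ (p.H + 1) = 0) {h : ℕ} (h1 : 1 ≤ h)
    (hH : h ≤ p.H) :
    ∃ ϑ : Vec p.d, ‖ϑ‖ ≤ Real.sqrt (2 * p.d) * p.L₂' ∧ ∀ s a, M.stage s = h →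
      |targetMean M φ π G θ s a - inner ℝ (φ s a) ϑ|
        ≤ Real.sqrt (2 * p.d) * (8 * (p.H : ℝ) ^ 2 * p.d₀ / p.alpha + 1) * η := by
  have hα := hp.alpha_pos
  have hc := hp.sqrt_pos
  have hL₂ : 0 < p.L₂ := hp.2.2.2.2.2.2.2.2
  have hHpos : (1 : ℝ) ≤ p.H := by exact_mod_cast hp.1
  set ω := omega p M.stage φ G with hω
  have hωm : ∀ s, ω s ∈ Set.Icc (0 : ℝ) 1 := omega_mem M.stage φ hp G
  set g := vBarAt M φ θ with hg
  have hgm : ∀ s, g s ∈ Set.Icc (0 : ℝ) p.H := fun s => vBar_mem p φ _ s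
  set Q := targetMean M φ π G θ with hQ
  have hQm : ∀ s a, Q s a ∈ Set.Icc (0 : ℝ) (2 * p.H) := dp_stop_mem M π hωm hgm
  -- Stopping with the value $g$ instead of continuing with $\pi$ changes the value of a node by
  -- exactly $f$. Hence the target mean is $q^\pi$ plus the expected sum of $f$ over the later
  -- states.
  set f : S → ℝ := fun s => (1 - ω s) * (g s - piAvg π s (Q s)) with hf
  have hdecomp : ∀ s a, Q s a = qPi M π s a + futureSum M π f s a := by
    have h2 := futureSum_unique M π (f := f) (q := fun s a => Q s a - qPi M π s a)
      (fun s a hs => by rw [hQ, targetMean, dp_last M _ _ hs, qPi_last M _ hs, sub_zero])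
      (fun s a hs => by
        rw [hQ, targetMean, dp_eq M _ _ hs, qPi_bellman M _ hs, add_sub_add_left_eq_sub, ← trAvg_sub]
        congr 1
        funext s'
        rw [piAvg_sub]
        simp only [hf, stopNode, ← hω, ← hg]
        simp only [hQ, targetMean, ← hω, ← hg]
        ring)
    intro s a
    rw [← h2 s]; ring
  have hfb : ∀ s, |f s| ≤ 2 * p.H := by
    intro s
    have hQa : piAvg π s (Q s) ∈ Set.Icc (0 : ℝ) (2 * p.H) := by
      constructor
      · rw [← piAvg_const π s 0]; exact piAvg_mono π s fun a => (hQm s a).1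
      · rw [← piAvg_const π s (2 * p.H)]; exact piAvg_mono π s fun a => (hQm s a).2
    obtain ⟨w0, w1⟩ := hωm s
    obtain ⟨g0, g1⟩ := hgm s
    simp only [hf]
    rw [abs_mul, abs_of_nonneg (by linarith : 0 ≤ 1 - ω s)]
    have h3 : |g s - piAvg π s (Q s)| ≤ 2 * p.H := by
      rw [abs_le]; constructor <;> linarith [hQa.1, hQa.2]
    nlinarith [abs_nonneg (g s - piAvg π s (Q s))]
  have hflast : ∀ s, M.stage s = p.H + 1 → f s = 0 := by
    intro s hs
    have e1 : Q s = fun _ => 0 := funext fun a => by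
      rw [hQ, targetMean, dp_last M _ _ (by omega)]
    have e2 : g s = 0 := by
      simp only [hg, vBarAt, vBar, hs, hlast, inner_zero_right, ciSup_const]
      exact clip_of_mem ⟨le_rfl, Nat.cast_nonneg _⟩
    simp only [hf]
    rw [e1, e2, piAvg_const]; ring
  have hfω : ∀ s, f s ≠ 0 → ω s ≠ 1 := by
    intro s hs h2
    exact hs (by simp only [hf]; rw [h2]; ring)
  have hargs : ∀ s, ∃ i a a', rangeG p M.stage φ G s
      = inner ℝ (φ s a - φ s a') (G (M.stage s) i) := fun s => exists_rangeG_eq M.stage φ hp G s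
  choose I a₁ a₂ hI using hargs
  -- Since $|f|\le 2H$, this choice gives $|\kappa f|\le\alpha/(2\sqrt{2d})$, half of the range
  -- threshold; the other half absorbs the misspecification $2\eta$ of the gap.
  set κ := p.alpha / (4 * Real.sqrt (2 * p.d) * p.H) with hκ
  have hκ0 : 0 < κ := by positivity
  -- The gap comes from the policy of the component that attains the range, which varies with the
  -- state. So $f$ is split by stage and by this component into at most $Hd_0$ pieces, to each of
  -- which `exists_difference` applies with a single policy.
  set F : ℕ × Fin p.d₀ → S → ℝ := fun k s => if M.stage s = k.1 ∧ I s = k.2 then f s else 0 with hF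
  set K := Finset.Icc 2 p.H ×ˢ (Finset.univ : Finset (Fin p.d₀)) with hK
  have hpiece : ∀ k : ℕ × Fin p.d₀, ∃ ϑ : Vec p.d, k ∈ K → ‖ϑ‖ ≤ 2 * p.L₂ / κ ∧
      ∀ s a, M.stage s = h → |futureSum M π (F k) s a - inner ℝ (φ s a) ϑ| ≤ 2 * η / κ := by
    rintro ⟨t, i⟩
    by_cases hk : (t, i) ∈ K
    swap
    · exact ⟨0, fun h => absurd h hk⟩
    simp only [hK, Finset.mem_product, Finset.mem_Icc, Finset.mem_univ, and_true] at hk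
    have hF0 : ∀ s, M.stage s ≠ t → F (t, i) s = 0 := fun s hs => by
      simp only [hF]; rw [if_neg (fun h => hs h.1)]
    rcases Nat.lt_or_ge h t with hht | hht
    · obtain ⟨π₁, -, hπ₁⟩ := hG t (by omega) (by omega) i
      obtain ⟨σ₁, σ₂, hσ⟩ := exists_difference M π π₁ (κ := κ) hF0 a₁ a₂ (fun s hs => by
        have hcase : M.stage s = t ∧ I s = i := by
          by_contra hcon
          exact hs (by simp only [hF]; rw [if_neg hcon])
        have hFs : F (t, i) s = f s := by simp only [hF]; rw [if_pos hcase]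
        rw [hFs] at hs ⊢
        have h3 := lt_rangeG_of_omega_ne_one M.stage φ G (by omega) (by omega) (hfω s hs)
        rw [hI s, hcase.1, hcase.2, inner_sub_left] at h3
        have h4 := (abs_le.1 (hπ₁ s (a₁ s) hcase.1)).1
        have h5 := (abs_le.1 (hπ₁ s (a₂ s) hcase.1)).2
        have h6 : |κ * f s| ≤ p.alpha / (2 * Real.sqrt (2 * p.d)) := by
          rw [abs_mul, abs_of_pos hκ0]
          refine (mul_le_mul_of_nonneg_left (hfb s) hκ0.le).trans (le_of_eq ?_)
          rw [hκ]; field_simp; norm_num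
        have h7 : p.alpha / Real.sqrt (2 * p.d) = 2 * (p.alpha / (2 * Real.sqrt (2 * p.d))) := by
          field_simp
        linarith)
      obtain ⟨θ₁, hn₁, hr₁⟩ := hreal σ₁ h h1 (by omega)
      obtain ⟨θ₂, hn₂, hr₂⟩ := hreal σ₂ h h1 (by omega)
      refine ⟨(1 / κ) • (θ₁ - θ₂), fun _ => ⟨?_, fun s a hs => ?_⟩⟩
      · rw [norm_smul, Real.norm_eq_abs, abs_of_pos (by positivity), one_div, inv_mul_eq_div]
        gcongr
        exact (norm_sub_le _ _).trans (by linarith)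
      · have h3 := hσ s (by omega) a
        rw [inner_smul_right, inner_sub_right]
        have e : futureSum M π (F (t, i)) s a = (1 / κ) * (qPi M σ₁ s a - qPi M σ₂ s a) := by
          rw [h3]; field_simp
        rw [e, ← mul_sub, abs_mul, abs_of_pos (by positivity), one_div, inv_mul_eq_div]
        gcongr
        have h4 := abs_le.1 (hr₁ s a hs)
        have h5 := abs_le.1 (hr₂ s a hs)
        rw [abs_le]; constructor <;> linarith [h4.1, h4.2, h5.1, h5.2]
    · refine ⟨0, fun _ => ⟨by rw [norm_zero]; positivity, fun s a hs => ?_⟩⟩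
      rw [futureSum_eq_zero M π hF0 s (by omega) a, inner_zero_right, sub_zero, abs_zero]
      positivity
  choose ϑ hϑ using hpiece
  obtain ⟨θ₀, hn₀, hr₀⟩ := hreal π h h1 (by omega)
  have hcard : (K.card : ℝ) ≤ p.H * p.d₀ := by
    rw [hK, Finset.card_product]
    have : (Finset.Icc 2 p.H).card * (Finset.univ : Finset (Fin p.d₀)).card ≤ p.H * p.d₀ := by
      simp only [Nat.card_Icc, Finset.card_univ, Fintype.card_fin]
      exact Nat.mul_le_mul_right _ (by omega)
    exact_mod_cast this
  have hsum : ∀ s a, futureSum M π f s a = ∑ k ∈ K, futureSum M π (F k) s a := by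
    refine futureSum_sum M π K F (fun s hs => ?_)
    rcases Nat.lt_or_ge p.H (M.stage s) with h3 | h3
    · have h4 : M.stage s = p.H + 1 := by have := M.stage_le s; omega
      rw [hflast s h4]
      refine (Finset.sum_eq_zero fun k hk => ?_).symm
      simp only [hK, Finset.mem_product, Finset.mem_Icc, Finset.mem_univ, and_true] at hk
      simp only [hF]
      rw [if_neg (by omega)]
    · rw [Finset.sum_eq_single (M.stage s, I s)]
      · simp only [hF]; simp
      · rintro ⟨t, i⟩ _ hne
        simp only [hF]
        rw [if_neg]
        rintro ⟨e1, e2⟩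
        exact hne (Prod.ext e1.symm e2.symm)
      · intro hn
        refine absurd ?_ hn
        simp only [hK, Finset.mem_product, Finset.mem_Icc, Finset.mem_univ, and_true]
        omega
  -- One unit for $q^\pi$ and $2/\kappa$ for each piece. This is the factor in $\tilde L_2$, up to
  -- $\sqrt{2d}$; consequently $\vartheta$ may leave the ball of radius $\tilde L_2$ and serves only
  -- as a reference point.
  have hfac : 1 + p.H * p.d₀ * (2 / κ)
      ≤ Real.sqrt (2 * p.d) * (8 * (p.H : ℝ) ^ 2 * p.d₀ / p.alpha + 1) := by
    have e : p.H * p.d₀ * (2 / κ)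
        = Real.sqrt (2 * p.d) * (8 * (p.H : ℝ) ^ 2 * p.d₀ / p.alpha) := by
      rw [hκ]; field_simp; ring
    have h2 : 1 ≤ Real.sqrt (2 * p.d) := by
      rw [Real.one_le_sqrt]
      have : (1 : ℝ) ≤ p.d := by exact_mod_cast hp.2.1
      linarith
    rw [e]; linarith
  refine ⟨θ₀ + ∑ k ∈ K, ϑ k, ?_, fun s a hs => ?_⟩
  · refine (norm_add_le _ _).trans ?_
    have h2 : ‖∑ k ∈ K, ϑ k‖ ≤ p.H * p.d₀ * (2 * p.L₂ / κ) := by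
      refine (norm_sum_le_of_le K fun k hk => (hϑ k hk).1).trans ?_
      rw [Finset.sum_const, nsmul_eq_mul]
      gcongr
    have h3 := mul_le_mul_of_nonneg_left hfac hL₂.le
    rw [Params.L₂']
    calc ‖θ₀‖ + ‖∑ k ∈ K, ϑ k‖ ≤ p.L₂ + p.H * p.d₀ * (2 * p.L₂ / κ) := add_le_add hn₀ h2
      _ = p.L₂ * (1 + p.H * p.d₀ * (2 / κ)) := by ring
      _ ≤ _ := h3
      _ = _ := by ring
  · rw [hdecomp, hsum, inner_add_right, inner_sum]
    have e : qPi M π s a + ∑ k ∈ K, futureSum M π (F k) s a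
        - (inner ℝ (φ s a) θ₀ + ∑ k ∈ K, inner ℝ (φ s a) (ϑ k))
        = (qPi M π s a - inner ℝ (φ s a) θ₀)
          + ∑ k ∈ K, (futureSum M π (F k) s a - inner ℝ (φ s a) (ϑ k)) := by
      rw [Finset.sum_sub_distrib]; ring
    rw [e]
    refine (abs_add_le _ _).trans ?_
    have h2 : |∑ k ∈ K, (futureSum M π (F k) s a - inner ℝ (φ s a) (ϑ k))|
        ≤ p.H * p.d₀ * (2 * η / κ) := by
      refine (Finset.abs_sum_le_sum_abs _ _).trans ?_
      refine (Finset.sum_le_sum fun k hk => (hϑ k hk).2 s a hs).trans ?_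
      rw [Finset.sum_const, nsmul_eq_mul]
      gcongr
    calc |qPi M π s a - inner ℝ (φ s a) θ₀|
          + |∑ k ∈ K, (futureSum M π (F k) s a - inner ℝ (φ s a) (ϑ k))|
        ≤ η + p.H * p.d₀ * (2 * η / κ) := add_le_add (hr₀ s a hs) h2
      _ = (1 + p.H * p.d₀ * (2 / κ)) * η := by ring
      _ ≤ _ := mul_le_mul_of_nonneg_right hfac hη

end Guesses

/-! ### Least-squares errors and membership in the confidence sets. -/

section ConfidenceSets

variable {S A : Type*} [Fintype S] [Fintype A] [Nonempty A] {p : Params}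
  [MeasurableSpace S] [MeasurableSpace A] [DiscreteMeasurableSpace S] [DiscreteMeasurableSpace A]

theorem Params.Valid.L₂'_pos (hp : p.Valid) : 0 < p.L₂' := by
  have h1 := hp.alpha_pos
  have h2 := hp.2.2.2.2.2.2.2.2
  unfold Params.L₂'
  positivity

theorem Params.Valid.L₂_le (hp : p.Valid) : p.L₂ ≤ p.L₂' := by
  have h1 := hp.alpha_pos
  have h2 := hp.2.2.2.2.2.2.2.2
  unfold Params.L₂'
  refine le_mul_of_one_le_right h2.le ?_
  have : 0 ≤ 8 * (p.H : ℝ) ^ 2 * p.d₀ / p.alpha := by positivity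
  linarith

/-- The regularization is chosen such that the bias $\sqrt\lambda\tilde L_2$ equals $H^{3/2}d$, the
order of $\beta$ up to logarithms. -/
theorem Params.Valid.sqrt_lam (hp : p.Valid) :
    Real.sqrt p.lam = (p.H : ℝ) ^ (3 / 2 : ℝ) * p.d / p.L₂' := by
  have h1 := hp.L₂'_pos
  unfold Params.lam
  exact Real.sqrt_sq (by positivity)

theorem Params.Valid.lam_pos (hp : p.Valid) : 0 < p.lam := by
  have h1 := hp.L₂'_pos
  have h2 : (0 : ℝ) < p.H := by exact_mod_cast hp.1
  have h3 : (0 : ℝ) < p.d := by exact_mod_cast hp.2.1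
  unfold Params.lam
  positivity

theorem omega_congr {M : MDP S A p.H} (φ : S → A → Vec p.d) {G G' : ℕ → Fin p.d₀ → Vec p.d}
    (hG : ∀ u, 2 ≤ u → u ≤ p.H → G u = G' u) :
    omega p M.stage φ G = omega p M.stage φ G' := by
  funext s
  by_cases hs : M.stage s = 1 ∨ M.stage s = p.H + 1
  · rcases hs with hs | hs
    · rw [omega_first M.stage φ G hs, omega_first M.stage φ G' hs]
    · rw [omega_last M.stage φ G hs, omega_last M.stage φ G' hs]
  · have h1 := M.one_le_stage s
    have h2 := M.stage_le s
    have : rangeG p M.stage φ G s = rangeG p M.stage φ G' s := by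
      unfold rangeG
      rw [hG (M.stage s) (by omega) (by omega)]
    unfold omega
    rw [this]

/-- `least_squares_error` on the event of the noise process, at the pair after $h-1$ steps. It
serves both for parameters of a true policy and for the linearizations available at the good guess,
which have a larger norm bound $N$. -/
theorem norm_lsEstimate_sub_le (hp : p.Valid) {M : MDP S A p.H} {φ : S → A → Vec p.d}
    (hφ : ∀ s a, ‖φ s a‖ ≤ p.L₁) {π : Policy S A} {n : ℕ} {D : Fin n → Traj S A p.H}
    (hD : ∀ j, GoodTraj M (D j)) {R L : ℝ} (hL : 0 ≤ L)
    (hnoise : ∀ t < p.H, ∀ v G θ, (∀ i, |v i| ≤ R) →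
      (∀ u ≤ p.H, ∀ i j, |G u i j| ≤ R) → (∀ u ≤ p.H, ∀ j, |θ u j| ≤ R) → θ (p.H + 1) = 0 →
      ∑ j, noiseExp M φ π t v G θ (D j) ≤ L)
    {G : ℕ → Fin p.d₀ → Vec p.d} (hG : ∀ u, 2 ≤ u → u ≤ p.H → ∀ i, ‖G u i‖ ≤ p.L₂)
    {θ : ℕ → Vec p.d} (hθ : ∀ u ≤ p.H, ‖θ u‖ ≤ p.L₂') (hlast : θ (p.H + 1) = 0) (hR : p.L₂' ≤ R)
    {h : ℕ} (h1 : 1 ≤ h) (hH : h ≤ p.H) {ϑ : Vec p.d} {N η : ℝ} (hη : 0 ≤ η) (hN : ‖ϑ‖ ≤ N)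
    (hϑ : ∀ s a, M.stage s = h → |targetMean M φ π G θ s a - inner ℝ (φ s a) ϑ| ≤ η)
    (hRN : (N + n * p.L₁ * (η + 2 * p.H) / p.lam) / (p.H : ℝ) ^ 2 ≤ R) :
    wnorm (gram p φ D h) (ϑ - lsEstimate p M.stage φ D G h θ)
      ≤ 2 * (Real.sqrt p.lam * N + η * Real.sqrt n) + Real.sqrt (2 * L) * p.H := by
  have hHpos : (0 : ℝ) < p.H := by exact_mod_cast hp.1
  have hst : ∀ j, M.stage (seqOf (D j) (h - 1)).1.1 = h := fun j => by
    rw [(hD j).2 (h - 1) (by omega)]; omega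
  -- The norm constraint covers only the stages $2,\dots,H$. Setting the other components to zero
  -- puts the guess into the box without changing $\omega_G$.
  set G' : ℕ → Fin p.d₀ → Vec p.d := fun u i => if 2 ≤ u ∧ u ≤ p.H then G u i else 0 with hG'
  have hω : omega p M.stage φ G = omega p M.stage φ G' :=
    omega_congr φ fun u h2 h3 => by funext i; simp [hG', h2, h3]
  have htm : targetMean M φ π G θ = targetMean M φ π G' θ := by
    unfold targetMean; rw [hω]
  have hR0 : 0 ≤ R := hp.L₂'_pos.le.trans hR
  have hmem : ∀ s a, targetMean M φ π G θ s a ∈ Set.Icc (0 : ℝ) (2 * p.H) :=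
    dp_stop_mem M π (omega_mem M.stage φ hp G) fun s => vBar_mem p φ (θ (M.stage s)) s
  have htar : ∀ j, target p M.stage φ G (D j) h θ = stopReturn (omega p M.stage φ G')
      (vBarAt M φ θ) (p.H - (h - 1)) (fun i => seqOf (D j) (i + (h - 1))) := fun j => by
    rw [target_eq_stopReturn φ G (hD j) h1 hH θ, hω]
    have : p.H + 1 - h = p.H - (h - 1) := by omega
    rw [this]; rfl
  have htarmem : ∀ j, target p M.stage φ G (D j) h θ ∈ Set.Icc (0 : ℝ) (2 * p.H) := fun j => by
    rw [htar j]
    have := stopReturn_mem (ω := omega p M.stage φ G') (g := vBarAt M φ θ) (B := p.H)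
      (omega_mem M.stage φ hp G') (fun s => vBar_mem p φ (θ (M.stage s)) s) hHpos.le (p.H - (h - 1))
      (fun i => seqOf (D j) (i + (h - 1))) (fun i => (hD j).1 _)
    refine ⟨this.1, this.2.trans ?_⟩
    have h5 : ((p.H - (h - 1) : ℕ) : ℝ) ≤ p.H := by exact_mod_cast Nat.sub_le _ _
    linarith
  have key := least_squares_error hp.lam_pos hη hHpos hp.2.2.2.2.2.2.2.1.le
    (by positivity : (0 : ℝ) ≤ 2 * p.H) hL (fun j => feat p φ D j h)
    (fun j => target p M.stage φ G (D j) h θ)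
    (fun j => targetMean M φ π G θ (seqOf (D j) (h - 1)).1.1 (seqOf (D j) (h - 1)).1.2)
    ϑ (R := R) (fun j => hφ _ _) (fun j => hϑ _ _ (hst j))
    (fun j => by
      have h2 := htarmem j
      have h3 := hmem (seqOf (D j) (h - 1)).1.1 (seqOf (D j) (h - 1)).1.2
      rw [abs_le]; constructor <;> linarith [h2.1, h2.2, h3.1, h3.2])
    (by
      refine le_trans ?_ hRN
      gcongr)
    (fun v hv => by
      have := hnoise (h - 1) (by omega) v G' θ hv (fun u hu i j => by
        simp only [hG']
        split_ifs with h5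
        · exact (abs_coord_le_norm _ _).trans ((hG u h5.1 h5.2 i).trans (hp.L₂_le.trans hR))
        · simpa using hR0) (fun u hu j =>
          (abs_coord_le_norm _ _).trans ((hθ u hu).trans hR)) hlast
      refine le_trans (le_of_eq (Finset.sum_congr rfl fun j _ => ?_)) this
      simp only [noiseExp, htar j, htm]
      rfl)
  refine key.trans ?_
  have : Real.sqrt p.lam * ‖ϑ‖ ≤ Real.sqrt p.lam * N := by gcongr
  linarith

theorem mem_Theta_iff (stage : S → ℕ) (φ : S → A → Vec p.d) {n : ℕ}
    (D : Fin n → Traj S A p.H) (β : ℝ) (G : ℕ → Fin p.d₀ → Vec p.d) {h : ℕ} (hH : h ≤ p.H)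
    (x : Vec p.d) : x ∈ Theta p stage φ D β G h ↔ ‖x‖ ≤ p.L₂' ∧ ∃ θ : ℕ → Vec p.d,
      (∀ u, h < u → u ≤ p.H + 1 → θ u ∈ Theta p stage φ D β G u) ∧
      wnorm (gram p φ D h) (x - lsEstimate p stage φ D G h θ) ≤ β := by
  rw [Theta, if_pos hH]; rfl

theorem Theta_last (stage : S → ℕ) (φ : S → A → Vec p.d) {n : ℕ}
    (D : Fin n → Traj S A p.H) (β : ℝ) (G : ℕ → Fin p.d₀ → Vec p.d) :
    Theta p stage φ D β G (p.H + 1) = {0} := by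
  rw [Theta, if_neg (by omega)]

/-- A sequence of parameters can be assumed to be bounded and to vanish at the last stage. -/
theorem exists_of_mem_Theta (hp : p.Valid) {M : MDP S A p.H} {φ : S → A → Vec p.d} {n : ℕ}
    {D : Fin n → Traj S A p.H} (hD : ∀ j, GoodTraj M (D j)) {β : ℝ}
    {G : ℕ → Fin p.d₀ → Vec p.d} {h : ℕ} (h1 : 1 ≤ h) (hH : h ≤ p.H) {x : Vec p.d}
    (hx : x ∈ Theta p M.stage φ D β G h) :
    ∃ θ : ℕ → Vec p.d, (∀ u, h < u → u ≤ p.H + 1 → θ u ∈ Theta p M.stage φ D β G u) ∧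
      (∀ u ≤ p.H, ‖θ u‖ ≤ p.L₂') ∧ θ (p.H + 1) = 0 ∧
      wnorm (gram p φ D h) (x - lsEstimate p M.stage φ D G h θ) ≤ β := by
  obtain ⟨-, θ, hθ, hw⟩ := (mem_Theta_iff M.stage φ D β G hH x).1 hx
  refine ⟨fun u => if h < u ∧ u ≤ p.H + 1 then θ u else 0, fun u h2 h3 => ?_, fun u hu => ?_, ?_, ?_⟩
  · beta_reduce; rw [if_pos ⟨h2, h3⟩]; exact hθ u h2 h3
  · beta_reduce; split_ifs with h2
    · exact ((mem_Theta_iff M.stage φ D β G hu _).1 (hθ u h2.1 h2.2)).1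
    · simpa using hp.L₂'_pos.le
  · beta_reduce; rw [if_pos ⟨by omega, le_rfl⟩]
    have := hθ (p.H + 1) (by omega) le_rfl
    rw [Theta_last] at this
    exact this
  · have : lsEstimate p M.stage φ D G h (fun u => if h < u ∧ u ≤ p.H + 1 then θ u else 0)
        = lsEstimate p M.stage φ D G h θ := by
      unfold lsEstimate
      congr 3
      refine Finset.sum_congr rfl fun j _ => ?_
      rw [target_congr hp φ (hD j) h1 hH (fun u _ => rfl)
        (fun u h2 h3 => if_pos ⟨h2, h3⟩)]
    rw [this]; exact hw

/-- For every guess, the parameters of some policy belong to the confidence sets. -/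
theorem exists_realizing_mem_Theta (hp : p.Valid) {M : MDP S A p.H} {φ : S → A → Vec p.d}
    (hφ : ∀ s a, ‖φ s a‖ ≤ p.L₁) {π : Policy S A} {n : ℕ} {D : Fin n → Traj S A p.H}
    (hD : ∀ j, GoodTraj M (D j)) {R L η β : ℝ} (hL : 0 ≤ L) (hη : 0 ≤ η)
    (hreal : ApproxRealizable M φ η p.L₂)
    (hnoise : ∀ t < p.H, ∀ v G θ, (∀ i, |v i| ≤ R) →
      (∀ u ≤ p.H, ∀ i j, |G u i j| ≤ R) → (∀ u ≤ p.H, ∀ j, |θ u j| ≤ R) → θ (p.H + 1) = 0 →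
      ∑ j, noiseExp M φ π t v G θ (D j) ≤ L)
    (hR : p.L₂' ≤ R)
    (hRN : (p.L₂' + n * p.L₁ * (((p.H : ℝ) + 1) * η + 2 * p.H) / p.lam) / (p.H : ℝ) ^ 2 ≤ R)
    (hβ : 2 * (Real.sqrt p.lam * p.L₂' + ((p.H : ℝ) + 1) * η * Real.sqrt n)
      + Real.sqrt (2 * L) * p.H ≤ β)
    {G : ℕ → Fin p.d₀ → Vec p.d} (hG : ∀ u, 2 ≤ u → u ≤ p.H → ∀ i, ‖G u i‖ ≤ p.L₂) :
    ∃ (σ : Policy S A) (θ : ℕ → Vec p.d),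
      (∀ s, piAvg σ s (qPi M σ s) = greedyNode (omega p M.stage φ G) π s (qPi M σ s)) ∧
      (∀ t, 1 ≤ t → t ≤ p.H → Realizes M φ η t σ (θ t)) ∧
      ∀ t, 1 ≤ t → t ≤ p.H + 1 → θ t ∈ Theta p M.stage φ D β G t := by
  obtain ⟨σ, hσ1, hσ2⟩ := exists_greedy_policy M (omega_mem M.stage φ hp G) π
  have hex : ∀ t, ∃ x : Vec p.d, 1 ≤ t → t ≤ p.H → Realizes M φ η t σ x := fun t => by
    by_cases ht : 1 ≤ t ∧ t ≤ p.H
    · obtain ⟨x, h1, h2⟩ := hreal σ t ht.1 (by omega)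
      exact ⟨x, fun _ _ => ⟨h1, h2⟩⟩
    · exact ⟨0, fun h1 h2 => absurd ⟨h1, h2⟩ ht⟩
  choose f hf using hex
  set θ : ℕ → Vec p.d := fun u => if 1 ≤ u ∧ u ≤ p.H then f u else 0 with hθdef
  have hr : ∀ t, 1 ≤ t → t ≤ p.H → Realizes M φ η t σ (θ t) := fun t h1 h2 => by
    simp only [hθdef, h1, h2, and_self, if_true]; exact hf t h1 h2
  have hlast : θ (p.H + 1) = 0 := by
    simp only [hθdef]; rw [if_neg (by omega)]
  have hb : ∀ u ≤ p.H, ‖θ u‖ ≤ p.L₂' := fun u hu => by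
    rcases Nat.eq_zero_or_pos u with h0 | h0
    · simp only [hθdef]; rw [if_neg (by omega)]; simpa using hp.L₂'_pos.le
    · exact (hr u h0 hu).1.trans hp.L₂_le
  refine ⟨σ, θ, hσ2, hr, fun t => ?_⟩
  -- Backward induction over the stages. Built from these parameters, the targets have means within
  -- $H\eta$ of $q^\sigma$, which is within $\eta$ of a linear function; no linearity of other
  -- targets is needed, so $G$ can be arbitrary.
  have main : ∀ k t, p.H + 1 - t = k → 1 ≤ t → t ≤ p.H + 1 → θ t ∈ Theta p M.stage φ D β G t := by
    intro k
    induction k using Nat.strong_induction_on with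
    | _ k ih =>
      intro t hk h1 h2
      rcases Nat.lt_or_ge p.H t with h3 | h3
      · have : t = p.H + 1 := by omega
        subst this
        rw [Theta_last, hlast]; rfl
      · rw [mem_Theta_iff M.stage φ D β G h3]
        refine ⟨hb t h3, θ, fun u hu hu' => ih (p.H + 1 - u) (by omega) u rfl (by omega) hu', ?_⟩
        refine (norm_lsEstimate_sub_le hp hφ hD hL hnoise hG hb hlast hR h1 h3
          (by positivity : 0 ≤ ((p.H : ℝ) + 1) * η) (hb t h3) (fun s a hs => ?_) hRN).trans hβ
        have e1 := targetMean_sub_qPi_le hp hη π σ hσ1 hlast hr s a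
        have e2 := (hr t h1 h3).2 s a hs
        calc _ ≤ |targetMean M φ π G θ s a - qPi M σ s a|
              + |qPi M σ s a - inner ℝ (φ s a) (θ t)| := abs_sub_le _ _ _
          _ ≤ _ := by linarith
  exact main _ t rfl

end ConfidenceSets

/-! ### Widths of the confidence sets and averages of the bonuses. -/

section Width

variable {S A : Type*} [Fintype S] [Fintype A] [Nonempty A] {p : Params}
  [MeasurableSpace S] [MeasurableSpace A] [DiscreteMeasurableSpace S] [DiscreteMeasurableSpace A]

theorem abs_clip_sub_le_card (H : ℕ) (x y : ℝ) : |clip H x - clip H y| ≤ H := by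
  have h1 := clip_mem H x
  have h2 := clip_mem H y
  rw [abs_le]
  constructor <;> linarith [h1.1, h1.2, h2.1, h2.2]

/-- The rewards cancel. With probability $1-\omega$ one stops and sees a difference of $\bar v$, at
most the largest width in that state; with probability $\omega$ one continues along $\pi$. This is
the recursion of the width without the bonus of the first step. -/
theorem abs_targetMean_sub_le_widthBound (hp : p.Valid) {M : MDP S A p.H} {φ : S → A → Vec p.d}
    (π : Policy S A) (G : ℕ → Fin p.d₀ → Vec p.d) {θ θ' : ℕ → Vec p.d} {b : S → A → ℝ}
    (hb : ∀ s a, 0 ≤ b s a) {h : ℕ}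
    (hg : ∀ s, h < M.stage s → |vBarAt M φ θ s - vBarAt M φ θ' s|
      ≤ ⨆ a, widthBound M (omega p M.stage φ G) π b s a) :
    ∀ s, h ≤ M.stage s → ∀ a, |targetMean M φ π G θ s a - targetMean M φ π G θ' s a|
      ≤ if M.stage s ≤ p.H then widthBound M (omega p M.stage φ G) π b s a - b s a else 0 := by
  set ω := omega p M.stage φ G
  have hω := omega_mem M.stage φ hp G
  refine stage_induction M (fun s hs _ a => ?_) (fun s hs ih hhs a => ?_)
  · rw [if_neg (by omega), targetMean, targetMean, dp_last _ _ _ hs, dp_last _ _ _ hs]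
    simp
  · rw [if_pos hs, targetMean, targetMean, dp_eq _ _ _ hs, dp_eq _ _ _ hs, widthBound,
      dp_eq _ _ _ hs, add_sub_add_left_eq_sub, add_sub_cancel_left, ← trAvg_sub, abs_le]
    have hpt : ∀ s', M.stage s' = M.stage s + 1 →
        |stopNode ω (vBarAt M φ θ) π s' (targetMean M φ π G θ s')
          - stopNode ω (vBarAt M φ θ') π s' (targetMean M φ π G θ' s')|
          ≤ greedyNode ω π s' (widthBound M ω π b s') := by
      intro s' hs'
      obtain ⟨w0, w1⟩ := hω s'
      have hq : ∀ a, |targetMean M φ π G θ s' a - targetMean M φ π G θ' s' a|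
          ≤ widthBound M ω π b s' a := fun a => by
        refine (ih s' hs' (by omega) a).trans ?_
        split_ifs with h5
        · linarith [hb s' a]
        · rw [widthBound, dp_last _ _ _ (by omega)]
      have e1 : |piAvg π s' (targetMean M φ π G θ s') - piAvg π s' (targetMean M φ π G θ' s')|
          ≤ piAvg π s' (widthBound M ω π b s') := by
        rw [← piAvg_sub, abs_le]
        refine ⟨?_, piAvg_mono π s' fun a => (abs_le.1 (hq a)).2⟩
        have := piAvg_mono π s' (fun a => (abs_le.1 (hq a)).1)
        have e : piAvg π s' (fun a => - widthBound M ω π b s' a)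
            = - piAvg π s' (widthBound M ω π b s') := by simp [piAvg]
        rw [← e]; exact this
      have e2 := hg s' (by omega)
      have e3 : stopNode ω (vBarAt M φ θ) π s' (targetMean M φ π G θ s')
          - stopNode ω (vBarAt M φ θ') π s' (targetMean M φ π G θ' s')
          = (1 - ω s') * (vBarAt M φ θ s' - vBarAt M φ θ' s')
            + ω s' * (piAvg π s' (targetMean M φ π G θ s')
              - piAvg π s' (targetMean M φ π G θ' s')) := by unfold stopNode; ring
      rw [e3, greedyNode]
      refine (abs_add_le _ _).trans (add_le_add ?_ ?_)
      · rw [abs_mul, abs_of_nonneg (by linarith : 0 ≤ 1 - ω s')]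
        exact mul_le_mul_of_nonneg_left e2 (by linarith)
      · rw [abs_mul, abs_of_nonneg w0]
        exact mul_le_mul_of_nonneg_left e1 w0
    refine ⟨?_, trAvg_mono a hs fun s' hs' => (abs_le.1 (hpt s' hs')).2⟩
    have e : trAvg M s a (fun s' => - greedyNode ω π s' (widthBound M ω π b s'))
        = - trAvg M s a fun s' => greedyNode ω π s' (widthBound M ω π b s') := by simp [trAvg]
    rw [← show _ = - trAvg M s a fun s' => greedyNode ω π s' (dp M b (greedyNode ω π) s') from e]
    exact trAvg_mono a hs fun s' hs' => (abs_le.1 (hpt s' hs')).1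

/-- The width of the confidence sets of a good guess. -/
theorem abs_qBar_sub_le_widthBound (hp : p.Valid) {M : MDP S A p.H} {φ : S → A → Vec p.d}
    {π : Policy S A} {n : ℕ} {D : Fin n → Traj S A p.H} {β ρ η : ℝ} (hη : 0 ≤ η) (hρ : 0 ≤ ρ)
    {G : ℕ → Fin p.d₀ → Vec p.d}
    (hfit : ∀ h, 1 ≤ h → h ≤ p.H → ∀ x ∈ Theta p M.stage φ D β G h, ∃ θ : ℕ → Vec p.d,
      (∀ u, h < u → u ≤ p.H + 1 → θ u ∈ Theta p M.stage φ D β G u) ∧ ∃ ϑ : Vec p.d,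
        wnorm (gram p φ D h) (x - ϑ) ≤ ρ ∧
        ∀ s a, M.stage s = h → |targetMean M φ π G θ s a - inner ℝ (φ s a) ϑ| ≤ η)
    (s : S) (a : A) {x x' : Vec p.d} (hx : x ∈ Theta p M.stage φ D β G (M.stage s))
    (hx' : x' ∈ Theta p M.stage φ D β G (M.stage s)) :
    |qBar p φ x s a - qBar p φ x' s a| ≤ widthBound M (omega p M.stage φ G) π
      (fun s a => bonus φ (2 * ρ) (2 * η) (gram p φ D (M.stage s))⁻¹ s a) s a := by
  set b : S → A → ℝ := fun s a => bonus φ (2 * ρ) (2 * η) (gram p φ D (M.stage s))⁻¹ s a with hbdef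
  have hb : ∀ s a, 0 ≤ b s a := fun s a =>
    (bonus_mem φ (by positivity) (by positivity) _ s a).1
  have main : ∀ k s, p.H + 1 - M.stage s = k → ∀ a, ∀ x ∈ Theta p M.stage φ D β G (M.stage s),
      ∀ x' ∈ Theta p M.stage φ D β G (M.stage s), |qBar p φ x s a - qBar p φ x' s a|
        ≤ widthBound M (omega p M.stage φ G) π b s a := by
    intro k
    induction k using Nat.strong_induction_on with
    | _ k ih =>
      intro s hk a x hx x' hx'
      rcases Nat.lt_or_ge p.H (M.stage s) with h3 | h3
      · have h4 : M.stage s = p.H + 1 := by have := M.stage_le s; omega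
        rw [h4, Theta_last, Set.mem_singleton_iff] at hx hx'
        rw [hx, hx', widthBound, dp_last _ _ _ h3]; simp
      · obtain ⟨θ, hθ, ϑ, hw, hϑ⟩ := hfit _ (M.one_le_stage s) h3 x hx
        obtain ⟨θ', hθ', ϑ', hw', hϑ'⟩ := hfit _ (M.one_le_stage s) h3 x' hx'
        have hd := abs_targetMean_sub_le_widthBound hp (M := M) (φ := φ) π G (θ := θ) (θ' := θ') hb
          (h := M.stage s) (fun s' hs' => by
            refine abs_vBar_sub_le p φ fun a' => ?_
            refine (ih (p.H + 1 - M.stage s') (by have := M.stage_le s'; omega) s' rfl a' _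
              (hθ _ hs' (M.stage_le s')) _ (hθ' _ hs' (M.stage_le s'))).trans ?_
            exact le_ciSup (f := fun a => widthBound M (omega p M.stage φ G) π b s' a)
              (Finite.bddAbove_range _) a') s le_rfl a
        rw [if_pos h3] at hd
        have hlev : ∀ e : Vec p.d, wnorm (gram p φ D (M.stage s)) e ≤ ρ →
            |inner ℝ (φ s a) e| ≤ Real.sqrt ((φ s a).ofLp ⬝ᵥ
              (gram p φ D (M.stage s))⁻¹.mulVec (φ s a).ofLp) * ρ := fun e he =>
          (abs_inner_le_wnorm hp.lam_pos (fun j => feat p φ D j (M.stage s)) (φ s a) e).trans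
            (mul_le_mul_of_nonneg_left he (Real.sqrt_nonneg _))
        set q := Real.sqrt ((φ s a).ofLp ⬝ᵥ
              (gram p φ D (M.stage s))⁻¹.mulVec (φ s a).ofLp)
        have i1 := hlev _ hw
        have i2 := hlev _ hw'
        rw [inner_sub_right] at i1 i2
        have i3 := hϑ s a rfl
        have i4 := hϑ' s a rfl
        have hW : 0 ≤ widthBound M (omega p M.stage φ G) π b s a - b s a :=
          (abs_nonneg _).trans hd
        have hbe : b s a = min (p.H : ℝ) (2 * ρ * q + 2 * η) := rfl
        have hle : |qBar p φ x s a - qBar p φ x' s a|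
            ≤ 2 * ρ * q + 2 * η + (widthBound M (omega p M.stage φ G) π b s a - b s a) := by
          refine (abs_clip_sub_le _ _ _).trans ?_
          rw [abs_le] at *
          constructor <;> linarith [i1.1, i1.2, i2.1, i2.2, i3.1, i3.2, i4.1, i4.2, hd.1, hd.2]
        -- If the bonus is capped, the bound holds trivially, because clipped values differ by at
        -- most $H$.
        rcases le_total (p.H : ℝ) (2 * ρ * q + 2 * η) with h5 | h5
        · rw [min_eq_left h5] at hbe
          have := abs_clip_sub_le_card p.H (inner ℝ (φ s a) x) (inner ℝ (φ s a) x')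
          refine this.trans ?_
          linarith
        · rw [min_eq_right h5] at hbe
          linarith
  exact main _ s rfl a x hx x' hx'

/-- Cauchy–Schwarz over the data, together with the fact that the leverages of the data points add
up to at most $d$. -/
theorem empE_bonus_le (hp : p.Valid) (φ : S → A → Vec p.d) {n : ℕ} (hn : 0 < n)
    (D : Fin n → Traj S A p.H) {c η : ℝ} (hc : 0 ≤ c) (t : ℕ) :
    empE D t (bonus φ c η (gram p φ D (t + 1))⁻¹) ≤ c * Real.sqrt (p.d / n) + η := by
  have hn' : (0 : ℝ) < n := by exact_mod_cast hn
  set x : Fin n → Fin p.d → ℝ := fun j => (feat p φ D j (t + 1)).ofLp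
  set l : Fin n → ℝ := fun j => x j ⬝ᵥ (gram p φ D (t + 1))⁻¹.mulVec (x j) with hl
  have hl0 : ∀ j, 0 ≤ l j := fun j => regGram_inv_nonneg hp.lam_pos x Finset.univ (x j)
  have hsum : ∑ j, l j ≤ p.d := sum_leverage_le hp.lam_pos x Finset.univ
  have hcs : ∑ j, Real.sqrt (l j) ≤ Real.sqrt (n * p.d) := by
    refine Real.le_sqrt_of_sq_le ?_
    have := sq_sum_le_card_mul_sum_sq (s := Finset.univ) (f := fun j => Real.sqrt (l j))
    refine this.trans ?_
    simp only [Finset.card_univ, Fintype.card_fin, Real.sq_sqrt (hl0 _)]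
    gcongr
  have h1 : empE D t (bonus φ c η (gram p φ D (t + 1))⁻¹)
      ≤ (1 / (n : ℝ)) * ∑ j, (c * Real.sqrt (l j) + η) := by
    unfold empE
    refine mul_le_mul_of_nonneg_left (Finset.sum_le_sum fun j _ => min_le_right _ _) (by positivity)
  refine h1.trans ?_
  rw [Finset.sum_add_distrib, ← Finset.mul_sum, Finset.sum_const, Finset.card_univ,
    Fintype.card_fin, nsmul_eq_mul, mul_add, ← mul_assoc (1 / (n : ℝ)) n η,
    one_div_mul_cancel hn'.ne', one_mul]
  have h2 : Real.sqrt (p.d / n) = 1 / n * Real.sqrt (n * p.d) := by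
    rw [Real.sqrt_eq_iff_mul_self_eq (by positivity) (by positivity)]
    have := Real.mul_self_sqrt (by positivity : (0 : ℝ) ≤ n * p.d)
    rw [mul_mul_mul_comm, this]
    field_simp
  rw [h2]
  have : 1 / (n : ℝ) * (c * ∑ j, Real.sqrt (l j)) ≤ c * (1 / n * Real.sqrt (n * p.d)) := by
    rw [mul_left_comm]
    gcongr
  linarith

/-- Follows from $X\succeq\lambda I$. It places the data-dependent matrices $X_h^{-1}$ in the box
over which the bonuses concentrate uniformly. -/
theorem abs_inv_gram_le (hp : p.Valid) (φ : S → A → Vec p.d) {n : ℕ}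
    (D : Fin n → Traj S A p.H) (h : ℕ) (i j : Fin p.d) :
    |(gram p φ D h)⁻¹ i j| ≤ 1 / p.lam := by
  set X := gram p φ D h
  set x : Fin n → Fin p.d → ℝ := fun j => (feat p φ D j h).ofLp
  set y : Fin p.d → ℝ := X⁻¹.mulVec (Pi.single j 1) with hy
  have hlam := hp.lam_pos
  have e1 : X.mulVec y = Pi.single j 1 := regGram_mulVec_inv hlam x Finset.univ _
  have e2 : y i = X⁻¹ i j := by simp [hy]
  have e3 : y ⬝ᵥ X.mulVec y = y j := by rw [e1]; simp
  have e4 : p.lam * (y ⬝ᵥ y) ≤ y j := by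
    rw [← e3]
    have := dot_regGram p.lam x Finset.univ y y
    rw [show X = regGram p.lam x Finset.univ from rfl, this]
    have : 0 ≤ ∑ k, (x k ⬝ᵥ y) * (x k ⬝ᵥ y) := Finset.sum_nonneg fun k _ => mul_self_nonneg _
    linarith
  have e5 : ∀ k, y k ^ 2 ≤ y ⬝ᵥ y := fun k => by
    rw [dotProduct, sq]
    exact Finset.single_le_sum (f := fun k => y k * y k) (fun k _ => mul_self_nonneg _)
      (Finset.mem_univ k)
  have e6 : p.lam * y j ≤ 1 := by
    by_contra hcon
    push Not at hcon
    have h1 := e5 j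
    have h2 : 0 < y j := by
      by_contra h
      push Not at h
      nlinarith
    nlinarith [mul_le_mul_of_nonneg_left h1 hlam.le]
  have e7 : (p.lam * y i) ^ 2 ≤ 1 := by
    have h1 := mul_le_mul_of_nonneg_left (e5 i) hlam.le
    calc (p.lam * y i) ^ 2 = p.lam * (p.lam * y i ^ 2) := by ring
      _ ≤ p.lam * y j := mul_le_mul_of_nonneg_left (by linarith) hlam.le
      _ ≤ 1 := e6
  rw [← e2, le_div_iff₀ hlam]
  have := (sq_le_one_iff_abs_le_one (p.lam * y i)).1 e7
  rwa [abs_mul, abs_of_pos hlam, mul_comm] at this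

end Width

/-! ### Deterministic analysis on the good event. -/

section GoodData

variable {S A : Type*} [Fintype S] [Fintype A] [Nonempty A] {p : Params}
  [MeasurableSpace S] [MeasurableSpace A] [DiscreteMeasurableSpace S] [DiscreteMeasurableSpace A]

/-- The event on which the learner succeeds: empirical quantities concentrate, uniformly in the
parameters of the box of radius `R`. -/
structure GoodData (M : MDP S A p.H) (φ : S → A → Vec p.d) (π : Policy S A) (ω : S → ℝ)
    (c η R L : ℝ) {n : ℕ} (D : Fin n → Traj S A p.H) : Prop where
  good : ∀ j, GoodTraj M (D j)
  noise : ∀ t < p.H, ∀ v G θ, (∀ i, |v i| ≤ R) → (∀ u ≤ p.H, ∀ i j, |G u i j| ≤ R) →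
    (∀ u ≤ p.H, ∀ j, |θ u j| ≤ R) → θ (p.H + 1) = 0 → ∑ j, noiseExp M φ π t v G θ (D j) ≤ L
  diff : ∀ t < p.H, ∀ x y : Vec p.d, (∀ i, |x i| ≤ R) → (∀ i, |y i| ≤ R) →
    occE M π t (fun s a => |qBar p φ x s a - qBar p φ y s a|)
      ≤ empE D t (fun s a => |qBar p φ x s a - qBar p φ y s a|) + 2 * p.H * Real.sqrt (L / n)
  width : ∀ t < p.H, ∀ Y : ℕ → Matrix (Fin p.d) (Fin p.d) ℝ, (∀ u i j, |Y u i j| ≤ R) →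
    empE D t (widthBound M ω π fun s a => bonus φ c η (Y (M.stage s)) s a)
      ≤ occE M π t (widthBound M ω π fun s a => bonus φ c η (Y (M.stage s)) s a)
        + 2 * (p.H * p.H) * Real.sqrt (L / n)
  bonus : ∀ t < p.H, ∀ Y : Matrix (Fin p.d) (Fin p.d) ℝ, (∀ i j, |Y i j| ≤ R) →
    occE M π t (OfflineRL.bonus φ c η Y)
      ≤ empE D t (OfflineRL.bonus φ c η Y) + 2 * p.H * Real.sqrt (L / n)

/-- With $\sigma$ and $\theta^o$ for the good guess and $\sigma'$ for the guess of the solution, the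
chain is $v^\star\le v^\sigma+\varepsilon/4$, $v^\sigma\le\bar v_{\theta^o_1}+\eta$, $\bar
v_{\theta^o_1}\le\bar v_{\theta'_1}+\varepsilon/12$, $\bar v_{\theta'_1}\le v^{\sigma'}+\xi$ and
$v^{\sigma'}\le v^{\pi'}+2H\xi$. The hypothesis `hfin` leaves $2\varepsilon/3$ for $(2H+1)\xi+\eta$.
-/
theorem vStar_sub_vPi_le (hp : p.Valid) {M : MDP S A p.H} {φ : S → A → Vec p.d}
    (hφ : ∀ s a, ‖φ s a‖ ≤ p.L₁) {η : ℝ} (hη : 0 ≤ η) (hη4 : η ≤ p.alpha / 4)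
    (hreal : ApproxRealizable M φ η p.L₂) {π : Policy S A} (hconc : Concentrable M π p.C)
    {G : ℕ → Fin p.d₀ → Vec p.d} (hGood : GoodGuess M φ η G)
    (hG : ∀ t, 1 ≤ t → t ≤ p.H + 1 → ∀ π θ, Realizes M φ η t π θ → ∀ y : Vec p.d, ∀ m : ℝ,
        (∀ i, |inner ℝ y (G t i)| ≤ m) →
          |inner ℝ y θ| ≤ Real.sqrt (2 * p.d) * m + p.alpha / (4 * p.L₁) * ‖y‖)
    {n : ℕ} (hn : 0 < n) {D : Fin n → Traj S A p.H} {β β' η' εbar R L : ℝ} (hL : 0 ≤ L)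
    (hη' : Real.sqrt (2 * p.d) * (8 * (p.H : ℝ) ^ 2 * p.d₀ / p.alpha + 1) * η ≤ η')
    (hη2 : ((p.H : ℝ) + 1) * η ≤ η')
    (hη3 : 2 * η ≤ p.alpha / (2 * Real.sqrt (2 * p.d)))
    (hR1 : p.L₂' ≤ R) (hR2 : 1 / p.lam ≤ R)
    (hR3 : (Real.sqrt (2 * p.d) * p.L₂' + n * p.L₁ * (η' + 2 * p.H) / p.lam) / (p.H : ℝ) ^ 2 ≤ R)
    (hβ : 2 * (Real.sqrt p.lam * p.L₂' + ((p.H : ℝ) + 1) * η * Real.sqrt n) + Real.sqrt (2 * L) * p.H ≤ β)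
    (hβ' : 2 * (Real.sqrt p.lam * (Real.sqrt (2 * p.d) * p.L₂') + η' * Real.sqrt n)
      + Real.sqrt (2 * L) * p.H ≤ β')
    (hε : p.C * p.H * (2 * (β + β') * Real.sqrt (p.d / n) + 2 * η')
      + 4 * p.C * p.H ^ 2 * Real.sqrt (L / n) ≤ εbar)
    (hfin : (2 * (p.H : ℝ) + 1) * (p.C * (εbar + 2 * p.H * Real.sqrt (L / n)) + η) + η
      ≤ 2 * p.ε / 3)
    (hD : GoodData M φ π (omega p M.stage φ G) (2 * (β + β')) (2 * η') R L D) :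
    (∃ G θ, Feasible p M.stage φ D β εbar G θ) ∧
      ∀ (κ : ℝ), 0 ≤ κ → κ ≤ p.ε / 12 → ∀ G θ, IsSolution p M.stage φ D M.start β εbar κ G θ →
        ∀ π' : Policy S A, IsGreedy p M.stage φ θ π' →
          vStar M M.start - vPi M π' M.start ≤ p.ε := by
  have hH1 : (1 : ℝ) ≤ p.H := by exact_mod_cast hp.1
  have hd1 : (1 : ℝ) ≤ p.d := by exact_mod_cast hp.2.1
  have hC1 : 1 ≤ p.C := hp.2.2.2.2.2.2.1
  have hL1 : 0 < p.L₁ := hp.2.2.2.2.2.2.2.1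
  have hL2' := hp.L₂'_pos
  have hlam := hp.lam_pos
  have hη'0 : 0 ≤ η' := le_trans (by positivity) hη2
  have hs2 : 1 ≤ Real.sqrt (2 * p.d) := by rw [Real.one_le_sqrt]; linarith
  have hβ'0 : 0 ≤ β' := le_trans (by positivity) hβ'
  have hβ0 : 0 ≤ β := le_trans (by positivity) hβ
  have hst1 : M.stage M.start = 1 := (M.stage_eq_one _).2 rfl
  set ω := omega p M.stage φ G with hωdef
  have hω := omega_mem M.stage φ hp G
  have hGb : ∀ u, 2 ≤ u → u ≤ p.H → ∀ i, ‖G u i‖ ≤ p.L₂ := fun u h2 h3 i => by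
    obtain ⟨_, h⟩ := hGood u (by omega) (by omega) i
    exact h.1
  have hRexists : ∀ G' : ℕ → Fin p.d₀ → Vec p.d, (∀ u, 2 ≤ u → u ≤ p.H → ∀ i, ‖G' u i‖ ≤ p.L₂) →
      ∃ (σ : Policy S A) (θ : ℕ → Vec p.d),
      (∀ s, piAvg σ s (qPi M σ s) = greedyNode (omega p M.stage φ G') π s (qPi M σ s)) ∧
      (∀ t, 1 ≤ t → t ≤ p.H → Realizes M φ η t σ (θ t)) ∧
      ∀ t, 1 ≤ t → t ≤ p.H + 1 → θ t ∈ Theta p M.stage φ D β G' t := fun G' hG' => by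
    refine exists_realizing_mem_Theta hp hφ hD.good hL hη hreal hD.noise hR1 ?_ ?_ hG'
    · refine le_trans ?_ hR3
      gcongr
      exact le_mul_of_one_le_left hL2'.le hs2
    · exact hβ
  obtain ⟨σ, θo, hσ, hreal_o, hmem_o⟩ := hRexists G hGb
  -- the width of the confidence sets of the good guess
  have hwidth : ∀ s a, ∀ x ∈ Theta p M.stage φ D β G (M.stage s),
      ∀ x' ∈ Theta p M.stage φ D β G (M.stage s), |qBar p φ x s a - qBar p φ x' s a|
        ≤ widthBound M ω π (fun s a => bonus φ (2 * (β + β')) (2 * η')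
            (gram p φ D (M.stage s))⁻¹ s a) s a := by
    intro s a x hx x' hx'
    refine abs_qBar_sub_le_widthBound hp hη'0 (by positivity) (fun h h1 h2 x hx => ?_) s a hx hx'
    obtain ⟨θ, hθ, hθb, hlast, hw⟩ := exists_of_mem_Theta hp hD.good h1 h2 hx
    obtain ⟨ϑ, hϑn, hϑ⟩ := targetMean_linear hp hη hη3 hreal π hGood hlast h1 h2
    have hϑ' : ∀ s a, M.stage s = h → |targetMean M φ π G θ s a - inner ℝ (φ s a) ϑ| ≤ η' :=
      fun s a hs => (hϑ s a hs).trans hη'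
    refine ⟨θ, hθ, ϑ, ?_, hϑ'⟩
    have e1 := norm_lsEstimate_sub_le hp hφ hD.good hL hD.noise hGb hθb hlast hR1 h1 h2 hη'0 hϑn
      hϑ' hR3
    have e2 := wnorm_add_le hlam (fun j => feat p φ D j h) (x - lsEstimate p M.stage φ D G h θ)
      (-(ϑ - lsEstimate p M.stage φ D G h θ))
    have e3 : wnorm (gram p φ D h) (-(ϑ - lsEstimate p M.stage φ D G h θ))
        = wnorm (gram p φ D h) (ϑ - lsEstimate p M.stage φ D G h θ) := by
      simp only [wnorm, WithLp.ofLp_neg, Matrix.mulVec_neg, neg_dotProduct_neg]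
    have e4 : x - ϑ = (x - lsEstimate p M.stage φ D G h θ)
        + -(ϑ - lsEstimate p M.stage φ D G h θ) := by abel
    rw [e4]
    refine e2.trans ?_
    change wnorm (gram p φ D h) _ + wnorm (gram p φ D h) _ ≤ _
    rw [e3]
    linarith [e1.trans hβ']
  set b : S → A → ℝ := fun s a => bonus φ (2 * (β + β')) (2 * η') (gram p φ D (M.stage s))⁻¹ s a
    with hbdef
  have hb : ∀ s a, 0 ≤ b s a := fun s a =>
    (bonus_mem φ (by positivity) (by positivity) _ s a).1
  have hgramR : ∀ u i j, |(gram p φ D u)⁻¹ i j| ≤ R := fun u i j =>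
    (abs_inv_gram_le hp φ D u i j).trans hR2
  have hfeas : Feasible p M.stage φ D β εbar G θo := by
    refine ⟨hGb, hmem_o, fun h h1 h2 => ?_⟩
    have e1 : (1 / (n : ℝ)) * ∑ j : Fin n,
        ((⨆ x : Theta p M.stage φ D β G h,
            qBar p φ x.1 (stepAt (D j) h).1.1 (stepAt (D j) h).1.2)
          - ⨅ x : Theta p M.stage φ D β G h,
            qBar p φ x.1 (stepAt (D j) h).1.1 (stepAt (D j) h).1.2)
        ≤ empE D (h - 1) (widthBound M ω π b) := by
      unfold empE
      refine mul_le_mul_of_nonneg_left (Finset.sum_le_sum fun j _ => ?_) (by positivity)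
      rw [stepAt_eq_seqOf]
      have hs : M.stage (seqOf (D j) (h - 1)).1.1 = h := by
        rw [(hD.good j).2 (h - 1) (by omega)]; omega
      have : Nonempty (Theta p M.stage φ D β G h) := ⟨⟨θo h, hmem_o h h1 (by omega)⟩⟩
      have key := hwidth (seqOf (D j) (h - 1)).1.1 (seqOf (D j) (h - 1)).1.2
      rw [hs] at key
      rw [sub_le_iff_le_add]
      refine ciSup_le fun x => ?_
      rw [← sub_le_iff_le_add']
      refine le_ciInf fun x' => ?_
      have := (abs_le.1 (key x.1 x.2 x'.1 x'.2)).2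
      linarith
    refine e1.trans ?_
    have ht : h - 1 < p.H := by omega
    -- The empirical width is replaced by its expectation under $\pi^0$ and unrolled into bonuses.
    -- Their expectations under $\pi^0$ are then replaced by empirical averages, where leverages can
    -- be summed.
    have e2 := hD.width (h - 1) ht (fun u => (gram p φ D u)⁻¹) hgramR
    have e3 := widthBound_occE_le (by linarith : 0 ≤ p.C) hconc hω hb ht
    have e4 : ∀ u ∈ Finset.Ico (h - 1) p.H, occE M π u b
        ≤ 2 * (β + β') * Real.sqrt (p.d / n) + 2 * η' + 2 * p.H * Real.sqrt (L / n) := by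
      intro u hu
      rw [Finset.mem_Ico] at hu
      have e5 : occE M π u b
          = occE M π u (bonus φ (2 * (β + β')) (2 * η') (gram p φ D (u + 1))⁻¹) :=
        occE_congr M π hu.2.le fun s a hs => by simp only [hbdef, hs]
      have e6 := hD.bonus u hu.2 _ (hgramR (u + 1))
      have e7 := empE_bonus_le hp φ hn D (c := 2 * (β + β')) (η := 2 * η') (by positivity) u
      rw [e5]; linarith
    have e8 := Finset.sum_le_card_nsmul _ _ _ e4
    rw [Nat.card_Ico, nsmul_eq_mul] at e8
    have hcard : ((p.H - (h - 1) : ℕ) : ℝ) ≤ p.H := by exact_mod_cast Nat.sub_le _ _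
    set q := 2 * (β + β') * Real.sqrt (p.d / n) + 2 * η' + 2 * p.H * Real.sqrt (L / n) with hq
    have hq0 : 0 ≤ q := by positivity
    have e9 : p.C * ∑ u ∈ Finset.Ico (h - 1) p.H, occE M π u b ≤ p.C * (p.H * q) :=
      mul_le_mul_of_nonneg_left (e8.trans (mul_le_mul_of_nonneg_right hcard hq0)) (by linarith)
    have e10 : 2 * ((p.H : ℝ) * p.H) * Real.sqrt (L / n)
        ≤ p.C * (2 * (p.H * p.H) * Real.sqrt (L / n)) :=
      le_mul_of_one_le_left (by positivity) hC1
    calc _ ≤ p.C * (p.H * q) + p.C * (2 * (p.H * p.H) * Real.sqrt (L / n)) := by linarith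
      _ = p.C * p.H * (2 * (β + β') * Real.sqrt (p.d / n) + 2 * η')
          + 4 * p.C * p.H ^ 2 * Real.sqrt (L / n) := by rw [hq]; ring
      _ ≤ εbar := hε
  refine ⟨⟨G, θo, hfeas⟩, ?_⟩
  rintro κ hκ0 hκ G' θ' ⟨hfeas', hopt⟩ π' ⟨g, hg, rfl⟩
  -- The guess of the solution may be bad. Still, its confidence sets contain parameters of a true
  -- policy, and by feasibility they are narrow on the data.
  obtain ⟨σ', θo', hσ', hreal_o', hmem_o'⟩ := hRexists G' hfeas'.1
  set ξ := p.C * (εbar + 2 * p.H * Real.sqrt (L / n)) + η with hξdef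
  have hcoord : ∀ t < p.H, ∀ x ∈ Theta p M.stage φ D β G' (t + 1), ∀ i, |x i| ≤ R :=
    fun t ht x hx i => (abs_coord_le_norm _ _).trans
      ((((mem_Theta_iff M.stage φ D β G' (by omega) x).1 hx).1).trans hR1)
  have hclose : ∀ s a, M.stage s ≤ p.H →
      |qBar p φ (θo' (M.stage s)) s a - qPi M σ' s a| ≤ η := fun s a hs => by
    refine (abs_clip_sub_of_mem (qPi_mem M σ' s a)).trans ?_
    rw [abs_sub_comm]
    exact (hreal_o' (M.stage s) (M.one_le_stage s) hs).2 s a rfl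
  -- From an arbitrary policy to $\pi^0$ by concentrability, from $\pi^0$ to the data by uniform
  -- deviation, and on the data by the constraint, as both parameters are in the same confidence
  -- set.
  have hdev : ∀ (ν : Policy S A), ∀ t < p.H,
      occE M ν t (fun s a => |qBar p φ (θ' (M.stage s)) s a - qPi M σ' s a|) ≤ ξ := by
    intro ν t ht
    have h1 : occE M ν t (fun s a => |qBar p φ (θ' (M.stage s)) s a - qPi M σ' s a|)
        ≤ occE M ν t (fun s a =>
          |qBar p φ (θ' (t + 1)) s a - qBar p φ (θo' (t + 1)) s a| + η) :=
      occE_mono M ν ht.le fun s a hs => by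
        have := hclose s a (by omega)
        rw [hs] at this ⊢
        exact (abs_sub_le _ (qBar p φ (θo' (t + 1)) s a) _).trans (by linarith)
    rw [occE_add, occE_const] at h1
    have h2 := occE_le_of_concentrable (by linarith : 0 ≤ p.C) hconc ν ht
      (f := fun s a => |qBar p φ (θ' (t + 1)) s a - qBar p φ (θo' (t + 1)) s a|)
      (fun s a _ => abs_nonneg _)
    have hm1 := hfeas'.2.1 (t + 1) (by omega) (by omega)
    have hm2 := hmem_o' (t + 1) (by omega) (by omega)
    have h3 := hD.diff t ht _ _ (hcoord t ht _ hm1) (hcoord t ht _ hm2)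
    have h4 : empE D t (fun s a => |qBar p φ (θ' (t + 1)) s a - qBar p φ (θo' (t + 1)) s a|)
        ≤ εbar := by
      refine le_trans ?_ (hfeas'.2.2 (t + 1) (by omega) (by omega))
      unfold empE
      refine mul_le_mul_of_nonneg_left (Finset.sum_le_sum fun j _ => ?_) (by positivity)
      rw [stepAt_eq_seqOf, Nat.add_sub_cancel]
      set s := (seqOf (D j) t).1.1
      set a := (seqOf (D j) t).1.2
      have hab : BddAbove (Set.range fun x : Theta p M.stage φ D β G' (t + 1) =>
          qBar p φ x.1 s a) := ⟨p.H, by rintro _ ⟨x, rfl⟩; exact (qBar_mem p φ x.1 s a).2⟩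
      have hbe : BddBelow (Set.range fun x : Theta p M.stage φ D β G' (t + 1) =>
          qBar p φ x.1 s a) := ⟨0, by rintro _ ⟨x, rfl⟩; exact (qBar_mem p φ x.1 s a).1⟩
      have u1 := le_ciSup hab ⟨_, hm1⟩
      have u2 := le_ciSup hab ⟨_, hm2⟩
      have l1 := ciInf_le hbe ⟨_, hm1⟩
      have l2 := ciInf_le hbe ⟨_, hm2⟩
      rw [abs_le]
      constructor <;> linarith
    have h5 : p.C * occE M π t
        (fun s a => |qBar p φ (θ' (t + 1)) s a - qBar p φ (θo' (t + 1)) s a|)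
        ≤ p.C * (εbar + 2 * p.H * Real.sqrt (L / n)) :=
      mul_le_mul_of_nonneg_left (by linarith) (by linarith)
    rw [hξdef]; linarith
  have hpd := performance_difference M σ' hg hdev
  -- the value of the greedy action in the initial state
  have hstart : vBar p φ (θ' 1) M.start ≤ vPi M σ' M.start + ξ := by
    obtain ⟨a, ha⟩ := exists_vBar_eq p φ (θ' 1) M.start
    have h1 := hdev (fun _ => PMF.pure a) 0 hp.1
    rw [occE_zero, piAvg_pure M.start (fun _ => a), hst1] at h1
    have h2 : qPi M σ' M.start a ≤ vPi M σ' M.start := by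
      rw [vPi_eq, hσ', greedyNode, omega_first M.stage φ G' hst1]
      have := le_ciSup (Finite.bddAbove_range (qPi M σ' M.start)) a
      linarith
    rw [ha]
    linarith [(abs_le.1 h1).2]
  have hoptim : vPi M σ M.start ≤ vBar p φ (θo 1) M.start + η := by
    rw [vPi_eq, hσ, greedyNode, omega_first M.stage φ G hst1, sub_zero, one_mul, zero_mul,
      add_zero]
    refine ciSup_le fun a => ?_
    have h1 := (hreal_o 1 le_rfl hp.1).2 M.start a hst1
    rw [abs_sub_comm] at h1
    have h2 := (abs_clip_sub_of_mem (x := inner ℝ (φ M.start a) (θo 1))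
      (qPi_mem M σ M.start a)).trans h1
    have h3 := qBar_le_vBar p φ (θo 1) M.start a
    unfold qBar at h3
    linarith [(abs_le.1 h2).1]
  have hdesign := vStar_le_of_design hp hφ hη4 hreal hG π σ hσ
  have hsol := hopt G θo hfeas
  have hαH : 3 * p.alpha * p.H ≤ p.ε / 4 := by
    have hεp : 0 < p.ε := hp.2.2.1
    unfold Params.alpha
    rw [show 3 * (p.ε / (12 * ((p.H : ℝ) + 1))) * p.H = p.ε / 4 * (p.H / (p.H + 1)) by
      field_simp; norm_num]
    refine mul_le_of_le_one_right (by positivity) ?_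
    rw [div_le_one (by linarith)]
    linarith
  linarith

end GoodData

/-! ### The probability of the good event. -/

section GoodEvent

variable {S A : Type*} [Fintype S] [Fintype A] [Nonempty A] {p : Params}
  [MeasurableSpace S] [MeasurableSpace A] [DiscreteMeasurableSpace S] [DiscreteMeasurableSpace A]

theorem dataLaw_not_goodTraj (M : MDP S A p.H) (π : Policy S A) (n : ℕ) :
    dataLaw M π n {D | ¬ ∀ j, GoodTraj M (D j)} = 0 := by
  have : IsProbabilityMeasure (startLaw M π) := by unfold startLaw; infer_instance
  have h : ∀ j, ∀ᵐ D ∂(dataLaw M π n), GoodTraj M (D j) := fun j =>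
    (Measure.quasiMeasurePreserving_eval (fun _ : Fin n => startLaw M π) j).ae (ae_goodTraj M π)
  exact (ae_all_iff.2 h : ∀ᵐ D ∂(dataLaw M π n), ∀ j, GoodTraj M (D j))

theorem abs_qBar_diff_sub_le (hp : p.Valid) {φ : S → A → Vec p.d}
    (hφ : ∀ s a, ‖φ s a‖ ≤ p.L₁) {x x' y y' : Vec p.d} {ρ : ℝ} (hx : ∀ i, |x i - x' i| ≤ ρ)
    (hy : ∀ i, |y i - y' i| ≤ ρ) (s : S) (a : A) :
    |(|qBar p φ x s a - qBar p φ y s a|) - (|qBar p φ x' s a - qBar p φ y' s a|)|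
      ≤ 2 * p.L₁ * p.d * ρ := by
  have hL1 : 0 ≤ p.L₁ := hp.2.2.2.2.2.2.2.1.le
  have e1 : ‖x - x'‖ ≤ p.d * ρ := norm_le_of_coord hp.2.1 hx
  have e2 : ‖y - y'‖ ≤ p.d * ρ := norm_le_of_coord hp.2.1 hy
  have h1 := (abs_qBar_sub_le p φ hφ x x' s a).trans (mul_le_mul_of_nonneg_left e1 hL1)
  have h2 := (abs_qBar_sub_le p φ hφ y y' s a).trans (mul_le_mul_of_nonneg_left e2 hL1)
  refine (abs_abs_sub_abs_le_abs_sub _ _).trans ?_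
  rw [abs_le] at *
  constructor <;> linarith [h1.1, h1.2, h2.1, h2.2]

/-- A union bound over four kinds of events and $H$ stages, each with failure probability
$\delta/(4H)$. The skipping probability in the widths is fixed, as the good guess does not depend on
the data; so only the matrices of the bonuses have to be covered. -/
theorem dataLaw_not_goodData_le (hp : p.Valid) (M : MDP S A p.H) {φ : S → A → Vec p.d}
    (π : Policy S A) (hφ : ∀ s a, ‖φ s a‖ ≤ p.L₁) {ω : S → ℝ}
    (hω : ∀ s, ω s ∈ Set.Icc (0 : ℝ) 1) {n : ℕ} (hn : 0 < n) {c η R ρ L : ℝ} (hc : 0 ≤ c)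
    (hη : 0 ≤ η) (hR : 0 ≤ R) (hρ0 : 0 < ρ) (hρ : ρ ≤ 1) (hL0 : 0 < L) {m : ℕ}
    (hm : 2 * R / ρ + 1 ≤ m)
    (hnoise : n * (ρ * (p.L₁ * p.d * (2 * p.H) + p.L₁ * p.d * (R + 1) * (2 * (p.H * (2 * p.H
          * (Real.sqrt (2 * p.d) / p.alpha * (2 * p.L₁ * p.d)) + p.L₁ * p.d)))
          + (p.H : ℝ) ^ 2 * (p.L₁ * p.d * (p.L₁ * p.d * (R + 1))))) ≤ 1)
    (hdiff : 2 * Real.sqrt (n * L) * (2 * p.L₁ * p.d * ρ) ≤ p.H)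
    (hbonus : 2 * Real.sqrt (n * L) * (c * (p.d * p.L₁ * Real.sqrt ρ)) ≤ p.H) {K : ℝ}
    (hK1 : Fintype.card (NoiseIdx p) ≤ K) (hK2 : 2 * (p.d : ℝ) ≤ K)
    (hK3 : ((p.H : ℝ) + 2) * (p.d * p.d) ≤ K)
    (hL : K * Real.log m + Real.log (4 * p.H / p.δ) + 1 ≤ L) :
    dataLaw M π n {D | ¬ GoodData M φ π ω c η R L D} ≤ ENNReal.ofReal p.δ := by
  have hHpos : (0 : ℝ) < p.H := by exact_mod_cast hp.1
  have hδ : 0 < p.δ := hp.2.2.2.2.1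
  set δ' := p.δ / (4 * p.H) with hδ'
  have hδ'0 : 0 < δ' := by positivity
  have hm1 : (1 : ℝ) ≤ m := le_trans (by have : 0 ≤ 2 * R / ρ := by positivity
                                         linarith) hm
  have hlm : 0 ≤ Real.log m := Real.log_nonneg hm1
  have hLc : ∀ k : ℝ, k ≤ K → k * Real.log m + Real.log (1 / δ') + 1 ≤ L := fun k hk => by
    have e : 1 / δ' = 4 * p.H / p.δ := by rw [hδ', one_div_div]
    rw [e]
    have := mul_le_mul_of_nonneg_right hk hlm
    linarith
  set E : ℕ → Set (Fin n → Traj S A p.H) := fun t =>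
    {D | (∀ j, GoodTraj M (D j)) ∧ ∃ v G θ, (∀ i, |v i| ≤ R) ∧
      (∀ u ≤ p.H, ∀ i j, |G u i j| ≤ R) ∧ (∀ u ≤ p.H, ∀ j, |θ u j| ≤ R) ∧ θ (p.H + 1) = 0 ∧
      L < ∑ j, noiseExp M φ π t v G θ (D j)} with hE
  have hEle : ∀ t < p.H, dataLaw M π n (E t) ≤ ENNReal.ofReal δ' := fun t ht =>
    noise_event hp M π hφ ht.le hR hρ0 hρ hδ'0 hm hnoise (hLc _ hK1)
  set fd : (Fin p.d ⊕ Fin p.d → ℝ) → S → A → ℝ := fun w s a =>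
    |qBar p φ (WithLp.toLp 2 fun i => w (Sum.inl i)) s a
      - qBar p φ (WithLp.toLp 2 fun i => w (Sum.inr i)) s a| with hfd
  set F : ℕ → Set (Fin n → Traj S A p.H) := fun t => {D | (∀ j, GoodTraj M (D j)) ∧
    ∃ w : Fin p.d ⊕ Fin p.d → ℝ, (∀ i, |w i| ≤ R) ∧
      empE D t (fd w) + 2 * p.H * Real.sqrt (L / n) < occE M π t (fd w)} with hF
  have hFle : ∀ t < p.H, dataLaw M π n (F t) ≤ ENNReal.ofReal δ' := fun t ht =>
    class_event M π (f := fd) ht.le hn hHpos hR hρ0 hδ'0 hL0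
      (fun w s a => ⟨abs_nonneg _, by
        have h1 := qBar_mem p φ (WithLp.toLp 2 fun i => w (Sum.inl i)) s a
        have h2 := qBar_mem p φ (WithLp.toLp 2 fun i => w (Sum.inr i)) s a
        simp only [hfd]
        rw [abs_le]; constructor <;> linarith [h1.1, h1.2, h2.1, h2.2]⟩)
      (fun w w' _ hww s a => abs_qBar_diff_sub_le hp hφ (fun i => hww (Sum.inl i))
        (fun i => hww (Sum.inr i)) s a) hdiff hm (hLc _ (by
          refine le_trans (le_of_eq ?_) hK2
          simp [two_mul]))
  set fw : (Fin (p.H + 2) × Fin p.d × Fin p.d → ℝ) → S → A → ℝ := fun w =>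
    widthBound M ω π fun s a => bonus φ c η
      (Matrix.of fun i j => w (⟨M.stage s, by have := M.stage_le s; omega⟩, i, j)) s a with hfw
  set V : ℕ → Set (Fin n → Traj S A p.H) := fun t => {D | (∀ j, GoodTraj M (D j)) ∧
    ∃ w : Fin (p.H + 2) × Fin p.d × Fin p.d → ℝ, (∀ i, |w i| ≤ R) ∧
      occE M π t (fw w) + 2 * (p.H * p.H) * Real.sqrt (L / n) < empE D t (fw w)} with hV
  have hVle : ∀ t < p.H, dataLaw M π n (V t) ≤ ENNReal.ofReal δ' := fun t ht =>
    class_event' M π (f := fw) (κ := p.H * (c * (p.d * p.L₁ * Real.sqrt ρ))) ht.le hn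
      (by positivity) hR hρ0 hδ'0 hL0
      (fun w s a => widthBound_mem M hω π (fun s a => bonus_mem φ hc hη _ s a) s a)
      (fun w w' _ hww s a => widthBound_abs_sub_le M hω π
        (by have := hp.2.2.2.2.2.2.2.1.le; positivity)
        (fun s a => bonus_abs_sub_le hφ hc (fun i j => hww _) s a) s a)
      (by
        calc _ = (p.H : ℝ) * (2 * Real.sqrt (n * L) * (c * (p.d * p.L₁ * Real.sqrt ρ))) := by ring
          _ ≤ p.H * p.H := mul_le_mul_of_nonneg_left hbonus hHpos.le) hm (hLc _ (by
          refine le_trans (le_of_eq ?_) hK3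
          simp))
  set fb : (Fin p.d × Fin p.d → ℝ) → S → A → ℝ := fun w =>
    bonus φ c η (Matrix.of fun i j => w (i, j)) with hfb
  set W : ℕ → Set (Fin n → Traj S A p.H) := fun t => {D | (∀ j, GoodTraj M (D j)) ∧
    ∃ w : Fin p.d × Fin p.d → ℝ, (∀ i, |w i| ≤ R) ∧
      empE D t (fb w) + 2 * p.H * Real.sqrt (L / n) < occE M π t (fb w)} with hW
  have hWle : ∀ t < p.H, dataLaw M π n (W t) ≤ ENNReal.ofReal δ' := fun t ht =>
    class_event M π (f := fb) ht.le hn hHpos hR hρ0 hδ'0 hL0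
      (fun w s a => bonus_mem φ hc hη _ s a)
      (fun w w' _ hww s a => bonus_abs_sub_le hφ hc (fun i j => hww _) s a) hbonus hm (hLc _ (by
          refine le_trans ?_ hK3
          simp only [Fintype.card_prod, Fintype.card_fin, Nat.cast_mul]
          exact le_mul_of_one_le_left (by positivity) (by linarith)))
  have hsub : {D : Fin n → Traj S A p.H | ¬ GoodData M φ π ω c η R L D}
      ⊆ {D | ¬ ∀ j, GoodTraj M (D j)} ∪ ⋃ t ∈ Finset.range p.H, (E t ∪ F t ∪ (V t ∪ W t)) := by
    intro D hD
    by_contra hcon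
    simp only [Set.mem_union, Set.mem_ofPred_eq, not_or, not_not, Set.mem_iUnion, Finset.mem_range,
      not_exists] at hcon
    obtain ⟨hgood, hev⟩ := hcon
    refine hD ⟨hgood, fun t ht v G θ hv hG hθ hlast => ?_, fun t ht x y hx hy => ?_,
      fun t ht Y hY => ?_, fun t ht Y hY => ?_⟩
    · by_contra h
      exact (hev t ht).1.1 ⟨hgood, v, G, θ, hv, hG, hθ, hlast, not_le.1 h⟩
    · by_contra h
      exact (hev t ht).1.2 ⟨hgood, Sum.elim x.ofLp y.ofLp, by rintro (i | i) <;> simp [hx, hy],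
        not_le.1 h⟩
    · by_contra h
      exact (hev t ht).2.1 ⟨hgood, fun z => Y z.1 z.2.1 z.2.2, fun z => hY _ _ _, not_le.1 h⟩
    · by_contra h
      exact (hev t ht).2.2 ⟨hgood, fun z => Y z.1 z.2, fun z => hY _ _, not_le.1 h⟩
  refine (measure_mono hsub).trans ((measure_union_le _ _).trans ?_)
  rw [dataLaw_not_goodTraj, zero_add]
  refine (measure_biUnion_finset_le _ _).trans ?_
  have hone : ∀ t ∈ Finset.range p.H, dataLaw M π n (E t ∪ F t ∪ (V t ∪ W t))
      ≤ ENNReal.ofReal (4 * δ') := fun t ht => by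
    have ht' := Finset.mem_range.1 ht
    refine (measure_union_le _ _).trans ?_
    have h1 := (measure_union_le (μ := dataLaw M π n) (E t) (F t)).trans
      (add_le_add (hEle t ht') (hFle t ht'))
    have h2 := (measure_union_le (μ := dataLaw M π n) (V t) (W t)).trans
      (add_le_add (hVle t ht') (hWle t ht'))
    refine (add_le_add h1 h2).trans (le_of_eq ?_)
    rw [← ENNReal.ofReal_add hδ'0.le hδ'0.le, ← ENNReal.ofReal_add (by positivity) (by positivity)]
    congr 1; ring
  refine (Finset.sum_le_sum hone).trans (le_of_eq ?_)
  rw [Finset.sum_const, Finset.card_range, nsmul_eq_mul, ← ENNReal.ofReal_natCast,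
    ← ENNReal.ofReal_mul (by positivity)]
  congr 1
  rw [hδ']; field_simp

end GoodEvent

/-! ### Sample-size and misspecification rates. -/

section Rates

variable {p : Params}

theorem Params.Valid.logs_bounds (hp : p.Valid) : 1 ≤ p.logs ∧
    Real.log (1 + 1 / p.ε) ≤ p.logs - 1 ∧ Real.log (1 / p.δ) ≤ p.logs - 1 ∧
    Real.log p.H ≤ p.logs - 1 ∧ Real.log p.d ≤ p.logs - 1 ∧
    Real.log (1 + p.L₁) ≤ p.logs - 1 ∧ Real.log (1 + p.L₂) ≤ p.logs - 1 ∧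
    4 * Real.log p.C + 7 * Real.log p.H + 4 * Real.log p.d + 2 * Real.log (1 + 1 / p.ε)
      ≤ 7 * p.logs := by
  obtain ⟨hH, hd, hε, -, hδ, hδ1, hC, hL1, hL2⟩ := hp
  have h1 : 0 ≤ Real.log (1 + 1 / p.ε) :=
    Real.log_nonneg (by have : 0 < 1 / p.ε := by positivity
                        linarith)
  have h2 : 0 ≤ Real.log (1 / p.δ) := Real.log_nonneg (by rw [le_div_iff₀ hδ]; linarith)
  have h3 : 0 ≤ Real.log (p.H : ℝ) := Real.log_nonneg (by exact_mod_cast hH)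
  have h4 : 0 ≤ Real.log (p.d : ℝ) := Real.log_nonneg (by exact_mod_cast hd)
  have h5 : 0 ≤ Real.log p.C := Real.log_nonneg hC
  have h6 : 0 ≤ Real.log (1 + p.L₁) := Real.log_nonneg (by linarith)
  have h7 : 0 ≤ Real.log (1 + p.L₂) := Real.log_nonneg (by linarith)
  unfold Params.logs
  refine ⟨?_, ?_, ?_, ?_, ?_, ?_, ?_, ?_⟩ <;> linarith

theorem rpow_three_halves {x : ℝ} (hx : 0 ≤ x) : x ^ (3 / 2 : ℝ) = x * Real.sqrt x := by
  rcases hx.eq_or_lt with rfl | h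
  · simp
  · rw [show (3 / 2 : ℝ) = 1 + 1 / 2 by norm_num, Real.rpow_add h, Real.rpow_one, Real.sqrt_eq_rpow]

theorem rpow_five_halves {x : ℝ} (hx : 0 ≤ x) : x ^ (5 / 2 : ℝ) = x ^ 2 * Real.sqrt x := by
  rcases hx.eq_or_lt with rfl | h
  · simp
  · rw [show (5 / 2 : ℝ) = (2 : ℕ) + 1 / 2 by norm_num, Real.rpow_add h, Real.rpow_natCast,
      Real.sqrt_eq_rpow]

theorem Params.Valid.sqrt_sampleRate (hp : p.Valid) :
    Real.sqrt p.sampleRate = p.C ^ 2 * (p.H : ℝ) ^ 3 * Real.sqrt p.H * (p.d : ℝ) ^ 2 / p.ε := by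
  have hε := hp.2.2.1
  have hC : 0 ≤ p.C := by linarith [hp.2.2.2.2.2.2.1]
  rw [Real.sqrt_eq_iff_mul_self_eq (by unfold Params.sampleRate; positivity) (by positivity)]
  have h := Real.mul_self_sqrt (Nat.cast_nonneg (α := ℝ) p.H)
  symm
  calc _ = p.C ^ 4 * (p.H : ℝ) ^ 6 * (Real.sqrt p.H * Real.sqrt p.H) * (p.d : ℝ) ^ 4 / p.ε ^ 2 := by
        ring
    _ = _ := by rw [h]; unfold Params.sampleRate; ring

theorem Params.Valid.one_le_sampleRate (hp : p.Valid) : 1 ≤ p.sampleRate := by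
  obtain ⟨hH, hd, hε, hεH, hδ, hδ1, hC, hL1, hL2⟩ := hp
  have hH1 : (1 : ℝ) ≤ p.H := by exact_mod_cast hH
  have hd1 : (1 : ℝ) ≤ p.d := by exact_mod_cast hd
  unfold Params.sampleRate
  rw [le_div_iff₀ (by positivity), one_mul]
  calc p.ε ^ 2 ≤ (p.H : ℝ) ^ 2 := by gcongr
    _ ≤ (p.H : ℝ) ^ 7 := pow_le_pow_right₀ hH1 (by norm_num)
    _ = 1 * (p.H : ℝ) ^ 7 * 1 := by ring
    _ ≤ p.C ^ 4 * (p.H : ℝ) ^ 7 * (p.d : ℝ) ^ 4 := by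
        gcongr
        · exact one_le_pow₀ hC
        · exact one_le_pow₀ hd1

theorem Params.Valid.log_sampleRate_le (hp : p.Valid) : Real.log p.sampleRate ≤ 7 * p.logs := by
  have hb := hp.logs_bounds.2.2.2.2.2.2.2
  obtain ⟨hH, hd, hε, hεH, hδ, hδ1, hC, hL1, hL2⟩ := hp
  have hH1 : (0 : ℝ) < p.H := by exact_mod_cast hH
  have hd1 : (0 : ℝ) < p.d := by exact_mod_cast hd
  have e : p.sampleRate = p.C ^ 4 * (p.H : ℝ) ^ 7 * (p.d : ℝ) ^ 4 * (1 / p.ε) ^ 2 := by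
    unfold Params.sampleRate; field_simp
  rw [e, Real.log_mul (by positivity) (by positivity), Real.log_mul (by positivity) (by positivity),
    Real.log_mul (by positivity) (by positivity), Real.log_pow, Real.log_pow, Real.log_pow,
    Real.log_pow]
  have : Real.log (1 / p.ε) ≤ Real.log (1 + 1 / p.ε) :=
    Real.log_le_log (by positivity) (by linarith)
  push_cast
  linarith

/-- A lower bound with a logarithmic factor of the other parameters absorbs a factor `log n`. -/
theorem sq_log_mul_le {ℓ r k : ℝ} (hℓ : 1 ≤ ℓ) (hr : 1 ≤ r) (hlog : Real.log r ≤ 7 * ℓ)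
    (hk : 0 ≤ k) {n : ℝ} (hn : 1 ≤ n) (h : (256 * k + 4096 * k ^ 2) * ℓ ^ 2 * r ≤ n) :
    k * (ℓ + Real.log n) ^ 2 * r ≤ n := by
  set x := n / r with hx
  have hr0 : 0 < r := by linarith
  have hx0 : 0 < x := by positivity
  have hnx : n = x * r := by rw [hx]; field_simp
  have hxl : (256 * k + 4096 * k ^ 2) * ℓ ^ 2 ≤ x := by rw [hx, le_div_iff₀ hr0]; exact h
  have hlogn : Real.log n = Real.log x + Real.log r := by
    rw [hnx, Real.log_mul hx0.ne' hr0.ne']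
  -- With $y=x^{1/4}$ one has $\log x\le4y$, hence $(\ell+\log n)^2\le128\ell^2+32y^2$. The two
  -- terms of the assumed lower bound on $x$ make $k$ times each summand at most $x/2$.
  set y := Real.sqrt (Real.sqrt x) with hy
  have hy0 : 0 ≤ y := Real.sqrt_nonneg _
  have hy2 : y ^ 2 = Real.sqrt x := Real.sq_sqrt (Real.sqrt_nonneg _)
  have hy4 : y ^ 4 = x := by
    rw [show y ^ 4 = (y ^ 2) ^ 2 by ring, hy2, Real.sq_sqrt hx0.le]
  have hypos : 0 < y := Real.sqrt_pos.2 (Real.sqrt_pos.2 hx0)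
  have hlogx : Real.log x ≤ 4 * y := by
    rw [← hy4, Real.log_pow]
    have := Real.log_le_sub_one_of_pos hypos
    push_cast
    linarith
  have hlogn0 : 0 ≤ Real.log n := Real.log_nonneg hn
  have hle : (ℓ + Real.log n) ^ 2 ≤ 128 * ℓ ^ 2 + 32 * y ^ 2 := by
    have h1 : ℓ + Real.log n ≤ 8 * ℓ + 4 * y := by linarith
    have h2 : (ℓ + Real.log n) ^ 2 ≤ (8 * ℓ + 4 * y) ^ 2 := by
      gcongr
    nlinarith [sq_nonneg (8 * ℓ - 4 * y)]
  have hs : 64 * k ≤ y ^ 2 := by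
    rw [hy2]
    refine Real.le_sqrt_of_sq_le ?_
    have : (64 * k) ^ 2 * 1 ≤ 4096 * k ^ 2 * ℓ ^ 2 := by
      have : (1 : ℝ) ≤ ℓ ^ 2 := one_le_pow₀ hℓ
      nlinarith [sq_nonneg k]
    have : 0 ≤ 256 * k * ℓ ^ 2 := by positivity
    nlinarith
  have h1 : k * (32 * y ^ 2) ≤ x / 2 := by
    rw [← hy4]
    nlinarith [mul_le_mul_of_nonneg_right hs (sq_nonneg y)]
  have h2 : k * (128 * ℓ ^ 2) ≤ x / 2 := by
    have : 0 ≤ 4096 * k ^ 2 * ℓ ^ 2 := by positivity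
    linarith
  rw [hnx]
  refine mul_le_mul_of_nonneg_right ?_ hr0.le
  rw [← hnx]
  calc k * (ℓ + Real.log n) ^ 2 ≤ k * (128 * ℓ ^ 2 + 32 * y ^ 2) := by gcongr
    _ ≤ x := by linarith

theorem Params.Valid.d₀_le_logs (hp : p.Valid) : (p.d₀ : ℝ) ≤ 21 * p.d * p.logs := by
  have hb := hp.logs_bounds
  have hd1 : (1 : ℝ) ≤ p.d := by exact_mod_cast hp.2.1
  refine hp.d₀_le.trans ?_
  have h1 : (p.d : ℝ) * Real.log p.d ≤ p.d * (p.logs - 1) := by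
    gcongr; exact hb.2.2.2.2.1
  nlinarith [hb.1]

/-- The factor by which the misspecification is amplified by a good guess. -/
theorem Params.Valid.amplification_le (hp : p.Valid) :
    8 * (p.H : ℝ) ^ 2 * p.d₀ / p.alpha + 1 ≤ 4033 * (p.H : ℝ) ^ 3 * p.d * p.logs / p.ε := by
  have hd0 := hp.d₀_le_logs
  have hb := hp.logs_bounds
  obtain ⟨hH, hd, hε, hεH, hδ, hδ1, hC, hL1, hL2⟩ := hp
  have hH1 : (1 : ℝ) ≤ p.H := by exact_mod_cast hH
  have hd1 : (1 : ℝ) ≤ p.d := by exact_mod_cast hd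
  unfold Params.alpha
  rw [le_div_iff₀ hε, add_mul, one_mul]
  have e : 8 * (p.H : ℝ) ^ 2 * p.d₀ / (p.ε / (12 * ((p.H : ℝ) + 1))) * p.ε
      = 96 * (p.H : ℝ) ^ 2 * (p.H + 1) * p.d₀ := by field_simp; ring
  rw [e]
  have h1 : 96 * (p.H : ℝ) ^ 2 * (p.H + 1) * p.d₀
      ≤ 96 * (p.H : ℝ) ^ 2 * (p.H + p.H) * (21 * p.d * p.logs) := by gcongr
  have h2 : p.ε ≤ (p.H : ℝ) ^ 3 * p.d * p.logs := by
    calc p.ε ≤ p.H := hεH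
      _ ≤ (p.H : ℝ) ^ 3 := le_self_pow₀ hH1 (by norm_num)
      _ = (p.H : ℝ) ^ 3 * 1 * 1 := by ring
      _ ≤ _ := by gcongr; exact hb.1
  nlinarith

end Rates

/-! ### Smallness of the misspecification and crude polynomial bounds. -/

section CrudeBounds

variable {p : Params}

/-- Here the upper bound on $n$ enters: misspecification is amplified by $\sqrt n$ in the
least-squares error, and the product of the misspecification rate with the square root of the sample
rate is $\varepsilon\sqrt H/H^2$. -/
theorem Params.Valid.misspec_bounds (hp : p.Valid) {n : ℕ} {c η : ℝ} {k : ℕ} (hη : 0 ≤ η)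
    (hn : (n : ℝ) ≤ c * p.logs ^ k * p.sampleRate)
    (hle : η ≤ p.misspecRate / (6000 * (|c| + 1) * p.logs ^ (k + 1))) :
    Real.sqrt (2 * p.d) * (8 * (p.H : ℝ) ^ 2 * p.d₀ / p.alpha + 1) * η * Real.sqrt n
        ≤ Real.sqrt p.d * (p.H * Real.sqrt p.H * p.d) ∧
      ((p.H : ℝ) + 1) * η * Real.sqrt n ≤ p.H * Real.sqrt p.H * p.d ∧
      6000 * (p.H * p.d * η) ≤ p.ε := by
  have hℓ := hp.logs_bounds.1
  have hA := hp.amplification_le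
  have hrate := hp.sqrt_sampleRate
  have hrate1 := hp.one_le_sampleRate
  have hα := hp.alpha_pos
  obtain ⟨hH, hd, hε, hεH, hδ, hδ1, hC, hL1, hL2⟩ := hp
  have hH1 : (1 : ℝ) ≤ p.H := by exact_mod_cast hH
  have hd1 : (1 : ℝ) ≤ p.d := by exact_mod_cast hd
  have hC0 : 0 < p.C := by linarith
  set ℓ := p.logs
  -- As $a\ge1$, the factor $a\ell^k$ dominates the square root of $c\ell^k$, so no square roots of
  -- logarithmic factors arise.
  set a := |c| + 1 with ha
  have ha1 : 1 ≤ a := by have := abs_nonneg c; linarith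
  set r := Real.sqrt p.H with hr
  have hr1 : 1 ≤ r := by rw [hr, Real.one_le_sqrt]; exact hH1
  have hℓk : 1 ≤ ℓ ^ k := one_le_pow₀ hℓ
  have hw : Real.sqrt n ≤ a * ℓ ^ k * Real.sqrt p.sampleRate := by
    rw [Real.sqrt_le_left (by positivity), mul_pow, Real.sq_sqrt (by linarith)]
    refine hn.trans ?_
    gcongr
    calc c * ℓ ^ k ≤ a * ℓ ^ k := by gcongr; linarith [le_abs_self c]
      _ ≤ (a * ℓ ^ k) ^ 2 := le_self_pow₀ (one_le_mul_of_one_le_of_one_le ha1 hℓk) (by norm_num)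
  rw [le_div_iff₀ (by positivity)] at hle
  have hmr : p.misspecRate * Real.sqrt p.sampleRate = p.ε * r / (p.H : ℝ) ^ 2 := by
    rw [hrate]; unfold Params.misspecRate; field_simp
  set w := Real.sqrt n
  have hw0 : 0 ≤ w := Real.sqrt_nonneg _
  have hηw : η * w * (6000 * ℓ * (p.H : ℝ) ^ 2) ≤ p.ε * r := by
    have h1 : η * w * (6000 * a * ℓ ^ (k + 1)) ≤ a * ℓ ^ k * (p.ε * r / (p.H : ℝ) ^ 2) := by
      rw [← hmr]
      have hm0 : 0 ≤ p.misspecRate := by unfold Params.misspecRate; positivity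
      calc η * w * (6000 * a * ℓ ^ (k + 1)) = (η * (6000 * a * ℓ ^ (k + 1))) * w := by ring
        _ ≤ p.misspecRate * (a * ℓ ^ k * Real.sqrt p.sampleRate) := by gcongr
        _ = _ := by ring
    have h2 : a * ℓ ^ k * (η * w * (6000 * ℓ)) ≤ a * ℓ ^ k * (p.ε * r / (p.H : ℝ) ^ 2) := by
      refine le_trans (le_of_eq ?_) h1
      ring
    have h3 := le_of_mul_le_mul_left h2 (by positivity)
    rw [le_div_iff₀ (by positivity)] at h3
    linarith
  refine ⟨?_, ?_, ?_⟩
  · have hs : Real.sqrt (2 * p.d) ≤ 1.48 * Real.sqrt p.d := by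
      rw [Real.sqrt_mul (by norm_num)]
      gcongr
      rw [Real.sqrt_le_left (by norm_num)]; norm_num
    calc _ ≤ 1.48 * Real.sqrt p.d * (4033 * (p.H : ℝ) ^ 3 * p.d * ℓ / p.ε) * η * w := by gcongr
      _ = Real.sqrt p.d * p.d * (p.H / p.ε) * (1.48 * 4033 / 6000)
            * (η * w * (6000 * ℓ * (p.H : ℝ) ^ 2)) := by field_simp
      _ ≤ Real.sqrt p.d * p.d * (p.H / p.ε) * 1 * (p.ε * r) := by gcongr; norm_num
      _ = _ := by field_simp
  · have h1 : ((p.H : ℝ) + 1) * η * w ≤ 2 * p.H * (η * w) := by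
      have : 0 ≤ η * w := by positivity
      nlinarith
    have h2 : 2 * p.H * (η * w) ≤ η * w * (6000 * ℓ * (p.H : ℝ) ^ 2) := by
      calc 2 * p.H * (η * w) = η * w * (2 * 1 * p.H) := by ring
        _ ≤ η * w * (6000 * ℓ * (p.H : ℝ) ^ 2) := by
          gcongr
          · norm_num
          · exact le_self_pow₀ hH1 (by norm_num)
    calc _ ≤ p.ε * r := h1.trans (h2.trans hηw)
      _ ≤ p.H * r := by gcongr
      _ ≤ p.H * r * p.d := le_mul_of_one_le_right (by positivity) hd1
  · have h1 : η * (6000 * 1 * 1) ≤ p.misspecRate := by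
      refine le_trans ?_ hle
      gcongr
      exact one_le_pow₀ hℓ
    have h2 : p.misspecRate * (p.H * p.d) ≤ p.ε := by
      unfold Params.misspecRate
      rw [div_mul_eq_mul_div, div_le_iff₀ (by positivity)]
      calc p.ε ^ 2 * (p.H * p.d) = p.ε * (1 * (p.ε * p.H) * p.d) := by ring
        _ ≤ p.ε * (p.C ^ 2 * (p.H : ℝ) ^ 5 * (p.d : ℝ) ^ 2) := by
          gcongr
          · exact one_le_pow₀ hC
          · calc p.ε * p.H ≤ p.H * p.H := by gcongr
              _ = (p.H : ℝ) ^ 2 := by ring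
              _ ≤ (p.H : ℝ) ^ 5 := pow_le_pow_right₀ hH1 (by norm_num)
          · exact le_self_pow₀ hd1 (by norm_num)
    calc 6000 * (p.H * p.d * η) = η * (6000 * 1 * 1) * (p.H * p.d) := by ring
      _ ≤ p.misspecRate * (p.H * p.d) := by gcongr
      _ ≤ p.ε := h2

/-- All parameters are bounded by the exponential of the sum of their logarithms. -/
theorem Params.Valid.le_exp (hp : p.Valid) {Λ : ℝ} (hΛ : p.logs ≤ Λ) :
    2 ≤ Real.exp Λ ∧ (p.H : ℝ) ≤ Real.exp Λ ∧ (p.d : ℝ) ≤ Real.exp Λ ∧ 1 / p.ε ≤ Real.exp Λ ∧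
      p.L₁ ≤ Real.exp Λ ∧ p.L₂ ≤ Real.exp Λ ∧ Λ ≤ Real.exp Λ := by
  obtain ⟨h1, h2, -, h4, h5, h6, h7, -⟩ := hp.logs_bounds
  obtain ⟨hH, hd, hε, hεH, hδ, hδ1, hC, hL1, hL2⟩ := hp
  have key : ∀ x : ℝ, 0 < x → Real.log x ≤ Λ → x ≤ Real.exp Λ := fun x hx h =>
    (Real.log_le_iff_le_exp hx).1 h
  have hε' : 0 < 1 / p.ε := by positivity
  have e1 := Real.add_one_le_exp Λ
  refine ⟨by linarith, key _ (by exact_mod_cast hH) (by linarith),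
    key _ (by exact_mod_cast hd) (by linarith), ?_, ?_, ?_, by linarith⟩
  · linarith [key (1 + 1 / p.ε) (by linarith) (by linarith)]
  · linarith [key (1 + p.L₁) (by linarith) (by linarith)]
  · linarith [key (1 + p.L₂) (by linarith) (by linarith)]

/-- Only logarithms of the box radius and of the grid size enter the final rates, so any fixed
powers of $E$ will do. -/
theorem Params.Valid.radius_bounds (hp : p.Valid) {E : ℝ} (hE : 2 ≤ E) (hH : (p.H : ℝ) ≤ E)
    (hd : (p.d : ℝ) ≤ E) (hε : 1 / p.ε ≤ E) (hL2 : p.L₂ ≤ E) (hℓ : p.logs ≤ E) :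
    1 / p.alpha ≤ E ^ 7 ∧ p.L₂' ≤ E ^ 21 ∧ 1 / p.lam ≤ E ^ 42 := by
  have hd0 := hp.d₀_le_logs
  have hℓ1 := hp.logs_bounds.1
  have hα := hp.alpha_pos
  have hL2' := hp.L₂'_pos
  obtain ⟨hH0, hd0', hε0, hεH, hδ, hδ1, hC, hL1, hL20⟩ := hp
  have hH1 : (1 : ℝ) ≤ p.H := by exact_mod_cast hH0
  have hd1 : (1 : ℝ) ≤ p.d := by exact_mod_cast hd0'
  have hpow : ∀ k : ℕ, (2 : ℝ) ^ k ≤ E ^ k := fun k => by gcongr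
  have hα' : 1 / p.alpha ≤ E ^ 7 := by
    unfold Params.alpha
    calc 1 / (p.ε / (12 * ((p.H : ℝ) + 1))) = 12 * ((p.H : ℝ) + 1) * (1 / p.ε) := by field_simp
      _ ≤ 12 * (E + E) * E := by gcongr; linarith
      _ = 24 * E ^ 2 := by ring
      _ ≤ E ^ 5 * E ^ 2 := by gcongr; linarith [hpow 5]
      _ = E ^ 7 := by ring
  have hd₀ : (p.d₀ : ℝ) ≤ E ^ 7 := by
    calc (p.d₀ : ℝ) ≤ 21 * p.d * p.logs := hd0
      _ ≤ 21 * E * E := by gcongr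
      _ = 21 * E ^ 2 := by ring
      _ ≤ E ^ 5 * E ^ 2 := by gcongr; linarith [hpow 5]
      _ = E ^ 7 := by ring
  have hL : p.L₂' ≤ E ^ 21 := by
    unfold Params.L₂'
    calc p.L₂ * (8 * (p.H : ℝ) ^ 2 * p.d₀ / p.alpha + 1)
        = p.L₂ * (8 * (p.H : ℝ) ^ 2 * p.d₀ * (1 / p.alpha) + 1) := by ring
      _ ≤ E * (E ^ 3 * E ^ 2 * E ^ 7 * E ^ 7 + E ^ 19) := by
          gcongr
          · linarith [hpow 3]
          · exact one_le_pow₀ (by linarith)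
      _ = 2 * E ^ 20 := by ring
      _ ≤ E * E ^ 20 := by gcongr
      _ = E ^ 21 := by ring
  refine ⟨hα', hL, ?_⟩
  unfold Params.lam
  have h1 : 1 ≤ (p.H : ℝ) ^ (3 / 2 : ℝ) * p.d :=
    one_le_mul_of_one_le_of_one_le (Real.one_le_rpow hH1 (by norm_num)) hd1
  calc 1 / ((p.H : ℝ) ^ (3 / 2 : ℝ) * p.d / p.L₂') ^ 2
      = (p.L₂' / ((p.H : ℝ) ^ (3 / 2 : ℝ) * p.d)) ^ 2 := by
        rw [one_div, ← inv_pow, inv_div]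
    _ ≤ (E ^ 21) ^ 2 := by
        gcongr
        exact (div_le_self hL2'.le h1).trans hL
    _ = E ^ 42 := by ring

/-- A grid of spacing $E^{-200}$ is so fine that the discretization errors of all $n$ samples add up
to at most $1$. -/
theorem noise_scale_le {E n L₁ d H κ R : ℝ} (hE : 2 ≤ E) (hn : n ≤ E) (hL₁ : L₁ ≤ E) (hd : d ≤ E)
    (hH : H ≤ E) (hκ : κ ≤ E ^ 9) (hR : R = E ^ 50) (hL0 : 0 ≤ L₁) (hd0 : 0 ≤ d)
    (hH0 : 0 ≤ H) (hκ0 : 0 ≤ κ) :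
    n * ((E ^ 200)⁻¹ * (L₁ * d * (2 * H) + L₁ * d * (R + 1) * (2 * (H * (2 * H
      * (κ * (2 * L₁ * d)) + L₁ * d))) + H ^ 2 * (L₁ * d * (L₁ * d * (R + 1))))) ≤ 1 := by
  have hE0 : 0 < E := by linarith
  have hmon : ∀ {i j : ℕ}, i ≤ j → E ^ i ≤ E ^ j := fun h => pow_le_pow_right₀ (by linarith) h
  have hone : ∀ i : ℕ, 1 ≤ E ^ i := fun i => one_le_pow₀ (by linarith)
  have hdbl : ∀ i j : ℕ, i + 1 = j → E ^ i + E ^ i ≤ E ^ j := fun i j h => by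
    rw [← h, pow_succ]; nlinarith [hone i]
  have hR1 : R + 1 ≤ E ^ 51 := by
    rw [hR]; linarith [hdbl 50 51 rfl, hone 50]
  have hR0 : 0 ≤ R := by rw [hR]; positivity
  have h1 : L₁ * d * (2 * H) ≤ E ^ 4 := by
    calc L₁ * d * (2 * H) ≤ E * E * (E * E) := by gcongr
      _ = E ^ 4 := by ring
  have h2 : 2 * H * (κ * (2 * L₁ * d)) + L₁ * d ≤ E ^ 15 := by
    calc 2 * H * (κ * (2 * L₁ * d)) + L₁ * d ≤ E * E * (E ^ 9 * (E * E * E)) + E * E := by gcongr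
      _ = E ^ 14 + E ^ 2 := by ring
      _ ≤ E ^ 15 := by linarith [hdbl 14 15 rfl, hmon (show 2 ≤ 14 by norm_num)]
  have h3 : L₁ * d * (R + 1) * (2 * (H * (2 * H * (κ * (2 * L₁ * d)) + L₁ * d))) ≤ E ^ 70 := by
    calc _ ≤ E * E * E ^ 51 * (E * (E * E ^ 15)) := by gcongr
      _ = E ^ 70 := by ring
  have h4 : H ^ 2 * (L₁ * d * (L₁ * d * (R + 1))) ≤ E ^ 57 := by
    calc _ ≤ E ^ 2 * (E * E * (E * E * E ^ 51)) := by gcongr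
      _ = E ^ 57 := by ring
  have h5 : L₁ * d * (2 * H) + L₁ * d * (R + 1) * (2 * (H * (2 * H
      * (κ * (2 * L₁ * d)) + L₁ * d))) + H ^ 2 * (L₁ * d * (L₁ * d * (R + 1))) ≤ E ^ 72 := by
    linarith [hmon (show 4 ≤ 70 by norm_num), hmon (show 57 ≤ 71 by norm_num), hdbl 70 71 rfl, hdbl 71 72 rfl]
  calc _ ≤ E * ((E ^ 200)⁻¹ * E ^ 72) := by gcongr
    _ = E ^ 73 / E ^ 200 := by field_simp
    _ ≤ 1 := by rw [div_le_one (by positivity)]; exact hmon (by norm_num)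

end CrudeBounds

/-! ### Numerical constants of the radii and of the sample size. -/

section Radii

/-- The radius `ε̄` dominates the width of the confidence sets. -/
theorem width_radius_le {H d C Λ w n e η B : ℝ} (hH : 1 ≤ H) (hd : 1 ≤ d) (hC : 1 ≤ C)
    (hΛ : 1 ≤ Λ) (hw : w = Real.sqrt n) (hn : 0 < n)
    (hB : B = 158 * Real.sqrt d * (H * Real.sqrt H * d) * Λ)
    (hη : η * w ≤ Real.sqrt d * (H * Real.sqrt H * d))
    (he : e = 1066 * Λ * (C * (H ^ 2 * Real.sqrt H) * d ^ 2 / w)) :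
    C * H * (2 * (158 * Λ * (H * Real.sqrt H * d) + B) * Real.sqrt (d / n) + 2 * η)
      + 4 * C * H ^ 2 * Real.sqrt (11552 * H * d ^ 2 * Λ ^ 2 / n) ≤ e := by
  have hH0 : 0 ≤ H := by linarith
  have hd0 : 0 ≤ d := by linarith
  have hw0 : 0 < w := by rw [hw]; exact Real.sqrt_pos.2 hn
  set r := Real.sqrt H with hr
  have hr0 : 0 ≤ r := Real.sqrt_nonneg _
  set f := Real.sqrt d with hf
  have hf1 : 1 ≤ f := by rw [hf, Real.one_le_sqrt]; exact hd
  have hff : f * f = d := Real.mul_self_sqrt hd0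
  have hfd : f ≤ d := by rw [← hff]; nlinarith
  have e1 : Real.sqrt (d / n) = f / w := by rw [Real.sqrt_div hd0, hw]
  have e2 : Real.sqrt (11552 * H * d ^ 2 * Λ ^ 2 / n) ≤ 108 * r * d * Λ / w := by
    rw [Real.sqrt_div (by positivity), ← hw]
    gcongr
    rw [Real.sqrt_le_left (by positivity)]
    have : r ^ 2 = H := Real.sq_sqrt hH0
    calc 11552 * H * d ^ 2 * Λ ^ 2 ≤ 11664 * H * d ^ 2 * Λ ^ 2 := by gcongr; norm_num
      _ = 11664 * r ^ 2 * d ^ 2 * Λ ^ 2 := by rw [this]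
      _ = (108 * r * d * Λ) ^ 2 := by ring
  have e3 : 158 * Λ * (H * r * d) ≤ B := by
    rw [hB]
    calc 158 * Λ * (H * r * d) = 158 * 1 * (H * r * d) * Λ := by ring
      _ ≤ _ := by gcongr
  have t1 : 2 * (158 * Λ * (H * r * d) + B) * Real.sqrt (d / n)
      ≤ 632 * (H * r) * d ^ 2 * Λ / w := by
    rw [e1]
    calc _ ≤ 2 * (B + B) * (f / w) := by gcongr
      _ = 632 * (H * r) * (f * f * d) * Λ / w := by rw [hB]; ring
      _ = _ := by rw [hff]; ring
  have t2 : 2 * η ≤ 2 * (H * r) * d ^ 2 * Λ / w := by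
    rw [le_div_iff₀ hw0]
    calc 2 * η * w = 2 * (η * w) := by ring
      _ ≤ 2 * (f * (H * r * d)) := by gcongr
      _ ≤ 2 * (d * (H * r * d)) * 1 := by rw [mul_one]; gcongr
      _ ≤ 2 * (d * (H * r * d)) * Λ := by gcongr
      _ = _ := by ring
  have t3 : 4 * C * H ^ 2 * Real.sqrt (11552 * H * d ^ 2 * Λ ^ 2 / n)
      ≤ 432 * (C * H ^ 2 * r) * d ^ 2 * Λ / w := by
    calc _ ≤ 4 * C * H ^ 2 * (108 * r * d * Λ / w) := by gcongr
      _ = 432 * (C * H ^ 2 * r) * d * Λ / w := by ring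
      _ ≤ _ := by gcongr; exact le_self_pow₀ hd (by norm_num)
  -- The constant of $\bar\varepsilon$ is $1066=632+2+432$: bonuses, misspecification and uniform
  -- deviations.
  calc _ ≤ C * H * (632 * (H * r) * d ^ 2 * Λ / w + 2 * (H * r) * d ^ 2 * Λ / w)
        + 432 * (C * H ^ 2 * r) * d ^ 2 * Λ / w := by gcongr
    _ = e := by rw [he]; ring

/-- The suboptimality of the output of the learner. -/
theorem suboptimality_le {H d C ε Λ w e s η rate : ℝ} (hH : 1 ≤ H) (hC : 1 ≤ C)
    (hd : 1 ≤ d) (hε : 0 < ε) (hw : 0 < w) (hs : 4 * C * H ^ 2 * s ≤ e) (hs0 : 0 ≤ s)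
    (hη0 : 0 ≤ η) (hη : 6000 * (H * d * η) ≤ ε)
    (he : e = 1066 * Λ * (C * (H ^ 2 * Real.sqrt H) * d ^ 2 / w))
    (hrate : rate = C ^ 2 * H ^ 3 * Real.sqrt H * d ^ 2 / ε) (hn : 19188 * Λ * rate ≤ w) :
    (2 * H + 1) * (C * (e + 2 * H * s) + η) + η ≤ 2 * ε / 3 := by
  have hH0 : 0 < H := by linarith
  have h1 : 2 * H * s ≤ e := by
    refine le_trans ?_ hs
    calc 2 * H * s ≤ 4 * 1 * H ^ 2 * s := by
          gcongr
          · norm_num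
          · exact le_self_pow₀ hH (by norm_num)
      _ ≤ 4 * C * H ^ 2 * s := by gcongr
  have h0 : 0 ≤ 2 * H * s := by positivity
  have h2 : (2 * H + 1) * (C * (e + 2 * H * s)) ≤ 3 * H * (C * (e + e)) := by
    have : 0 ≤ e := h0.trans h1
    gcongr
    linarith
  -- Here $6\cdot1066=6396$, and the remaining factor $3$ in $19188$ makes this term at most
  -- $\varepsilon/3$.
  have h3 : 3 * H * (C * (e + e)) ≤ ε / 3 := by
    have : 3 * H * (C * (e + e)) = 6396 * Λ * rate * ε / w := by
      rw [he, hrate]; field_simp; ring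
    rw [this, div_le_div_iff₀ hw (by norm_num)]
    calc 6396 * Λ * rate * ε * 3 = 19188 * Λ * rate * ε := by ring
      _ ≤ w * ε := by gcongr
      _ = ε * w := by ring
  have h4 : (2 * H + 1) * η + η ≤ ε / 3 := by
    have h5 : H * η ≤ H * d * η := by
      have : 0 ≤ H * η := by positivity
      nlinarith
    have h6 : η ≤ H * η := le_mul_of_one_le_left hη0 hH
    linarith
  linarith

variable {p : Params}

/-- The guess dominates: $(H+1)d_0d\le42Hd^2\ell$, where $d_0$ is linear in $d$ up to a logarithm.
The direction and the stage parameters add $1$ and $2$ to the factor. -/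
theorem Params.Valid.card_noiseIdx_le (hp : p.Valid) :
    (Fintype.card (NoiseIdx p) : ℝ) ≤ 45 * p.H * (p.d : ℝ) ^ 2 * p.logs := by
  have hd0 := hp.d₀_le_logs
  have hℓ := hp.logs_bounds.1
  have hH1 : (1 : ℝ) ≤ p.H := by exact_mod_cast hp.1
  have hd1 : (1 : ℝ) ≤ p.d := by exact_mod_cast hp.2.1
  have hd2 : (p.d : ℝ) ≤ (p.d : ℝ) ^ 2 := le_self_pow₀ hd1 (by norm_num)
  simp only [Fintype.card_sum, Fintype.card_prod, Fintype.card_fin, Nat.cast_add, Nat.cast_mul,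
    Nat.cast_one]
  have h1 : ((p.H : ℝ) + 1) * (p.d₀ * p.d) ≤ (p.H + p.H) * (21 * p.d * p.logs * p.d) := by
    gcongr
  have h2 : (p.d : ℝ) ≤ p.H * (p.d : ℝ) ^ 2 * p.logs := by
    calc (p.d : ℝ) ≤ 1 * (p.d : ℝ) ^ 2 * 1 := by linarith
      _ ≤ _ := by gcongr
  have h3 : ((p.H : ℝ) + 1) * p.d ≤ 2 * (p.H * (p.d : ℝ) ^ 2 * p.logs) := by
    calc ((p.H : ℝ) + 1) * p.d ≤ (p.H + p.H) * (p.d : ℝ) ^ 2 * 1 := by rw [mul_one]; gcongr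
      _ ≤ (p.H + p.H) * (p.d : ℝ) ^ 2 * p.logs := by gcongr
      _ = _ := by ring
  linarith

theorem Params.Valid.net_size_le (hp : p.Valid) {Λ x : ℝ} (hΛ : p.logs ≤ Λ)
    (hx : x ≤ 253 * Λ) :
    45 * p.H * (p.d : ℝ) ^ 2 * p.logs * x + Real.log (4 * p.H / p.δ) + 1
      ≤ 11552 * p.H * (p.d : ℝ) ^ 2 * Λ ^ 2 := by
  obtain ⟨hℓ, -, hb2, hb3, -⟩ := hp.logs_bounds
  obtain ⟨hH0, hd0', hε0, hεH, hδ, hδ1, hC, hL1, hL20⟩ := hp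
  have hH1 : (1 : ℝ) ≤ p.H := by exact_mod_cast hH0
  have hd1 : (1 : ℝ) ≤ p.d := by exact_mod_cast hd0'
  have hΛ1 : 1 ≤ Λ := hℓ.trans hΛ
  have h1 : Real.log (4 * p.H / p.δ) ≤ 2 + 2 * Λ := by
    have e : 4 * (p.H : ℝ) / p.δ = 2 ^ 2 * p.H * (1 / p.δ) := by ring
    rw [e, Real.log_mul (by positivity) (by positivity), Real.log_mul (by positivity) (by positivity),
      Real.log_pow]
    have := Real.log_two_lt_d9
    push_cast
    linarith
  have h2 : 2 + 2 * Λ + 1 ≤ 5 * (p.H * (p.d : ℝ) ^ 2 * Λ ^ 2) := by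
    calc 2 + 2 * Λ + 1 ≤ 5 * (1 * 1 ^ 2 * Λ ^ 2) := by nlinarith
      _ ≤ _ := by gcongr
  have h3 : 45 * p.H * (p.d : ℝ) ^ 2 * p.logs * x
      ≤ 45 * p.H * (p.d : ℝ) ^ 2 * Λ * (253 * Λ) := by
    calc _ ≤ 45 * p.H * (p.d : ℝ) ^ 2 * p.logs * (253 * Λ) := by gcongr
      _ ≤ _ := by gcongr
  have h4 : 0 ≤ p.H * (p.d : ℝ) ^ 2 * Λ ^ 2 := by positivity
  linarith

end Radii

/-! ### Choice of all parameters and conclusion. -/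

set_option maxHeartbeats 1000000 in
theorem output_suboptimality_le {p : Params} (hp : p.Valid) {n : ℕ} {c η : ℝ} {k : ℕ}
    (hn : (256 * 19188 ^ 2 + 4096 * (19188 ^ 2) ^ 2) * p.logs ^ 2 * p.sampleRate ≤ n)
    (hn' : n ≤ c * p.logs ^ k * p.sampleRate) (hη : 0 ≤ η)
    (hη' : η ≤ p.misspecRate / (6000 * (|c| + 1) * p.logs ^ (k + 1)))
    {S A : Type*} [Fintype S] [Fintype A] [Nonempty A]
    [MeasurableSpace S] [DiscreteMeasurableSpace S]
    [MeasurableSpace A] [DiscreteMeasurableSpace A]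
    (M : MDP S A p.H) {φ : S → A → Vec p.d} (hφ : ∀ s a, ‖φ s a‖ ≤ p.L₁)
    (hreal : ApproxRealizable M φ η p.L₂) {π : Policy S A} (hconc : Concentrable M π p.C) :
    dataLaw M π n
      {D | ¬ ((∃ G θ, Feasible p M.stage φ D (p.beta 158 1 n) (p.epsBar 1066 1 n) G θ) ∧
              ∀ (κ : ℝ), 0 ≤ κ → κ ≤ p.ε / 12 →
              ∀ G θ, IsSolution p M.stage φ D M.start (p.beta 158 1 n) (p.epsBar 1066 1 n) κ G θ →
              ∀ π' : Policy S A, IsGreedy p M.stage φ θ π' →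
                vStar M M.start - vPi M π' M.start ≤ p.ε)}
      ≤ ENNReal.ofReal p.δ := by
  obtain ⟨hb1, hb2, hb3⟩ := hp.misspec_bounds hη hn' hη'
  have hℓ := hp.logs_bounds.1
  have hrate1 := hp.one_le_sampleRate
  have hrate := hp.sqrt_sampleRate
  have hα := hp.alpha_pos
  have hL2' := hp.L₂'_pos
  have hlam := hp.lam_pos
  have hsl := hp.sqrt_lam
  have hp' := hp
  obtain ⟨hH, hd, hε, hεH, hδ, hδ1, hC, hL1, hL2⟩ := hp'
  have hH1 : (1 : ℝ) ≤ p.H := by exact_mod_cast hH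
  have hd1 : (1 : ℝ) ≤ p.d := by exact_mod_cast hd
  have hn1 : (1 : ℝ) ≤ n := by
    refine le_trans ?_ hn
    refine one_le_mul_of_one_le_of_one_le (one_le_mul_of_one_le_of_one_le (by norm_num)
      (one_le_pow₀ hℓ)) hrate1
  have hn0 : 0 < n := by exact_mod_cast (by linarith : (0 : ℝ) < n)
  have hnpos : (0 : ℝ) < n := by linarith
  have hlogn : 0 ≤ Real.log n := Real.log_nonneg hn1
  -- The sample-size condition is stated with $\ell$ alone; this upgrades it to $\Lambda=\ell+\log
  -- n$, as needed because $\beta$ and $\bar\varepsilon$ contain $\log n$.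
  have habs := sq_log_mul_le hℓ hrate1 hp.log_sampleRate_le (by norm_num) hn1 hn
  set Λ := p.logs + Real.log n with hΛdef
  have hΛℓ : p.logs ≤ Λ := by linarith
  have hΛ1 : 1 ≤ Λ := by linarith
  obtain ⟨hE2, hEH, hEd, hEε, hEL1, hEL2, hEΛ⟩ := hp.le_exp hΛℓ
  have hEn : (n : ℝ) ≤ Real.exp Λ := (Real.log_le_iff_le_exp hnpos).1 (by linarith)
  have hlogE : ∀ i : ℕ, Real.log (Real.exp Λ ^ i) = i * Λ := fun i => by
    rw [Real.log_pow, Real.log_exp]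
  set E := Real.exp Λ with hEdef
  have hE0 : 0 < E := by linarith
  have hE1 : 1 ≤ E := by linarith
  have hmon : ∀ {i j : ℕ}, i ≤ j → E ^ i ≤ E ^ j := fun h => pow_le_pow_right₀ hE1 h
  have hpow2 : ∀ i : ℕ, (2 : ℝ) ^ i ≤ E ^ i := fun i => by gcongr
  obtain ⟨hα7, hL21, hlam42⟩ := hp.radius_bounds hE2 hEH hEd hEε hEL2 (hΛℓ.trans hEΛ)
  set w := Real.sqrt n with hw
  have hw1 : 1 ≤ w := by rw [hw, Real.one_le_sqrt]; exact hn1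
  set r := Real.sqrt p.H with hr
  have hr1 : 1 ≤ r := by rw [hr, Real.one_le_sqrt]; exact hH1
  have hrH : r ≤ p.H := by
    rw [hr, Real.sqrt_le_left (by linarith)]; exact le_self_pow₀ hH1 (by norm_num)
  set f := Real.sqrt p.d with hf
  have hf1 : 1 ≤ f := by rw [hf, Real.one_le_sqrt]; exact hd1
  have hfd : f ≤ p.d := by
    rw [hf, Real.sqrt_le_left (by linarith)]; exact le_self_pow₀ hd1 (by norm_num)
  have hs2 : Real.sqrt (2 * p.d) ≤ 2 * f := by
    rw [Real.sqrt_mul (by norm_num)]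
    gcongr
    rw [Real.sqrt_le_left (by norm_num)]; norm_num
  have hs21 : 1 ≤ Real.sqrt (2 * p.d) := by rw [Real.one_le_sqrt]; linarith
  set η' := Real.sqrt (2 * p.d) * (8 * (p.H : ℝ) ^ 2 * p.d₀ / p.alpha + 1) * η with hη'def
  have hamp0 : 0 ≤ 8 * (p.H : ℝ) ^ 2 * p.d₀ / p.alpha := by positivity
  have hη'0 : 0 ≤ η' := by positivity
  have hη'E : η' ≤ E ^ 4 := by
    calc η' ≤ η' * w := le_mul_of_one_le_right hη'0 hw1
      _ ≤ f * (p.H * r * p.d) := hb1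
      _ ≤ E * (E * E * E) := by
          gcongr
          · exact hfd.trans hEd
          · exact hrH.trans hEH
      _ = E ^ 4 := by ring
  have hη2 : ((p.H : ℝ) + 1) * η ≤ η' := by
    rw [hη'def]
    gcongr
    have hd₀ : (1 : ℝ) ≤ p.d₀ := by
      have := hp.d₀_pos
      exact_mod_cast (by omega : 1 ≤ p.d₀)
    have hα1 : p.alpha ≤ p.H := by
      unfold Params.alpha
      exact (div_le_self hε.le (by linarith)).trans hεH
    have h1 : (p.H : ℝ) ≤ 8 * (p.H : ℝ) ^ 2 * p.d₀ / p.alpha := by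
      rw [le_div_iff₀ hα]
      calc (p.H : ℝ) * p.alpha ≤ p.H * p.H := by gcongr
        _ = 1 * (p.H : ℝ) ^ 2 * 1 := by ring
        _ ≤ _ := by gcongr; norm_num
    calc (p.H : ℝ) + 1 ≤ 1 * (8 * (p.H : ℝ) ^ 2 * p.d₀ / p.alpha + 1) := by linarith
      _ ≤ _ := by gcongr
  have hαlow : p.ε ≤ 24 * p.H * p.alpha := by
    unfold Params.alpha
    rw [mul_div_assoc', le_div_iff₀ (by positivity)]
    have : p.ε * 1 ≤ p.ε * p.H := by gcongr
    linarith
  have hdη : p.H * (192 * p.d * η) ≤ p.H * p.alpha := by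
    have : 0 ≤ p.H * p.d * η := by positivity
    have e : p.H * (192 * p.d * η) = 192 * (p.H * p.d * η) := by ring
    rw [e]; linarith
  have hdη' := le_of_mul_le_mul_left hdη (by linarith)
  have hη4 : η ≤ p.alpha / 4 := by
    have : η ≤ p.d * η := le_mul_of_one_le_left hη hd1
    linarith
  have hη3 : 2 * η ≤ p.alpha / (2 * Real.sqrt (2 * p.d)) := by
    rw [le_div_iff₀ (by positivity)]
    calc 2 * η * (2 * Real.sqrt (2 * p.d)) ≤ 2 * η * (2 * (2 * p.d)) := by
          gcongr; exact hs2.trans (by gcongr)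
      _ = 8 * (p.d * η) := by ring
      _ ≤ 192 * (p.d * η) := by gcongr; norm_num
      _ ≤ p.alpha := by linarith
  have hh3 : (p.H : ℝ) ^ (3 / 2 : ℝ) = p.H * r := rpow_three_halves (by linarith)
  have hh5 : (p.H : ℝ) ^ (5 / 2 : ℝ) = (p.H : ℝ) ^ 2 * r := rpow_five_halves (by linarith)
  have hβ : p.beta 158 1 n = 158 * Λ * (p.H * r * p.d) := by
    unfold Params.beta; rw [hh3, pow_one]
  have hεbar : p.epsBar 1066 1 n
      = 1066 * Λ * (p.C * ((p.H : ℝ) ^ 2 * r) * (p.d : ℝ) ^ 2 / w) := by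
    unfold Params.epsBar; rw [hh5, pow_one]
  -- At least $45\cdot253+5$, as required by the net, and chosen such that $2L=(152\,d\Lambda)^2H$
  -- has a simple square root.
  set L := 11552 * p.H * (p.d : ℝ) ^ 2 * Λ ^ 2 with hLdef
  have hLpos : 0 < L := by positivity
  have hsL : Real.sqrt (2 * L) * p.H = 152 * Λ * (p.H * r * p.d) := by
    have : 2 * L = (152 * p.d * Λ) ^ 2 * p.H := by rw [hLdef]; ring
    rw [this, Real.sqrt_mul (by positivity), Real.sqrt_sq (by positivity)]
    ring
  have hslL : Real.sqrt p.lam * p.L₂' = p.H * r * p.d := by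
    rw [hsl, hh3]; field_simp
  -- The radius for the linearizations of the good guess, larger than $\beta$ by the factor $\sqrt
  -- d$. The constant is $152$ for the noise plus $2(2+1)$ for regularization and misspecification.
  set B := 158 * f * (p.H * r * p.d) * Λ with hBdef
  have hhrd : 0 ≤ p.H * r * p.d := by positivity
  have hβle : 2 * (Real.sqrt p.lam * p.L₂' + ((p.H : ℝ) + 1) * η * w)
      + Real.sqrt (2 * L) * p.H ≤ p.beta 158 1 n := by
    rw [hβ, hsL, hslL]
    have : p.H * r * p.d ≤ Λ * (p.H * r * p.d) := le_mul_of_one_le_left hhrd hΛ1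
    linarith
  have hβ'le : 2 * (Real.sqrt p.lam * (Real.sqrt (2 * p.d) * p.L₂') + η' * w)
      + Real.sqrt (2 * L) * p.H ≤ B := by
    rw [hsL, mul_left_comm, hslL, hBdef]
    calc 2 * (Real.sqrt (2 * p.d) * (p.H * r * p.d) + η' * w) + 152 * Λ * (p.H * r * p.d)
        ≤ 2 * (2 * f * (p.H * r * p.d) + f * (p.H * r * p.d)) * 1
          + 152 * Λ * (1 * (p.H * r * p.d)) := by rw [mul_one, one_mul]; gcongr
      _ ≤ 2 * (2 * f * (p.H * r * p.d) + f * (p.H * r * p.d)) * Λ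
          + 152 * Λ * (f * (p.H * r * p.d)) := by gcongr
      _ = _ := by ring
  have hwid := width_radius_le hH1 hd1 hC hΛ1 hw hnpos hBdef hb1 hεbar
  rw [← hβ] at hwid
  have hβ0 : 0 ≤ p.beta 158 1 n := by rw [hβ]; positivity
  have hB0 : 0 ≤ B := by positivity
  have hfin := suboptimality_le (s := Real.sqrt (L / n)) hH1 hC hd1 hε (by linarith)
    (le_trans (le_add_of_nonneg_left (by positivity)) hwid) (Real.sqrt_nonneg _) hη hb3 hεbar hrate
    (by
      rw [hw]
      refine Real.le_sqrt_of_sq_le ?_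
      rw [mul_pow, mul_pow, Real.sq_sqrt (by linarith)]
      exact habs)
  have hRN : (Real.sqrt (2 * p.d) * p.L₂' + n * p.L₁ * (η' + 2 * p.H) / p.lam) / (p.H : ℝ) ^ 2
      ≤ E ^ 50 := by
    refine (div_le_self (by positivity) (one_le_pow₀ hH1)).trans ?_
    calc Real.sqrt (2 * p.d) * p.L₂' + n * p.L₁ * (η' + 2 * p.H) / p.lam
        = Real.sqrt (2 * p.d) * p.L₂' + n * p.L₁ * (η' + 2 * p.H) * (1 / p.lam) := by ring
      _ ≤ (E * E) * E ^ 21 + E * E * (E ^ 4 + E * E) * E ^ 42 := by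
          gcongr
          refine hs2.trans ?_
          gcongr
          exact hfd.trans hEd
      _ = E ^ 23 + E ^ 48 + E ^ 46 := by ring
      _ ≤ E ^ 48 + E ^ 48 + E ^ 48 := by
          gcongr ?_ + E ^ 48 + ?_ <;> exact hmon (by norm_num)
      _ = 3 * E ^ 48 := by ring
      _ ≤ E ^ 2 * E ^ 48 := by gcongr; linarith [hpow2 2]
      _ = E ^ 50 := by ring
  have hnL : Real.sqrt (n * L) ≤ E ^ 20 := by
    have h1 : (n : ℝ) * L ≤ E ^ 20 := by
      calc (n : ℝ) * L ≤ E * (E ^ 14 * E * E ^ 2 * E ^ 2) := by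
            rw [hLdef]; gcongr; linarith [hpow2 14]
        _ = E ^ 20 := by ring
    rw [Real.sqrt_le_left (by positivity)]
    exact h1.trans (le_self_pow₀ (one_le_pow₀ hE1) (by norm_num))
  have hsρ : Real.sqrt ((E ^ 200)⁻¹) = (E ^ 100)⁻¹ := by
    rw [show (E ^ 200)⁻¹ = ((E ^ 100)⁻¹) ^ 2 by rw [inv_pow, ← pow_mul], Real.sqrt_sq (by positivity)]
  -- The good guess is fixed before the data are drawn. The tolerance makes the design error at most
  -- $\alpha/2$ on differences of two features.
  obtain ⟨G, hGood, hG⟩ := exists_goodGuess hp hreal (τ := p.alpha / (4 * p.L₁)) (by positivity)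
  have hev : dataLaw M π n {D | ¬ GoodData M φ π (omega p M.stage φ G)
      (2 * (p.beta 158 1 n + B)) (2 * η') (E ^ 50) L D} ≤ ENNReal.ofReal p.δ := by
    refine dataLaw_not_goodData_le hp M π hφ (omega_mem M.stage φ hp G) hn0
      (ρ := (E ^ 200)⁻¹)
      (m := ⌈2 * E ^ 50 / (E ^ 200)⁻¹ + 1⌉₊) (K := 45 * p.H * (p.d : ℝ) ^ 2 * p.logs)
      (by positivity) (by positivity) (by positivity) (by positivity)
      (inv_le_one_of_one_le₀ (one_le_pow₀ hE1)) hLpos (Nat.le_ceil _) ?_ ?_ ?_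
      hp.card_noiseIdx_le ?_ ?_ ?_
    · refine noise_scale_le (κ := Real.sqrt (2 * p.d) / p.alpha) hE2 hEn hEL1 hEd hEH ?_ rfl hL1.le
        (Nat.cast_nonneg _) (Nat.cast_nonneg _)
        (by positivity)
      calc Real.sqrt (2 * p.d) / p.alpha = Real.sqrt (2 * p.d) * (1 / p.alpha) := by ring
        _ ≤ (2 * f) * E ^ 7 := by gcongr
        _ ≤ (E * E) * E ^ 7 := by gcongr; exact hfd.trans hEd
        _ = E ^ 9 := by ring
    · refine le_trans ?_ hH1
      calc 2 * Real.sqrt (n * L) * (2 * p.L₁ * p.d * (E ^ 200)⁻¹)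
          ≤ E * E ^ 20 * (E * E * E * (E ^ 200)⁻¹) := by gcongr
        _ = E ^ 24 / E ^ 200 := by rw [div_eq_mul_inv]; ring
        _ ≤ 1 := by rw [div_le_one (by positivity)]; exact hmon (by norm_num)
    · refine le_trans ?_ hH1
      have hBE : p.beta 158 1 n + B ≤ E ^ 15 := by
        have h1 : p.beta 158 1 n ≤ E ^ 14 := by
          rw [hβ]
          calc 158 * Λ * (p.H * r * p.d) ≤ E ^ 8 * E * (E * E * E) := by
                gcongr
                · linarith [hpow2 8]
                · exact hrH.trans hEH
            _ = E ^ 12 := by ring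
            _ ≤ E ^ 14 := hmon (by norm_num)
        have h2 : B ≤ E ^ 14 := by
          rw [hBdef]
          calc 158 * f * (p.H * r * p.d) * Λ ≤ E ^ 8 * E * (E * E * E) * E := by
                gcongr
                · linarith [hpow2 8]
                · exact hfd.trans hEd
                · exact hrH.trans hEH
            _ = E ^ 13 := by ring
            _ ≤ E ^ 14 := hmon (by norm_num)
        calc p.beta 158 1 n + B ≤ E ^ 14 + E ^ 14 := add_le_add h1 h2
          _ = 2 * E ^ 14 := by ring
          _ ≤ E * E ^ 14 := by gcongr
          _ = E ^ 15 := by ring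
      rw [hsρ]
      calc 2 * Real.sqrt (n * L) * (2 * (p.beta 158 1 n + B) * (p.d * p.L₁ * (E ^ 100)⁻¹))
          ≤ E * E ^ 20 * (E * E ^ 15 * (E * E * (E ^ 100)⁻¹)) := by gcongr
        _ = E ^ 39 / E ^ 100 := by rw [div_eq_mul_inv]; ring
        _ ≤ 1 := by rw [div_le_one (by positivity)]; exact hmon (by norm_num)
    · calc 2 * (p.d : ℝ) = 2 * 1 * p.d * 1 := by ring
        _ ≤ 45 * p.H * (p.d : ℝ) ^ 2 * p.logs := by
          gcongr
          · norm_num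
          · exact le_self_pow₀ hd1 (by norm_num)
    · calc ((p.H : ℝ) + 2) * (p.d * p.d) ≤ (45 * p.H) * (p.d * p.d) := by gcongr; linarith
        _ = 45 * p.H * (p.d : ℝ) ^ 2 * 1 := by ring
        _ ≤ _ := by gcongr
    · refine hp.net_size_le hΛℓ ?_
      -- Box radius $E^{50}$ and spacing $E^{-200}$ give at most $4E^{250}\le E^{253}$ grid points
      -- per coordinate, hence a logarithm of at most $253\Lambda$.
      have hm : (⌈2 * E ^ 50 / (E ^ 200)⁻¹ + 1⌉₊ : ℝ) ≤ E ^ 253 := by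
        refine (Nat.ceil_lt_add_one (by positivity)).le.trans ?_
        calc 2 * E ^ 50 / (E ^ 200)⁻¹ + 1 + 1 = 2 * E ^ 250 + 2 := by rw [div_inv_eq_mul]; ring
          _ ≤ 2 * E ^ 250 + 2 * E ^ 250 := by
              gcongr
              linarith [one_le_pow₀ hE1 (n := 250)]
          _ = 4 * E ^ 250 := by ring
          _ ≤ E ^ 3 * E ^ 250 := by gcongr; linarith [hpow2 3]
          _ = E ^ 253 := by ring
      have hmpos : (0 : ℝ) < ⌈2 * E ^ 50 / (E ^ 200)⁻¹ + 1⌉₊ := by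
        have : 0 < ⌈2 * E ^ 50 / (E ^ 200)⁻¹ + 1⌉₊ := Nat.ceil_pos.2 (by positivity)
        exact_mod_cast this
      refine (Real.log_le_log hmpos hm).trans ?_
      rw [hlogE]; norm_num
  refine (measure_mono fun D hD => ?_).trans hev
  intro hgd
  exact hD (vStar_sub_vPi_le hp hφ hη hη4 hreal hconc hGood hG hn0 hLpos.le le_rfl hη2 hη3
    (hL21.trans (hmon (by norm_num))) (hlam42.trans (hmon (by norm_num))) hRN hβle hβ'le hwid
    hfin hgd)

end OfflineRL

end

theorem theorem1 :
    -- universal constants of the hidden factors of `β`, of `ε̄` and of the lower bound on `n`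
    ∃ (cβ : ℝ) (kβ : ℕ) (cε : ℝ) (kε : ℕ) (cn : ℝ) (kn : ℕ), 0 < cβ ∧ 0 < cε ∧ 0 < cn ∧
    -- any hidden factor in the upper bound on `n`
    ∀ (cn' : ℝ) (kn' : ℕ),
    -- the hidden factor in the bound on the misspecification
    ∃ (cη : ℝ) (kη : ℕ), 0 < cη ∧
    ∀ (p : OfflineRL.Params), p.Valid →
    ∀ (n : ℕ), cn * p.logs ^ kn * p.sampleRate ≤ n → n ≤ cn' * p.logs ^ kn' * p.sampleRate →
    ∀ (η : ℝ), 0 ≤ η → η ≤ p.misspecRate / (cη * p.logs ^ kη) →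
    ∀ (S : Type*) (A : Type*) [Fintype S] [Fintype A] [Nonempty A]
      [MeasurableSpace S] [DiscreteMeasurableSpace S]
      [MeasurableSpace A] [DiscreteMeasurableSpace A]
      (M : OfflineRL.MDP S A p.H) (φ : S → A → OfflineRL.Vec p.d),
    (∀ s a, ‖φ s a‖ ≤ p.L₁) →
    OfflineRL.ApproxRealizable M φ η p.L₂ →
    ∀ (π₀ : OfflineRL.Policy S A), OfflineRL.Concentrable M π₀ p.C →
    -- outside an event of probability at most `δ`, the optimization problem is feasible and the
    -- greedy policy of each of its solutions (exact or up to `ε / 12`) is `ε`-optimal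
    OfflineRL.dataLaw M π₀ n
      {D | ¬ ((∃ G θ, OfflineRL.Feasible p M.stage φ D
                (p.beta cβ kβ n) (p.epsBar cε kε n) G θ) ∧
              ∀ (κ : ℝ), 0 ≤ κ → κ ≤ p.ε / 12 →
              ∀ G θ, OfflineRL.IsSolution p M.stage φ D M.start
                (p.beta cβ kβ n) (p.epsBar cε kε n) κ G θ →
              ∀ π' : OfflineRL.Policy S A, OfflineRL.IsGreedy p M.stage φ θ π' →
                OfflineRL.vStar M M.start - OfflineRL.vPi M π' M.start ≤ p.ε)}
      ≤ ENNReal.ofReal p.δ := by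
  -- The constant of the lower bound on $n$ is $256k+4096k^2$ with $k=19188^2$, and its logarithmic
  -- power is $2$ because the condition on $\sqrt n$ is linear in $\Lambda$. Only the
  -- misspecification constants depend on the upper bound on $n$.
  refine ⟨158, 1, 1066, 1, 256 * 19188 ^ 2 + 4096 * (19188 ^ 2) ^ 2, 2, by norm_num, by norm_num,
    by norm_num, fun c k => ⟨6000 * (|c| + 1), k + 1, by positivity, ?_⟩⟩
  intro p hp n hn hn' η hη hη' S A _ _ _ _ _ _ _ M φ hφ hreal π₀ hconc
  exact OfflineRL.output_suboptimality_le hp hn hn' hη hη' M hφ hreal hconc
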